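/- **Setting.** Let $d,r\ge 2$, $V=\{1,\dots,d\}$, $\mathcal X=\{1,\dots,r\}$, and let $P$ be an arbitrary (not necessarily forest-structured) probability distribution on $\mathcal X^d$ all of whose pairwise marginals $P_{i,j}$ ($i\ne j$) are positive everywhere. A distribution $Q$ on $\mathcal X^d$ is *Markov on* a graph $G=(V,E)$ if $Q(x_i\mid x_{\mathrm{nbd}(i)})=Q(x_i\mid x_{V\setminus i})$ for all $i\in V$. It is *forest-structured* if its pairwise marginals are positive everywhere and it is Markov on an acyclic graph; its graph $T_Q=(V,E_Q)$ is then the graph with the fewest edges on which $Q$ is Markov. A *forest projection* of $P$ is a minimizer of the Kullback–Leibler divergence $D(P\,\|\,Q)$ over all forest-structured $Q$. Let $\widetilde P$ be a forest projection whose graph $T_{\widetilde P}=(V,E_{\widetilde P})$ has the fewest edges among all forest projections, and assume that its edge set $E_{\widetilde P}$ is the only one that arises in this way. **The algorithm $\mathsf{CLThres}$.** Given samples $\mathbf x^n=(\mathbf x_1,\dots,\mathbf x_n)\in(\mathcal X^d)^n$ and a threshold $\varepsilon_n$, let $\widehat P_{i,j}$ be the empirical distribution of coordinates $i,j$ and $I(\widehat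 P_{i,j})$ its mutual information, where $I(q)=\sum_{a,b}q(a,b)\log\frac{q(a,b)}{\sum_{b'}q(a,b')\sum_{a'}q(a',b)}$. Take a maximum-weight spanning tree of $V$ for the weights $I(\widehat P_{i,j})$, list its edges $\widehat e_1,\dots,\widehat e_{d-1}$ in order of decreasing weight, and return $\widehat E_{\widehat k_n}=\{\widehat e_1,\dots,\widehat e_{\widehat k_n}\}$, where $\widehat k_n\in\{0,\dots,d-1\}$ is such that $I(\widehat P_{\widehat e_j})\ge\varepsilon_n$ for $j\le\widehat k_n$ and $I(\widehat P_{\widehat e_j})\le\varepsilon_n$ for $j>\widehat k_n$. All ties (in the tree, the sorting and the threshold) are broken arbitrarily. Let $\widetilde{\mathcal A}_n=\{\mathbf x^n:\widehat E_{\widehat k_n}(\mathbf x^n)\ne E_{\widetilde P}\}$, and let $P^n$ be the $n$-fold product of $P$. Logarithms of probabilities take values in $[-\infty,0]$. **Statement.** 1. If $T_{\widetilde P}$ is a proper forest (not a tree), there is a constant $C_P\in(1,\infty)$, independent of $\{\varepsilon_n\}$ and of the way ties are broken, such that whenever $\lim_n\varepsilon_n=0$ and $\lim_n n\varepsilon_n/\log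 n=\infty$, $$-C_P\le\liminf_{n\to\infty}\frac1{n\varepsilon_n}\log P^n(\widetilde{\mathcal A}_n)\le\limsup_{n\to\infty}\frac1{n\varepsilon_n}\log P^n(\widetilde{\mathcal A}_n)\le-1.$$ 2. If $T_{\widetilde P}$ is a tree and $\{\varepsilon_n\}$ satisfies the same two conditions, then $$\limsup_{n\to\infty}\frac1n\log P^n(\widetilde{\mathcal A}_n)<0,$$ i.e. the error probability decays exponentially fast; if moreover $P(\mathbf x)>0$ for all $\mathbf x\in\mathcal X^d$, then the limit $\lim_{n\to\infty}\frac1n\log P^n(\widetilde{\mathcal A}_n)$ exists, and it is finite and negative. -/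

import Mathlib

open MeasureTheory Filter Topology

namespace ForestLearning

/-- Mutual information of a pair distribution `q` on `Fin r × Fin r`, in nats
(terms with `q a b = 0` contribute `0`). -/
noncomputable def mutualInfo {r : ℕ} (q : Fin r → Fin r → ℝ) : ℝ :=
  ∑ a, ∑ b, q a b * Real.log (q a b / ((∑ b', q a b') * (∑ a', q a' b)))

theorem mutualInfo_swap {r : ℕ} (q : Fin r → Fin r → ℝ) :
    mutualInfo (fun a b => q b a) = mutualInfo q := by
  unfold mutualInfo
  rw [Finset.sum_comm]
  simp only [mul_comm]

/-- The marginal of `Q` on the coordinates in `S`, evaluated at `(x_j)_{j ∈ S}`. -/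
noncomputable def marginal {d r : ℕ} (Q : Measure (Fin d → Fin r)) (S : Set (Fin d))
    (x : Fin d → Fin r) : ℝ :=
  Q.real {y | ∀ j ∈ S, y j = x j}

/-- Local Markov property `Q(x_i | x_{nbd(i)}) = Q(x_i | x_{V \ i})` for all `i`, with the
denominators cleared: `Q(x) / Q(x_{V \ i}) = Q(x_i, x_{nbd(i)}) / Q(x_{nbd(i)})`. -/
def IsMarkovOn {d r : ℕ} (Q : Measure (Fin d → Fin r)) (G : SimpleGraph (Fin d)) : Prop :=
  ∀ (i : Fin d) (x : Fin d → Fin r),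
    Q.real {x} * marginal Q (G.neighborSet i) x =
      marginal Q (insert i (G.neighborSet i)) x * marginal Q {i}ᶜ x

/-- `G` is a minimal representation of `Q`: `Q` is Markov on `G`, and on no graph with fewer
edges. -/
def IsMinimalGraph {d r : ℕ} (Q : Measure (Fin d → Fin r)) (G : SimpleGraph (Fin d)) : Prop :=
  IsMarkovOn Q G ∧
    ∀ G' : SimpleGraph (Fin d), IsMarkovOn Q G' → G.edgeSet.ncard ≤ G'.edgeSet.ncard

/-- All pairwise marginals are positive everywhere. -/
def PairwisePositive {d r : ℕ} (Q : Measure (Fin d → Fin r)) : Prop :=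
  ∀ i j : Fin d, i ≠ j → ∀ a b : Fin r, 0 < Q.real {y | y i = a ∧ y j = b}

/-- `Q` is a forest-structured distribution, with (minimal) forest `G`. -/
structure IsForestModel {d r : ℕ} (Q : Measure (Fin d → Fin r)) (G : SimpleGraph (Fin d)) :
    Prop where
  isProb : IsProbabilityMeasure Q
  pos : PairwisePositive Q
  acyclic : G.IsAcyclic
  minimal : IsMinimalGraph Q G

/-- `Q`, with graph `G`, minimizes `D(P || ·)` over all forest-structured distributions. -/
def IsForestProjection {d r : ℕ} (P Q : Measure (Fin d → Fin r)) (G : SimpleGraph (Fin d)) :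
    Prop :=
  IsForestModel Q G ∧
    ∀ (Q' : Measure (Fin d → Fin r)) (G' : SimpleGraph (Fin d)), IsForestModel Q' G' →
      InformationTheory.klDiv P Q ≤ InformationTheory.klDiv P Q'

/-- A forest projection whose graph has the fewest edges among all forest projections. -/
def IsMinimalForestProjection {d r : ℕ} (P Q : Measure (Fin d → Fin r))
    (G : SimpleGraph (Fin d)) : Prop :=
  IsForestProjection P Q G ∧
    ∀ (Q' : Measure (Fin d → Fin r)) (G' : SimpleGraph (Fin d)), IsForestProjection P Q' G' →
      G.edgeSet.ncard ≤ G'.edgeSet.ncard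

/-- The pairwise type (pairwise empirical distribution) of coordinates `i`, `j` of the sample. -/
noncomputable def pairType {d r n : ℕ} (x : Fin n → Fin d → Fin r) (i j : Fin d)
    (a b : Fin r) : ℝ :=
  ((Finset.univ.filter fun l => x l i = a ∧ x l j = b).card : ℝ) / n

/-- The empirical mutual information of an unordered pair of nodes. -/
noncomputable def empMI {d r n : ℕ} (x : Fin n → Fin d → Fin r) : Sym2 (Fin d) → ℝ :=
  Sym2.lift ⟨fun i j => mutualInfo (pairType x i j), fun i j => by
    have h : pairType x j i = fun a b => pairType x i j b a := by
      funext a b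
      simp only [pairType, and_comm]
    simp only [h, mutualInfo_swap]⟩

open Classical in
/-- `T` is a maximum-weight spanning tree for the edge weights `w`. -/
def IsMWST {d : ℕ} (w : Sym2 (Fin d) → ℝ) (T : SimpleGraph (Fin d)) : Prop :=
  T.IsTree ∧ ∀ T' : SimpleGraph (Fin d), T'.IsTree →
    ∑ e ∈ T'.edgeFinset, w e ≤ ∑ e ∈ T.edgeFinset, w e

/-- `E` is a possible edge set returned by the Chow-Liu algorithm with thresholding, run on the
sample `x` with threshold `ε`. `T` is a maximum-weight spanning tree for the empirical mutual
informations, `e 0, …, e (d-2)` lists its edges in order of decreasing empirical mutual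
information, and `k` edges are kept, where the `k`-th edge of the list (if `1 ≤ k`) has weight at
least `ε` and the `(k+1)`-st (if `k < d - 1`) has weight at most `ε`. Every way of breaking ties,
in the tree, in the sorting and at the threshold, is admitted. -/
def IsCLThresOutput {d r n : ℕ} (x : Fin n → Fin d → Fin r) (ε : ℝ)
    (E : Set (Sym2 (Fin d))) : Prop :=
  ∃ (T : SimpleGraph (Fin d)) (e : Fin (d - 1) → Sym2 (Fin d)) (k : ℕ),
    IsMWST (empMI x) T ∧
    Function.Injective e ∧ Set.range e = T.edgeSet ∧
    (∀ i j, i ≤ j → empMI x (e j) ≤ empMI x (e i)) ∧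
    k ≤ d - 1 ∧
    (∀ i : Fin (d - 1), i.val + 1 = k → ε ≤ empMI x (e i)) ∧
    (∀ i : Fin (d - 1), i.val = k → empMI x (e i) ≤ ε) ∧
    E = e '' {i | i.val < k}

/-- An implementation of the algorithm: for every sample size `n` and every sample `x`, `Ehat n x`
is an edge set returned when the threshold is `ε n`. -/
def IsCLThres {d r : ℕ} (ε : ℕ → ℝ)
    (Ehat : (n : ℕ) → (Fin n → Fin d → Fin r) → Set (Sym2 (Fin d))) : Prop :=
  ∀ (n : ℕ) (x : Fin n → Fin d → Fin r), IsCLThresOutput x (ε n) (Ehat n x)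

/-- The conditions `ε_n → 0` and `n ε_n / log n → ∞`. -/
def IsRegularization (ε : ℕ → ℝ) : Prop :=
  Tendsto ε atTop (𝓝 0) ∧ Tendsto (fun n : ℕ => n * ε n / Real.log n) atTop atTop

/-- The logarithm, in `[-∞, ∞]`, of the probability under `P^n` that the returned edge set is not
the edge set of `G`. -/
noncomputable def logErr {d r : ℕ} (P : Measure (Fin d → Fin r)) [IsProbabilityMeasure P]
    (G : SimpleGraph (Fin d))
    (Ehat : (n : ℕ) → (Fin n → Fin d → Fin r) → Set (Sym2 (Fin d))) (n : ℕ) : EReal :=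
  ENNReal.log ((Measure.pi fun _ : Fin n => P) {x | Ehat n x ≠ G.edgeSet})

end ForestLearning

/-! Write w(e) for the mutual information of P on the pair e. A forest model factorizes over its
forest (`factorizes_of_isMarkovMass`), and among laws factorizing over a tree T the unique one
closest to P is the product of node marginals and pair ratios along T (`chowLiu`), at divergence
const − w(T). Optimal trees are therefore the maximum-weight spanning trees, and discarding their
edges of weight zero gives minimal graphs. Uniqueness of the minimal edge set thus says that every
maximum-weight spanning tree for w is G plus edges of weight zero (`deleteEdges_zero_eq_of_isMWST`).
For small thresholds the algorithm errs only if some empirical weight is off by a fixed δ, or some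
edge of weight zero has empirical weight at least ε_n (`exists_forall_output_eq`).

The first event has probability at most poly(n)·exp(−nc). For the second, the method of types bounds
the probability by poly(n)·exp(−n·D), where D is the least relative entropy to P of a type in the
event; an edge independent under P satisfies I_q(e) ≤ D(q‖P) (`pairMI_le_relEnt`), so D ≥ ε_n. As
n·ε_n dominates log n, polynomial factors vanish and the bound −1 results. For the lower bound, take
a and b in different components of G. They are independent under P, and a dependence of order √ε_n
can be created at cost D(q‖P) = O(ε_n) (`exists_dependent_perturbation`). Under q the empirical
weight of ab exceeds ε_n with probability at least 1/2, and then G cannot be the output; a change of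
measure brings this back to P.

If G is a tree, it is the only maximum-weight spanning tree and has no edge of weight zero, so only
the exponentially small event remains. For positive P the exact rate is K = min D(q‖P) over the
compact `failureSet`, where G is not the unique heaviest tree or has an edge of weight zero. The
method of types gives one inequality. For the other, ties may be broken in favour of G, so the
minimizer is approximated by laws that force an error: exchange one edge, then lower the weight of
the removed edge by resampling one coordinate (`exists_isFailing_relEnt_lt`). -/

namespace ForestLearning

/-! ### Relative entropy, the method of types and change of measure on a finite alphabet. -/

section FiniteAlphabet

set_option linter.unusedSectionVars false

variable {α : Type*} [Fintype α]

/-- Relative entropy of two mass functions on a finite type. -/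
noncomputable def relEnt (q p : α → ℝ) : ℝ := ∑ a, q a * Real.log (q a / p a)

/-- Apply log t ≤ t − 1 to t = √(m/q). Requiring only that `m` has no more mass than `q` allows
subprobabilities `m`, which the change of measure uses. -/
theorem sum_sq_sqrt_sub_le_relEnt {q m : α → ℝ} (hq : ∀ a, 0 ≤ q a) (hm : ∀ a, 0 ≤ m a)
    (hac : ∀ a, m a = 0 → q a = 0) (hs : ∑ a, m a ≤ ∑ a, q a) :
    ∑ a, (√(q a) - √(m a)) ^ 2 ≤ relEnt q m := by
  have key : ∀ a, 2 * q a - 2 * (√(q a) * √(m a)) ≤ q a * Real.log (q a / m a) := by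
    intro a
    rcases (hq a).eq_or_lt with h0 | h0
    · simp [← h0]
    have hma : 0 < m a := (hm a).lt_of_ne fun h => h0.ne' (hac a h.symm)
    have hsq : 0 < √(q a) := Real.sqrt_pos.2 h0
    have hsm : 0 < √(m a) := Real.sqrt_pos.2 hma
    have h1 := Real.log_le_sub_one_of_pos (div_pos hsm hsq)
    have h2 : Real.log (q a / m a) = -2 * Real.log (√(m a) / √(q a)) := by
      rw [Real.log_div h0.ne' hma.ne', Real.log_div hsm.ne' hsq.ne', Real.log_sqrt (hq a),
        Real.log_sqrt (hm a)]
      ring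
    rw [h2]
    have h3 : q a * (√(m a) / √(q a)) = √(q a) * √(m a) := by
      conv_lhs => rw [← Real.mul_self_sqrt (hq a)]
      field_simp
      rw [Real.sq_sqrt (hq a)]
    nlinarith [mul_le_mul_of_nonneg_left h1 h0.le]
  have h1 : ∑ a, (√(q a) - √(m a)) ^ 2 =
      ∑ a, (2 * q a - 2 * (√(q a) * √(m a))) + (∑ a, m a - ∑ a, q a) := by
    rw [← Finset.sum_sub_distrib, ← Finset.sum_add_distrib]
    refine Finset.sum_congr rfl fun a _ => ?_
    nlinarith [Real.mul_self_sqrt (hq a), Real.mul_self_sqrt (hm a)]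
  have h2 := Finset.sum_le_sum fun a (_ : a ∈ Finset.univ) => key a
  rw [h1]
  unfold relEnt
  linarith

theorem relEnt_nonneg {q m : α → ℝ} (hq : ∀ a, 0 ≤ q a) (hm : ∀ a, 0 ≤ m a)
    (hac : ∀ a, m a = 0 → q a = 0) (hs : ∑ a, m a ≤ ∑ a, q a) : 0 ≤ relEnt q m :=
  (Finset.sum_nonneg fun _ _ => sq_nonneg _).trans (sum_sq_sqrt_sub_le_relEnt hq hm hac hs)

/-- A Pinsker-type bound: q − m = (√q − √m)(√q + √m), and the second factor is at most 2. -/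
theorem sq_sub_le_relEnt {q m : α → ℝ} (hq : q ∈ stdSimplex ℝ α) (hm : m ∈ stdSimplex ℝ α)
    (hac : ∀ a, m a = 0 → q a = 0) (a : α) : (q a - m a) ^ 2 ≤ 4 * relEnt q m := by
  have h := sum_sq_sqrt_sub_le_relEnt hq.1 hm.1 hac (by rw [hq.2, hm.2])
  have h1 : (√(q a) - √(m a)) ^ 2 ≤ relEnt q m :=
    (Finset.single_le_sum (f := fun a => (√(q a) - √(m a)) ^ 2) (fun _ _ => sq_nonneg _)
      (Finset.mem_univ a)).trans h
  have le1 : ∀ {p : α → ℝ}, p ∈ stdSimplex ℝ α → √(p a) ≤ 1 := fun {p} hp => by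
    refine Real.sqrt_le_one.2 ?_
    rw [← hp.2]
    exact Finset.single_le_sum (fun b _ => hp.1 b) (Finset.mem_univ a)
  have h4 : (√(q a) + √(m a)) ^ 2 ≤ 4 := by
    nlinarith [le1 hq, le1 hm, Real.sqrt_nonneg (q a), Real.sqrt_nonneg (m a)]
  have h5 : (q a - m a) ^ 2 = (√(q a) - √(m a)) ^ 2 * (√(q a) + √(m a)) ^ 2 := by
    rw [← mul_pow]
    congr 1
    nlinarith [Real.mul_self_sqrt (hq.1 a), Real.mul_self_sqrt (hm.1 a)]
  rw [h5]
  nlinarith [sq_nonneg (√(q a) - √(m a))]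

/-- Probability of a sample of i.i.d. letters with mass function `p`. -/
def iidProb {n : ℕ} (p : α → ℝ) (x : Fin n → α) : ℝ := ∏ l, p (x l)

open Classical in
/-- Probability of a set of samples of i.i.d. letters with mass function `p`. -/
noncomputable def iidSetProb {n : ℕ} (p : α → ℝ) (A : Set (Fin n → α)) : ℝ :=
  ∑ x with x ∈ A, iidProb p x

open Classical in
/-- The empirical distribution of a sample. -/
noncomputable def empirical {n : ℕ} (x : Fin n → α) (a : α) : ℝ :=
  ((Finset.univ.filter fun l => x l = a).card : ℝ) / n

theorem iidProb_nonneg {n : ℕ} {p : α → ℝ} (hp : ∀ a, 0 ≤ p a) (x : Fin n → α) :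
    0 ≤ iidProb p x := Finset.prod_nonneg fun _ _ => hp _

theorem iidSetProb_nonneg {n : ℕ} {p : α → ℝ} (hp : ∀ a, 0 ≤ p a) (A : Set (Fin n → α)) :
    0 ≤ iidSetProb p A := Finset.sum_nonneg fun _ _ => iidProb_nonneg hp _

theorem sum_iidProb {p : α → ℝ} (hp : ∑ a, p a = 1) (n : ℕ) :
    ∑ x : Fin n → α, iidProb p x = 1 := by
  classical
  have := Finset.prod_univ_sum (fun _ : Fin n => (Finset.univ : Finset α)) (fun _ a => p a)
  simp only [hp, Finset.prod_const_one, Fintype.piFinset_univ] at this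
  exact this.symm

theorem iidSetProb_mono {n : ℕ} {p : α → ℝ} (hp : ∀ a, 0 ≤ p a) {A B : Set (Fin n → α)}
    (h : A ⊆ B) : iidSetProb p A ≤ iidSetProb p B := by
  classical
  refine Finset.sum_le_sum_of_subset_of_nonneg (fun x hx => ?_) fun _ _ _ => iidProb_nonneg hp _
  simp only [Finset.mem_filter, Finset.mem_univ, true_and] at hx ⊢
  exact h hx

theorem iidSetProb_compl {n : ℕ} {p : α → ℝ} (hp : ∑ a, p a = 1) (A : Set (Fin n → α)) :
    iidSetProb p Aᶜ = 1 - iidSetProb p A := by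
  classical
  rw [← sum_iidProb hp n, ← Finset.sum_filter_add_sum_filter_not Finset.univ (· ∈ A)]
  simp only [iidSetProb, Set.mem_compl_iff]
  ring

theorem iidSetProb_union_le {n : ℕ} {p : α → ℝ} (hp : ∀ a, 0 ≤ p a) (A B : Set (Fin n → α)) :
    iidSetProb p (A ∪ B) ≤ iidSetProb p A + iidSetProb p B := by
  classical
  simp only [iidSetProb, Set.mem_union, Finset.filter_or]
  rw [← Finset.sum_union_inter]
  exact le_add_of_nonneg_right (Finset.sum_nonneg fun _ _ => iidProb_nonneg hp _)

theorem empirical_mem_stdSimplex {n : ℕ} (hn : n ≠ 0) (x : Fin n → α) :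
    empirical x ∈ stdSimplex ℝ α := by
  classical
  refine ⟨fun a => by unfold empirical; positivity, ?_⟩
  simp only [empirical, ← Finset.sum_div]
  rw [← Nat.cast_sum, ← Finset.card_eq_sum_card_fiberwise (s := Finset.univ) (f := x)
    (fun _ _ => by simp)]
  simp [hn]

theorem sum_comp_eq_empirical {n : ℕ} (hn : n ≠ 0) (x : Fin n → α) (f : α → ℝ) :
    ∑ l, f (x l) = n * ∑ a, empirical x a * f a := by
  classical
  rw [Finset.mul_sum, ← Finset.sum_fiberwise Finset.univ x]
  refine Finset.sum_congr rfl fun a _ => ?_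
  rw [Finset.sum_congr rfl (g := fun _ => f a) (by simp +contextual)]
  have : (n : ℝ) ≠ 0 := by exact_mod_cast hn
  simp only [Finset.sum_const, nsmul_eq_mul, empirical]
  field_simp

theorem empirical_apply_pos {n : ℕ} (x : Fin n → α) (l : Fin n) : 0 < empirical x (x l) := by
  classical
  have hn : 0 < n := l.pos
  have : 0 < (Finset.univ.filter fun l' => x l' = x l).card :=
    Finset.card_pos.2 ⟨l, by simp⟩
  unfold empirical
  positivity

theorem empirical_eq_zero_of_iidProb_ne_zero {n : ℕ} {p : α → ℝ} {x : Fin n → α}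
    (hx : iidProb p x ≠ 0) (a : α) (ha : p a = 0) : empirical x a = 0 := by
  classical
  have h : (Finset.univ.filter fun l => x l = a) = ∅ := by
    ext l
    simp only [Finset.mem_filter, Finset.mem_univ, true_and, Finset.notMem_empty, iff_false]
    intro h
    exact Finset.prod_ne_zero_iff.1 hx l (Finset.mem_univ _) (h ▸ ha)
  unfold empirical
  convert zero_div (n : ℝ)
  exact_mod_cast Finset.card_eq_zero.2 h

/-- The log-likelihood ratio is a sum over letters, that is, n times a mean under the empirical
distribution. -/
theorem iidProb_eq_exp_relEnt {n : ℕ} (hn : n ≠ 0) {p : α → ℝ} (hp : ∀ a, 0 ≤ p a)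
    {x : Fin n → α} (hx : iidProb p x ≠ 0) :
    iidProb p x = Real.exp (-(n * relEnt (empirical x) p)) * iidProb (empirical x) x := by
  have hpx : ∀ l, 0 < p (x l) := fun l =>
    (hp _).lt_of_ne' (Finset.prod_ne_zero_iff.1 hx l (Finset.mem_univ _))
  have h1 : n * relEnt (empirical x) p = ∑ l, Real.log (empirical x (x l) / p (x l)) := by
    rw [sum_comp_eq_empirical hn x fun a => Real.log (empirical x a / p a)]
    rfl
  rw [h1, ← Finset.sum_neg_distrib, Real.exp_sum, iidProb, iidProb, ← Finset.prod_mul_distrib]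
  refine Finset.prod_congr rfl fun l _ => ?_
  have := empirical_apply_pos x l
  rw [← Real.log_inv, Real.exp_log (by have := hpx l; positivity)]
  have := hpx l
  field_simp

/-- Samples of one type share one empirical distribution, so together they contribute at most 1;
there are at most (n+1)^|α| vectors of letter counts. -/
theorem sum_iidProb_empirical_le {n : ℕ} (hn : n ≠ 0) :
    ∑ x : Fin n → α, iidProb (empirical x) x ≤ ((n : ℝ) + 1) ^ Fintype.card α := by
  classical
  let c : (Fin n → α) → (α → Fin (n + 1)) := fun x a =>
    ⟨(Finset.univ.filter fun l => x l = a).card,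
      Nat.lt_succ_of_le ((Finset.card_le_univ _).trans (by simp))⟩
  rw [← Finset.sum_fiberwise Finset.univ c]
  have h : ∀ k ∈ (Finset.univ : Finset (α → Fin (n + 1))),
      ∑ x with c x = k, iidProb (empirical x) x ≤ 1 := by
    intro k _
    rcases (Finset.univ.filter fun x => c x = k).eq_empty_or_nonempty with h0 | ⟨y, hy⟩
    · rw [h0]; simp
    have hy' : c y = k := by simpa using hy
    have he : ∀ x, c x = k → empirical x = empirical y := by
      intro x hx
      funext a
      have h1 : c x a = c y a := by rw [hx, hy']
      have h2 := congrArg Fin.val h1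
      simp only [c] at h2
      simp only [empirical]
      congr 1
      exact_mod_cast h2
    calc ∑ x with c x = k, iidProb (empirical x) x
        = ∑ x with c x = k, iidProb (empirical y) x := by
          refine Finset.sum_congr rfl fun x hx => ?_
          rw [he x (by simpa using hx)]
      _ ≤ ∑ x : Fin n → α, iidProb (empirical y) x :=
          Finset.sum_le_univ_sum_of_nonneg fun x =>
            iidProb_nonneg (empirical_mem_stdSimplex hn y).1 x
      _ = 1 := sum_iidProb (empirical_mem_stdSimplex hn y).2 n
  exact (Finset.sum_le_sum h).trans (by simp)

/-- Method of types, upper bound. -/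
theorem iidSetProb_le_of_le_relEnt {n : ℕ} (hn : n ≠ 0) {p : α → ℝ} (hp : ∀ a, 0 ≤ p a)
    {A : Set (Fin n → α)} {c : ℝ}
    (h : ∀ x ∈ A, iidProb p x ≠ 0 → c ≤ relEnt (empirical x) p) :
    iidSetProb p A ≤ ((n : ℝ) + 1) ^ Fintype.card α * Real.exp (-(n * c)) := by
  classical
  have h1 : ∀ x : Fin n → α, x ∈ A →
      iidProb p x ≤ Real.exp (-(n * c)) * iidProb (empirical x) x := by
    intro x hx
    have h0 : 0 ≤ iidProb (empirical x) x := iidProb_nonneg (empirical_mem_stdSimplex hn x).1 x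
    by_cases hx0 : iidProb p x = 0
    · rw [hx0]; positivity
    rw [iidProb_eq_exp_relEnt hn hp hx0]
    gcongr
    exact h x hx hx0
  calc iidSetProb p A ≤ ∑ x with x ∈ A, Real.exp (-(n * c)) * iidProb (empirical x) x :=
        Finset.sum_le_sum fun x hx => h1 x (by simpa using hx)
    _ ≤ ∑ x : Fin n → α, Real.exp (-(n * c)) * iidProb (empirical x) x :=
        Finset.sum_le_univ_sum_of_nonneg fun x => mul_nonneg (Real.exp_nonneg _)
          (iidProb_nonneg (empirical_mem_stdSimplex hn x).1 x)
    _ ≤ _ := by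
        rw [← Finset.mul_sum, mul_comm]
        gcongr
        exact sum_iidProb_empirical_le hn

theorem sum_iidProb_mul_comp {q : α → ℝ} (hq : ∑ a, q a = 1) {n : ℕ} (k : Fin n) (f : α → ℝ) :
    ∑ x : Fin n → α, iidProb q x * f (x k) = ∑ a, q a * f a := by
  classical
  have h := Finset.prod_univ_sum (fun _ : Fin n => (Finset.univ : Finset α))
    (fun l a => q a * if l = k then f a else 1)
  rw [Fintype.piFinset_univ] at h
  have h1 : ∀ x : Fin n → α, ∏ l, (q (x l) * if l = k then f (x l) else 1) =
      iidProb q x * f (x k) := by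
    intro x
    rw [Finset.prod_mul_distrib, Finset.prod_ite_eq' Finset.univ k]
    simp [iidProb]
  simp only [h1] at h
  rw [← h, Finset.prod_eq_single k]
  · simp
  · intro l _ hl
    simp [hl, hq]
  · simp

/-- Change of measure. -/
theorem neg_relEnt_le_iidSetProb_mul_log {n : ℕ} {p q : α → ℝ} (hp : p ∈ stdSimplex ℝ α)
    (hq : q ∈ stdSimplex ℝ α) (hac : ∀ a, p a = 0 → q a = 0) (A : Set (Fin n → α)) :
    -(n * relEnt q p + Real.log 2) ≤ iidSetProb q A * Real.log (iidSetProb p A) := by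
  classical
  set π := iidSetProb p A with hπ
  have hπ0 : 0 ≤ π := iidSetProb_nonneg hp.1 A
  have hacn : ∀ x : Fin n → α, iidProb p x = 0 → iidProb q x = 0 := by
    intro x hx
    obtain ⟨l, hl, h0⟩ := Finset.prod_eq_zero_iff.1 hx
    exact Finset.prod_eq_zero hl (hac _ h0)
  have hpos : ∀ x ∈ A, iidProb p x ≠ 0 → 0 < π := by
    intro x hx h0
    refine lt_of_lt_of_le ((iidProb_nonneg hp.1 x).lt_of_ne' h0) ?_
    exact Finset.single_le_sum (f := fun x => iidProb p x) (fun y _ => iidProb_nonneg hp.1 y)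
      (by simpa using hx)
  -- The law of the sample under `p`, reweighted so that `A` and its complement have mass at most
  -- 1/2 each. Gibbs' inequality against `m` is the claim, and the halves produce log 2. If π = 0,
  -- the junk value 1/(2π) = 0 is harmless, since every sample in `A` then has probability zero.
  let m : (Fin n → α) → ℝ := fun x => iidProb p x * if x ∈ A then 1 / (2 * π) else 1 / 2
  have hm0 : ∀ x, 0 ≤ m x := fun x =>
    mul_nonneg (iidProb_nonneg hp.1 x) (by split_ifs <;> positivity)
  have hms : ∑ x, m x ≤ ∑ x : Fin n → α, iidProb q x := by
    rw [sum_iidProb hq.2, ← Finset.sum_filter_add_sum_filter_not Finset.univ (· ∈ A)]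
    have h1 : ∑ x with x ∈ A, m x = π * (1 / (2 * π)) := by
      rw [hπ, iidSetProb, Finset.sum_mul]
      refine Finset.sum_congr rfl fun x hx => ?_
      simp only [m, if_pos (show x ∈ A by simpa using hx)]
      rfl
    have h2 : ∑ x with x ∉ A, m x ≤ 1 / 2 := by
      calc ∑ x with x ∉ A, m x = ∑ x with x ∉ A, iidProb p x * (1 / 2) := by
            refine Finset.sum_congr rfl fun x hx => ?_
            simp only [m, if_neg (show x ∉ A by simpa using hx)]
        _ ≤ ∑ x : Fin n → α, iidProb p x * (1 / 2) :=
            Finset.sum_le_univ_sum_of_nonneg fun x =>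
              mul_nonneg (iidProb_nonneg hp.1 x) (by norm_num)
        _ = 1 / 2 := by rw [← Finset.sum_mul, sum_iidProb hp.2, one_mul]
    have h3 : π * (1 / (2 * π)) ≤ 1 / 2 := by
      rcases hπ0.eq_or_lt with h | h
      · rw [← h]; norm_num
      · field_simp; exact le_rfl
    linarith
  have hacm : ∀ x, m x = 0 → iidProb q x = 0 := by
    intro x hx
    by_cases h0 : iidProb p x = 0
    · exact hacn x h0
    exfalso
    rcases mul_eq_zero.1 hx with h | h
    · exact h0 h
    split_ifs at h with hA
    · have := hpos x hA h0
      exact (by positivity : (1 / (2 * π)) ≠ 0) h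
    · norm_num at h
  have hgibbs := relEnt_nonneg (fun x => iidProb_nonneg hq.1 x) hm0 hacm hms
  have hterm : ∀ x : Fin n → α, iidProb q x * Real.log (iidProb q x / m x) =
      iidProb q x * ∑ l, Real.log (q (x l) / p (x l)) + iidProb q x * Real.log 2 +
        (if x ∈ A then iidProb q x else 0) * Real.log π := by
    intro x
    by_cases hx : iidProb q x = 0
    · simp [hx]
    have hpx : iidProb p x ≠ 0 := fun h => hx (hacn x h)
    have h1 : ∑ l, Real.log (q (x l) / p (x l)) = Real.log (iidProb q x) -
        Real.log (iidProb p x) := by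
      rw [← Real.log_div hx hpx, iidProb, iidProb, ← Finset.prod_div_distrib, Real.log_prod]
      intro l _
      exact div_ne_zero (Finset.prod_ne_zero_iff.1 hx l (Finset.mem_univ _))
        (Finset.prod_ne_zero_iff.1 hpx l (Finset.mem_univ _))
    rw [h1]
    by_cases hA : x ∈ A
    · have hπp := hpos x hA hpx
      simp only [m, if_pos hA]
      rw [Real.log_div hx (by positivity), Real.log_mul hpx (by positivity), one_div,
        Real.log_inv, Real.log_mul two_ne_zero hπp.ne']
      ring
    · simp only [m, if_neg hA]
      rw [Real.log_div hx (by positivity), Real.log_mul hpx (by positivity), one_div,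
        Real.log_inv]
      ring
  rw [relEnt, Finset.sum_congr rfl fun x _ => hterm x, Finset.sum_add_distrib,
    Finset.sum_add_distrib, ← Finset.sum_mul, ← Finset.sum_mul, sum_iidProb hq.2,
    ← Finset.sum_filter] at hgibbs
  have hD : ∑ x : Fin n → α, iidProb q x * ∑ l, Real.log (q (x l) / p (x l)) =
      n * relEnt q p := by
    simp only [Finset.mul_sum]
    rw [Finset.sum_comm, Finset.sum_congr rfl fun l _ =>
      sum_iidProb_mul_comp hq.2 l fun a => Real.log (q a / p a)]
    simp [relEnt]
  rw [hD] at hgibbs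
  change 0 ≤ _ + iidSetProb q A * Real.log π at hgibbs
  linarith

/-- Exponential concentration of the empirical distribution. -/
theorem iidSetProb_le_of_le_abs_sub {n : ℕ} (hn : n ≠ 0) {p : α → ℝ} (hp : p ∈ stdSimplex ℝ α)
    {ρ : ℝ} (hρ : 0 ≤ ρ) {A : Set (Fin n → α)} (h : ∀ x ∈ A, ∃ a, ρ ≤ |empirical x a - p a|) :
    iidSetProb p A ≤ ((n : ℝ) + 1) ^ Fintype.card α * Real.exp (-(n * (ρ ^ 2 / 4))) := by
  refine iidSetProb_le_of_le_relEnt hn hp.1 fun x hx hx0 => ?_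
  obtain ⟨a, ha⟩ := h x hx
  have h1 := sq_sub_le_relEnt (empirical_mem_stdSimplex hn x) hp
    (empirical_eq_zero_of_iidProb_ne_zero hx0) a
  have h2 : ρ ^ 2 ≤ (empirical x a - p a) ^ 2 := by
    rw [← sq_abs (empirical x a - p a)]
    gcongr
  linarith

end FiniteAlphabet

end ForestLearning

namespace ForestLearning

/-! ### Pair marginals, mutual information as a function of the law, and perturbations of laws. -/

section PairMarginals

variable {d r : ℕ}

/-- Pair marginal of a mass function on `Fin d → Fin r`. -/
def pairMarg (q : (Fin d → Fin r) → ℝ) (i j : Fin d) (a b : Fin r) : ℝ :=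
  ∑ x with x i = a ∧ x j = b, q x

/-- Single-coordinate marginal of a mass function on `Fin d → Fin r`. -/
def nodeMarg (q : (Fin d → Fin r) → ℝ) (i : Fin d) (a : Fin r) : ℝ := ∑ x with x i = a, q x

theorem pairMarg_swap (q : (Fin d → Fin r) → ℝ) (i j : Fin d) (a b : Fin r) :
    pairMarg q j i b a = pairMarg q i j a b := by
  simp only [pairMarg, and_comm]

/-- Mutual information of an unordered pair of coordinates. -/
noncomputable def pairMI (q : (Fin d → Fin r) → ℝ) : Sym2 (Fin d) → ℝ :=
  Sym2.lift ⟨fun i j => mutualInfo (pairMarg q i j), fun i j => by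
    have h : pairMarg q j i = fun a b => pairMarg q i j b a := by
      funext a b
      exact pairMarg_swap q i j b a
    simp only [h, mutualInfo_swap]⟩

theorem pairMI_mk (q : (Fin d → Fin r) → ℝ) (i j : Fin d) :
    pairMI q s(i, j) = mutualInfo (pairMarg q i j) := rfl

theorem sum_mul_comp_pair (q : (Fin d → Fin r) → ℝ) (i j : Fin d) (h : Fin r → Fin r → ℝ) :
    ∑ x, q x * h (x i) (x j) = ∑ a, ∑ b, pairMarg q i j a b * h a b := by
  rw [← Finset.sum_product', ← Finset.sum_fiberwise Finset.univ (fun x => (x i, x j))]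
  refine Finset.sum_congr rfl fun ab _ => ?_
  rw [pairMarg, Finset.sum_mul]
  simp only [Prod.ext_iff]
  refine Finset.sum_congr rfl fun x hx => ?_
  obtain ⟨h1, h2⟩ : x i = ab.1 ∧ x j = ab.2 := by simpa using hx
  rw [h1, h2]

theorem sum_mul_comp_node (q : (Fin d → Fin r) → ℝ) (i : Fin d) (h : Fin r → ℝ) :
    ∑ x, q x * h (x i) = ∑ a, nodeMarg q i a * h a := by
  rw [← Finset.sum_fiberwise Finset.univ (fun x => x i)]
  refine Finset.sum_congr rfl fun a _ => ?_
  rw [nodeMarg, Finset.sum_mul]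
  refine Finset.sum_congr rfl fun x hx => ?_
  rw [(by simpa using hx : x i = a)]

theorem pairMarg_eq_sum_ite (q : (Fin d → Fin r) → ℝ) (i j : Fin d) (a b : Fin r) :
    pairMarg q i j a b = ∑ x, q x * if x i = a ∧ x j = b then 1 else 0 := by
  simp [pairMarg, Finset.sum_filter]

theorem nodeMarg_eq_sum_ite (q : (Fin d → Fin r) → ℝ) (i : Fin d) (a : Fin r) :
    nodeMarg q i a = ∑ x, q x * if x i = a then 1 else 0 := by
  simp [nodeMarg, Finset.sum_filter]

theorem sum_pairMarg_right (q : (Fin d → Fin r) → ℝ) (i j : Fin d) (a : Fin r) :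
    ∑ b, pairMarg q i j a b = nodeMarg q i a := by
  simp only [pairMarg_eq_sum_ite, nodeMarg_eq_sum_ite]
  rw [Finset.sum_comm]
  refine Finset.sum_congr rfl fun x _ => ?_
  rw [← Finset.mul_sum]
  congr 1
  by_cases h : x i = a <;> simp [h]

theorem sum_pairMarg_left (q : (Fin d → Fin r) → ℝ) (i j : Fin d) (b : Fin r) :
    ∑ a, pairMarg q i j a b = nodeMarg q j b := by
  simp only [← sum_pairMarg_right q j i, pairMarg_swap]

theorem sum_nodeMarg (q : (Fin d → Fin r) → ℝ) (i : Fin d) :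
    ∑ a, nodeMarg q i a = ∑ x, q x := by
  have := sum_mul_comp_node q i fun _ => 1
  simpa using this.symm

theorem pairMarg_nonneg {q : (Fin d → Fin r) → ℝ} (hq : ∀ x, 0 ≤ q x) (i j : Fin d)
    (a b : Fin r) : 0 ≤ pairMarg q i j a b := Finset.sum_nonneg fun x _ => hq x

theorem nodeMarg_nonneg {q : (Fin d → Fin r) → ℝ} (hq : ∀ x, 0 ≤ q x) (i : Fin d)
    (a : Fin r) : 0 ≤ nodeMarg q i a := Finset.sum_nonneg fun x _ => hq x

theorem le_pairMarg {q : (Fin d → Fin r) → ℝ} (hq : ∀ x, 0 ≤ q x) (i j : Fin d)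
    (x : Fin d → Fin r) : q x ≤ pairMarg q i j (x i) (x j) :=
  Finset.single_le_sum (fun y _ => hq y) (by simp)

theorem pairMarg_le_nodeMarg {q : (Fin d → Fin r) → ℝ} (hq : ∀ x, 0 ≤ q x) (i j : Fin d)
    (a b : Fin r) : pairMarg q i j a b ≤ nodeMarg q i a := by
  rw [← sum_pairMarg_right q i j]
  exact Finset.single_le_sum (fun y _ => pairMarg_nonneg hq i j a y) (Finset.mem_univ b)

theorem pairMarg_le_nodeMarg' {q : (Fin d → Fin r) → ℝ} (hq : ∀ x, 0 ≤ q x) (i j : Fin d)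
    (a b : Fin r) : pairMarg q i j a b ≤ nodeMarg q j b := by
  rw [← pairMarg_swap]
  exact pairMarg_le_nodeMarg hq j i b a

theorem nodeMarg_mem_stdSimplex {q : (Fin d → Fin r) → ℝ}
    (hq : q ∈ stdSimplex ℝ (Fin d → Fin r)) (i : Fin d) :
    nodeMarg q i ∈ stdSimplex ℝ (Fin r) :=
  ⟨nodeMarg_nonneg hq.1 i, by rw [sum_nodeMarg, hq.2]⟩

theorem nodeMarg_le_one {q : (Fin d → Fin r) → ℝ}
    (hq : q ∈ stdSimplex ℝ (Fin d → Fin r)) (i : Fin d) (a : Fin r) : nodeMarg q i a ≤ 1 := by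
  rw [← (nodeMarg_mem_stdSimplex hq i).2]
  exact Finset.single_le_sum (fun y _ => nodeMarg_nonneg hq.1 i y) (Finset.mem_univ a)

theorem mutualInfo_pairMarg (q : (Fin d → Fin r) → ℝ) (i j : Fin d) :
    mutualInfo (pairMarg q i j) = ∑ a, ∑ b, pairMarg q i j a b *
      Real.log (pairMarg q i j a b / (nodeMarg q i a * nodeMarg q j b)) := by
  simp only [mutualInfo, sum_pairMarg_right, sum_pairMarg_left]

theorem mutualInfo_pairMarg_eq_relEnt (q : (Fin d → Fin r) → ℝ) (i j : Fin d) :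
    mutualInfo (pairMarg q i j) = relEnt (fun c : Fin r × Fin r => pairMarg q i j c.1 c.2)
      (fun c => nodeMarg q i c.1 * nodeMarg q j c.2) := by
  rw [mutualInfo_pairMarg, relEnt, Fintype.sum_prod_type]

theorem pairMarg_mem_stdSimplex {q : (Fin d → Fin r) → ℝ}
    (hq : q ∈ stdSimplex ℝ (Fin d → Fin r)) (i j : Fin d) :
    (fun c : Fin r × Fin r => pairMarg q i j c.1 c.2) ∈ stdSimplex ℝ (Fin r × Fin r) := by
  refine ⟨fun c => pairMarg_nonneg hq.1 i j c.1 c.2, ?_⟩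
  rw [Fintype.sum_prod_type]
  simp only [sum_pairMarg_right, sum_nodeMarg, hq.2]

theorem nodeMarg_mul_mem_stdSimplex {q : (Fin d → Fin r) → ℝ}
    (hq : q ∈ stdSimplex ℝ (Fin d → Fin r)) (i j : Fin d) :
    (fun c : Fin r × Fin r => nodeMarg q i c.1 * nodeMarg q j c.2) ∈
      stdSimplex ℝ (Fin r × Fin r) := by
  refine ⟨fun c => mul_nonneg (nodeMarg_nonneg hq.1 i c.1) (nodeMarg_nonneg hq.1 j c.2), ?_⟩
  rw [Fintype.sum_prod_type]
  simp only [← Finset.mul_sum, sum_nodeMarg, hq.2, mul_one]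

theorem pairMarg_eq_zero_of_nodeMarg_mul {q : (Fin d → Fin r) → ℝ} (hq : ∀ x, 0 ≤ q x)
    {i j : Fin d} {a b : Fin r} (h : nodeMarg q i a * nodeMarg q j b = 0) :
    pairMarg q i j a b = 0 := by
  refine le_antisymm ?_ (pairMarg_nonneg hq i j a b)
  rcases mul_eq_zero.1 h with h | h
  · exact h ▸ pairMarg_le_nodeMarg hq i j a b
  · exact h ▸ pairMarg_le_nodeMarg' hq i j a b

theorem sq_pairMarg_sub_le {q : (Fin d → Fin r) → ℝ} (hq : q ∈ stdSimplex ℝ (Fin d → Fin r))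
    (i j : Fin d) (a b : Fin r) :
    (pairMarg q i j a b - nodeMarg q i a * nodeMarg q j b) ^ 2 ≤ 4 * pairMI q s(i, j) := by
  rw [pairMI_mk, mutualInfo_pairMarg_eq_relEnt]
  exact sq_sub_le_relEnt (pairMarg_mem_stdSimplex hq i j) (nodeMarg_mul_mem_stdSimplex hq i j)
    (fun c hc => pairMarg_eq_zero_of_nodeMarg_mul hq.1 hc) (a, b)

theorem pairMI_nonneg {q : (Fin d → Fin r) → ℝ} (hq : q ∈ stdSimplex ℝ (Fin d → Fin r))
    (e : Sym2 (Fin d)) : 0 ≤ pairMI q e := by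
  induction e with | _ i j
  rw [pairMI_mk, mutualInfo_pairMarg_eq_relEnt]
  refine relEnt_nonneg (pairMarg_mem_stdSimplex hq i j).1 (nodeMarg_mul_mem_stdSimplex hq i j).1
    (fun c hc => pairMarg_eq_zero_of_nodeMarg_mul hq.1 hc) ?_
  rw [(pairMarg_mem_stdSimplex hq i j).2, (nodeMarg_mul_mem_stdSimplex hq i j).2]

theorem pairMI_eq_zero_iff {q : (Fin d → Fin r) → ℝ} (hq : q ∈ stdSimplex ℝ (Fin d → Fin r))
    (i j : Fin d) :
    pairMI q s(i, j) = 0 ↔ ∀ a b, pairMarg q i j a b = nodeMarg q i a * nodeMarg q j b := by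
  constructor
  · intro h a b
    have h1 := sq_pairMarg_sub_le hq i j a b
    rw [h, mul_zero] at h1
    exact sub_eq_zero.1 (pow_eq_zero_iff two_ne_zero |>.1 (le_antisymm h1 (sq_nonneg _)))
  · intro h
    rw [pairMI_mk, mutualInfo_pairMarg]
    refine Finset.sum_eq_zero fun a _ => Finset.sum_eq_zero fun b _ => ?_
    rw [h]
    by_cases h0 : nodeMarg q i a * nodeMarg q j b = 0
    · simp [h0]
    · simp [div_self h0]

/-- On the simplex, mutual information is a combination of entropies, and t log t is continuous even
at 0. -/
theorem continuousOn_pairMI (e : Sym2 (Fin d)) :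
    ContinuousOn (fun q : (Fin d → Fin r) → ℝ => pairMI q e)
      (stdSimplex ℝ (Fin d → Fin r)) := by
  induction e with | _ i j
  have hp : ∀ a b, Continuous fun q : (Fin d → Fin r) → ℝ => pairMarg q i j a b := fun a b =>
    continuous_finsetSum _ fun x _ => continuous_apply x
  have hn : ∀ i a, Continuous fun q : (Fin d → Fin r) → ℝ => nodeMarg q i a := fun i a =>
    continuous_finsetSum _ fun x _ => continuous_apply x
  have hc : Continuous fun q : (Fin d → Fin r) → ℝ =>
      ∑ a, ∑ b, pairMarg q i j a b * Real.log (pairMarg q i j a b) -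
        ∑ a, nodeMarg q i a * Real.log (nodeMarg q i a) -
        ∑ b, nodeMarg q j b * Real.log (nodeMarg q j b) :=
    ((continuous_finsetSum _ fun a _ => continuous_finsetSum _ fun b _ =>
      Real.continuous_mul_log.comp (hp a b)).sub (continuous_finsetSum _ fun a _ =>
      Real.continuous_mul_log.comp (hn i a))).sub (continuous_finsetSum _ fun a _ =>
      Real.continuous_mul_log.comp (hn j a))
  refine hc.continuousOn.congr fun q hq => ?_
  simp only [pairMI_mk, mutualInfo_pairMarg]
  have h1 : ∑ a, nodeMarg q i a * Real.log (nodeMarg q i a) =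
      ∑ a, ∑ b, pairMarg q i j a b * Real.log (nodeMarg q i a) := by
    simp only [← Finset.sum_mul, sum_pairMarg_right]
  have h2 : ∑ b, nodeMarg q j b * Real.log (nodeMarg q j b) =
      ∑ a, ∑ b, pairMarg q i j a b * Real.log (nodeMarg q j b) := by
    rw [Finset.sum_comm]
    simp only [← Finset.sum_mul, sum_pairMarg_left]
  rw [h1, h2]
  simp only [← Finset.sum_sub_distrib]
  refine Finset.sum_congr rfl fun a _ => Finset.sum_congr rfl fun b _ => ?_
  by_cases h0 : pairMarg q i j a b = 0
  · simp [h0]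
  have ha : nodeMarg q i a * nodeMarg q j b ≠ 0 := fun h =>
    h0 (pairMarg_eq_zero_of_nodeMarg_mul hq.1 h)
  rw [Real.log_div h0 ha, Real.log_mul (left_ne_zero_of_mul ha) (right_ne_zero_of_mul ha)]
  ring

theorem continuous_relEnt_left {α : Type*} [Fintype α] {p : α → ℝ} (hp : ∀ a, p a ≠ 0) :
    Continuous fun q : α → ℝ => relEnt q p := by
  have h : (fun q : α → ℝ => relEnt q p) =
      fun q => ∑ a, (q a * Real.log (q a) - q a * Real.log (p a)) := by
    funext q
    refine Finset.sum_congr rfl fun a _ => ?_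
    by_cases h0 : q a = 0
    · simp [h0]
    rw [Real.log_div h0 (hp a)]
    ring
  rw [h]
  exact continuous_finsetSum _ fun a _ =>
    (Real.continuous_mul_log.comp (continuous_apply a)).sub ((continuous_apply a).mul_const _)

/-- The relative entropy to a distribution under which two coordinates are independent dominates
the mutual information of these coordinates. -/
theorem pairMI_le_relEnt {p q : (Fin d → Fin r) → ℝ} (hp : p ∈ stdSimplex ℝ (Fin d → Fin r))
    (hq : q ∈ stdSimplex ℝ (Fin d → Fin r)) (hac : ∀ x, p x = 0 → q x = 0) {e : Sym2 (Fin d)}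
    (h : pairMI p e = 0) : pairMI q e ≤ relEnt q p := by
  induction e with | _ i j
  rw [pairMI_eq_zero_iff hp] at h
  have hacn : ∀ k a, nodeMarg p k a = 0 → nodeMarg q k a = 0 := by
    intro k a h0
    refine Finset.sum_eq_zero fun x hx => hac x ?_
    exact (Finset.sum_eq_zero_iff_of_nonneg fun y _ => hp.1 y).1 h0 x hx
  have hg : ∀ k, 0 ≤ ∑ x, q x * Real.log (nodeMarg q k (x k) / nodeMarg p k (x k)) := by
    intro k
    rw [sum_mul_comp_node q k fun a => Real.log (nodeMarg q k a / nodeMarg p k a)]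
    refine relEnt_nonneg (nodeMarg_mem_stdSimplex hq k).1 (nodeMarg_mem_stdSimplex hp k).1
      (hacn k) ?_
    rw [(nodeMarg_mem_stdSimplex hq k).2, (nodeMarg_mem_stdSimplex hp k).2]
  -- The law with the pair marginal of `q` and the conditionals of `p` given the pair. The chain
  -- rule reads D(q‖p) = I_q(ij) + D(q‖m) + D(q_i‖p_i) + D(q_j‖p_j), and all terms are nonnegative.
  let m : (Fin d → Fin r) → ℝ := fun x =>
    p x * (pairMarg q i j (x i) (x j) / pairMarg p i j (x i) (x j))
  have hm0 : ∀ x, 0 ≤ m x := fun x => mul_nonneg (hp.1 x)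
    (div_nonneg (pairMarg_nonneg hq.1 _ _ _ _) (pairMarg_nonneg hp.1 _ _ _ _))
  have hpos : ∀ x, q x ≠ 0 → 0 < q x ∧ 0 < p x ∧ 0 < pairMarg q i j (x i) (x j) ∧
      0 < pairMarg p i j (x i) (x j) := by
    intro x hx
    have h1 : 0 < q x := (hq.1 x).lt_of_ne' hx
    have h2 : 0 < p x := (hp.1 x).lt_of_ne' fun h => hx (hac x h)
    exact ⟨h1, h2, h1.trans_le (le_pairMarg hq.1 i j x), h2.trans_le (le_pairMarg hp.1 i j x)⟩
  have hm := relEnt_nonneg (q := q) (m := m) hq.1 hm0 (fun x hx => by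
      by_contra h0
      obtain ⟨_, h2, h3, h4⟩ := hpos x h0
      exact (by positivity : p x * (pairMarg q i j (x i) (x j) / pairMarg p i j (x i) (x j)) ≠ 0)
        hx) (by
      simp only [m]
      rw [sum_mul_comp_pair p i j fun a b => pairMarg q i j a b / pairMarg p i j a b, hq.2,
        ← (pairMarg_mem_stdSimplex hq i j).2, Fintype.sum_prod_type]
      refine Finset.sum_le_sum fun a _ => Finset.sum_le_sum fun b _ => ?_
      by_cases h0 : pairMarg p i j a b = 0
      · simp [h0, pairMarg_nonneg hq.1]
      · exact (mul_div_cancel₀ _ h0).le)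
  rw [pairMI_mk, mutualInfo_pairMarg, ← sum_mul_comp_pair q i j fun a b =>
    Real.log (pairMarg q i j a b / (nodeMarg q i a * nodeMarg q j b))]
  have hsum : relEnt q p = ∑ x, q x * Real.log (pairMarg q i j (x i) (x j) /
      (nodeMarg q i (x i) * nodeMarg q j (x j))) + relEnt q m +
      ∑ x, q x * Real.log (nodeMarg q i (x i) / nodeMarg p i (x i)) +
      ∑ x, q x * Real.log (nodeMarg q j (x j) / nodeMarg p j (x j)) := by
    simp only [relEnt, ← Finset.sum_add_distrib]
    refine Finset.sum_congr rfl fun x _ => ?_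
    by_cases hx : q x = 0
    · simp [hx]
    obtain ⟨h1, h2, h3, h4⟩ := hpos x hx
    have h5 := h3.trans_le (pairMarg_le_nodeMarg hq.1 i j _ _)
    have h6 := h3.trans_le (pairMarg_le_nodeMarg' hq.1 i j _ _)
    have h7 := h4.trans_le (pairMarg_le_nodeMarg hp.1 i j _ _)
    have h8 := h4.trans_le (pairMarg_le_nodeMarg' hp.1 i j _ _)
    have h9 := h (x i) (x j)
    simp only [m]
    rw [h9, Real.log_div hx h2.ne', Real.log_div h3.ne' (by positivity),
      Real.log_div hx (by positivity), Real.log_mul h2.ne' (by positivity),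
      Real.log_div h3.ne' (by positivity), Real.log_mul h7.ne' h8.ne',
      Real.log_mul h5.ne' h6.ne', Real.log_div h5.ne' h7.ne', Real.log_div h6.ne' h8.ne']
    ring
  have h1 := hg i
  have h2 := hg j
  linarith

/-- Mixing towards the product of the node marginals decreases mutual information. -/
theorem pairMI_mix_le {q R : (Fin d → Fin r) → ℝ} (hq : q ∈ stdSimplex ℝ (Fin d → Fin r))
    {i j : Fin d} (hR : ∀ a b, pairMarg R i j a b = nodeMarg q i a * nodeMarg q j b)
    {t : ℝ} (ht0 : 0 ≤ t) (ht1 : t ≤ 1) :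
    pairMI (fun x => (1 - t) * q x + t * R x) s(i, j) ≤ (1 - t) * pairMI q s(i, j) := by
  set qt : (Fin d → Fin r) → ℝ := fun x => (1 - t) * q x + t * R x with hqt
  have h1 : ∀ a b, pairMarg qt i j a b =
      (1 - t) * pairMarg q i j a b + t * (nodeMarg q i a * nodeMarg q j b) := by
    intro a b
    rw [← hR, pairMarg, Finset.sum_add_distrib, ← Finset.mul_sum, ← Finset.mul_sum]
    rfl
  have h2 : ∀ a, nodeMarg qt i a = nodeMarg q i a := by
    intro a
    rw [← sum_pairMarg_right qt i j]
    simp only [h1, Finset.sum_add_distrib, ← Finset.mul_sum, sum_pairMarg_right, sum_nodeMarg,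
      hq.2]
    ring
  have h3 : ∀ b, nodeMarg qt j b = nodeMarg q j b := by
    intro b
    rw [← sum_pairMarg_left qt i j]
    simp only [h1, Finset.sum_add_distrib, ← Finset.mul_sum, sum_pairMarg_left, ← Finset.sum_mul,
      sum_nodeMarg, hq.2]
    ring
  simp only [pairMI_mk, mutualInfo_pairMarg, Finset.mul_sum]
  refine Finset.sum_le_sum fun a _ => Finset.sum_le_sum fun b _ => ?_
  rw [h1, h2, h3]
  by_cases h0 : nodeMarg q i a * nodeMarg q j b = 0
  · simp [h0]
  have hc : 0 < nodeMarg q i a * nodeMarg q j b :=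
    (mul_nonneg (nodeMarg_nonneg hq.1 i a) (nodeMarg_nonneg hq.1 j b)).lt_of_ne' h0
  set c := nodeMarg q i a * nodeMarg q j b
  set u := pairMarg q i j a b / c with hu
  have hA : pairMarg q i j a b = c * u := by rw [hu]; field_simp
  have hu0 : 0 ≤ u := div_nonneg (pairMarg_nonneg hq.1 i j a b) hc.le
  -- The ratio `u` of joint to product law is moved towards 1, where the convex function u log u
  -- vanishes.
  have hconv := Real.convexOn_mul_log.2 (Set.mem_Ici.2 hu0) (Set.mem_Ici.2 zero_le_one)
    (sub_nonneg.2 ht1) ht0 (by ring)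
  simp only [smul_eq_mul, Real.log_one, mul_zero, add_zero, mul_one] at hconv
  have e1 : ((1 - t) * pairMarg q i j a b + t * c) / c = (1 - t) * u + t := by
    rw [hA]; field_simp
  rw [e1, hA]
  nlinarith [mul_le_mul_of_nonneg_left hconv hc.le]

/-- Exchanging the coordinate x_l with `a` is an involution on the pairs (x, a). -/
theorem sum_sum_update (l : Fin d) (F : (Fin d → Fin r) → Fin r → ℝ) :
    ∑ x, ∑ a, F (Function.update x l a) (x l) = ∑ x, ∑ a, F x a := by
  simp only [← Fintype.sum_prod_type']
  refine Finset.sum_nbij' (fun c => (Function.update c.1 l c.2, c.1 l))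
    (fun c => (Function.update c.1 l c.2, c.1 l)) (by simp) (by simp) ?_ ?_ (by simp)
  · intro c _; simp
  · intro c _; simp

/-- The distribution in which coordinate `l` is resampled independently of the others. -/
def resample (q : (Fin d → Fin r) → ℝ) (l : Fin d) (x : Fin d → Fin r) : ℝ :=
  (∑ a, q (Function.update x l a)) * nodeMarg q l (x l)

theorem sum_resample_mul (q : (Fin d → Fin r) → ℝ) (l : Fin d) (f : (Fin d → Fin r) → ℝ)
    (g : Fin r → ℝ) (hf : ∀ x a, f (Function.update x l a) = f x) :
    ∑ x, resample q l x * (f x * g (x l)) =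
      (∑ x, q x * f x) * ∑ a, nodeMarg q l a * g a := by
  have h := sum_sum_update l fun x a => q x * f x * (nodeMarg q l a * g a)
  rw [Finset.sum_mul_sum, ← h]
  refine Finset.sum_congr rfl fun x _ => ?_
  rw [resample]
  simp only [hf, ← Finset.sum_mul]
  ring

theorem resample_mem_stdSimplex {q : (Fin d → Fin r) → ℝ}
    (hq : q ∈ stdSimplex ℝ (Fin d → Fin r)) (l : Fin d) :
    resample q l ∈ stdSimplex ℝ (Fin d → Fin r) := by
  refine ⟨fun x => mul_nonneg (Finset.sum_nonneg fun a _ => hq.1 _) (nodeMarg_nonneg hq.1 l _), ?_⟩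
  have := sum_resample_mul q l (fun _ => 1) (fun _ => 1) fun _ _ => rfl
  simpa [hq.2, sum_nodeMarg] using this

theorem pairMarg_resample_of_ne {q : (Fin d → Fin r) → ℝ}
    (hq : q ∈ stdSimplex ℝ (Fin d → Fin r)) {i j l : Fin d} (hi : i ≠ l) (hj : j ≠ l)
    (a b : Fin r) : pairMarg (resample q l) i j a b = pairMarg q i j a b := by
  have := sum_resample_mul q l (fun x => if x i = a ∧ x j = b then 1 else 0) (fun _ => 1)
    fun x c => by simp [hi, hj]
  simp only [mul_one, sum_nodeMarg, hq.2] at this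
  rw [pairMarg_eq_sum_ite, this, pairMarg_eq_sum_ite]

theorem pairMarg_resample_self {q : (Fin d → Fin r) → ℝ} {k l : Fin d} (hk : k ≠ l)
    (a b : Fin r) : pairMarg (resample q l) k l a b = nodeMarg q k a * nodeMarg q l b := by
  have := sum_resample_mul q l (fun x => if x k = a then 1 else 0) (fun c => if c = b then 1 else 0)
    fun x c => by simp [hk]
  have h2 : ∑ c, nodeMarg q l c * (if c = b then (1 : ℝ) else 0) = nodeMarg q l b := by simp
  rw [h2, ← nodeMarg_eq_sum_ite] at this
  rw [pairMarg_eq_sum_ite, ← this]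
  refine Finset.sum_congr rfl fun x _ => ?_
  by_cases h1 : x k = a <;> by_cases h2 : x l = b <;> simp [h1, h2]

/-- Partially resampling an endpoint of `e` outside of `e'` strictly lowers the mutual information
of `e` and preserves that of `e'`. -/
theorem exists_mem_stdSimplex_pairMI_lt {q : (Fin d → Fin r) → ℝ}
    (hq : q ∈ stdSimplex ℝ (Fin d → Fin r)) {e e' : Sym2 (Fin d)} (he : ¬ e.IsDiag)
    (hne : e ≠ e') (hpos : 0 < pairMI q e) :
    ∃ R ∈ stdSimplex ℝ (Fin d → Fin r), ∀ t : ℝ, 0 < t → t ≤ 1 →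
      pairMI (fun x => (1 - t) * q x + t * R x) e < pairMI q e ∧
      pairMI (fun x => (1 - t) * q x + t * R x) e' = pairMI q e' := by
  -- Resampling `l` leaves every pair marginal that avoids `l` unchanged. Since `e ≠ e'`, some
  -- endpoint of `e` lies outside `e'`.
  have key : ∀ k l : Fin d, k ≠ l → l ∉ e' → 0 < pairMI q s(k, l) →
      ∃ R ∈ stdSimplex ℝ (Fin d → Fin r), ∀ t : ℝ, 0 < t → t ≤ 1 →
      pairMI (fun x => (1 - t) * q x + t * R x) s(k, l) < pairMI q s(k, l) ∧
      pairMI (fun x => (1 - t) * q x + t * R x) e' = pairMI q e' := by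
    intro k l hkl hl hpos
    refine ⟨resample q l, resample_mem_stdSimplex hq l, fun t ht0 ht1 => ⟨?_, ?_⟩⟩
    · refine (pairMI_mix_le hq (pairMarg_resample_self hkl) ht0.le ht1).trans_lt ?_
      nlinarith
    · induction e' with | _ i j
      rw [Sym2.mem_iff, not_or] at hl
      rw [pairMI_mk, pairMI_mk]
      congr 1
      funext a b
      rw [pairMarg, Finset.sum_add_distrib, ← Finset.mul_sum, ← Finset.mul_sum]
      have := pairMarg_resample_of_ne hq (Ne.symm hl.1) (Ne.symm hl.2) a b
      unfold pairMarg at this ⊢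
      rw [this]
      ring
  induction e with | _ k l
  rw [Sym2.mk_isDiag_iff] at he
  by_cases hl : l ∈ e'
  · by_cases hk : k ∈ e'
    · exact absurd ((Sym2.mem_and_mem_iff he).1 ⟨hk, hl⟩).symm hne
    · rw [Sym2.eq_swap] at hpos ⊢
      exact key l k (Ne.symm he) hk hpos
  · exact key k l he hl hpos

/-- By log t ≤ t − 1 each term is at most (q − p)²/p + (q − p), and the linear parts cancel in the
sum. -/
theorem relEnt_le_chiSq {α : Type*} [Fintype α] {p q : α → ℝ} (hp : p ∈ stdSimplex ℝ α)
    (hq : q ∈ stdSimplex ℝ α) (hac : ∀ a, p a = 0 → q a = 0) :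
    relEnt q p ≤ ∑ a, (q a - p a) ^ 2 / p a := by
  have h : ∀ a, q a * Real.log (q a / p a) ≤ (q a - p a) ^ 2 / p a + (q a - p a) := by
    intro a
    by_cases h0 : q a = 0
    · by_cases h1 : p a = 0
      · simp [h0, h1]
      · simp only [h0, zero_mul, zero_sub, neg_sq]
        rw [pow_two, mul_div_assoc, div_self h1]
        simp
    have hpa : 0 < p a := (hp.1 a).lt_of_ne' fun h => h0 (hac a h)
    have hqa : 0 < q a := (hq.1 a).lt_of_ne' h0
    have h1 := mul_le_mul_of_nonneg_left (Real.log_le_sub_one_of_pos (div_pos hqa hpa)) hqa.le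
    refine h1.trans (le_of_eq ?_)
    field_simp
    ring
  have h2 := Finset.sum_le_sum fun a (_ : a ∈ Finset.univ) => h a
  rw [Finset.sum_add_distrib, Finset.sum_sub_distrib, hq.2, hp.2] at h2
  unfold relEnt
  linarith

/-- Perturbation of a distribution that makes two coordinates dependent at a cost quadratic in the
size of the dependence. -/
theorem exists_dependent_perturbation (hr : 2 ≤ r) {p : (Fin d → Fin r) → ℝ}
    (hp : p ∈ stdSimplex ℝ (Fin d → Fin r)) {i j : Fin d}
    (hpos : ∀ a b, 0 < pairMarg p i j a b)
    (hind : ∀ a b, pairMarg p i j a b = nodeMarg p i a * nodeMarg p j b) :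
    ∃ C t₀ : ℝ, 0 < C ∧ 0 < t₀ ∧ ∀ t, 0 ≤ t → t ≤ t₀ → ∃ q ∈ stdSimplex ℝ (Fin d → Fin r),
      (∀ x, p x = 0 → q x = 0) ∧ relEnt q p ≤ C * t ^ 2 ∧
      ∃ a b, pairMarg q i j a b - nodeMarg q i a * nodeMarg q j b = t := by
  let o : Fin r := ⟨0, by omega⟩
  let o' : Fin r := ⟨1, by omega⟩
  have hoo : o' ≠ o := by simp [o, o']
  -- Because `s` sums to zero, adding t·s(a)·s(b) to the pair marginal changes no node marginal; at
  -- (o, o) it creates dependence exactly `t`.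
  let s : Fin r → ℝ := fun a => (if a = o then 1 else 0) - (if a = o' then 1 else 0)
  have hs : ∑ a, s a = 0 := by simp [s, Finset.sum_sub_distrib]
  have hs1 : ∀ a, |s a| ≤ 1 := by
    intro a
    by_cases h1 : a = o
    · have : ¬ a = o' := fun h => hoo (h.symm.trans h1)
      simp only [s, if_pos h1, if_neg this]; norm_num
    · by_cases h2 : a = o' <;> simp [s, h1, h2]
      simp [hoo]
  have hso : s o = 1 := by simp [s, hoo.symm]
  have : Nonempty (Fin r) := ⟨o⟩
  obtain ⟨c, hc⟩ := Finite.exists_min fun c : Fin r × Fin r => pairMarg p i j c.1 c.2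
  set t₀ := pairMarg p i j c.1 c.2
  have ht₀ : 0 < t₀ := hpos _ _
  have hmin : ∀ a b, t₀ ≤ pairMarg p i j a b := fun a b => hc (a, b)
  -- The χ² cost has r² terms, each at most t²/t₀. With t₀ the least pair probability, t ≤ t₀ keeps
  -- the perturbed density nonnegative.
  refine ⟨∑ a : Fin r, ∑ b : Fin r, 1 / t₀, t₀, ?_, ht₀, fun t ht0 ht1 => ?_⟩
  · exact Finset.sum_pos (fun a _ => Finset.sum_pos (fun b _ => by positivity)
      Finset.univ_nonempty) Finset.univ_nonempty
  let h : Fin r → Fin r → ℝ := fun a b => t * s a * s b / pairMarg p i j a b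
  let q : (Fin d → Fin r) → ℝ := fun x => p x * (1 + h (x i) (x j))
  have hh : ∀ a b, -1 ≤ h a b := by
    intro a b
    have h1 : |t * s a * s b| ≤ t₀ := by
      rw [abs_mul, abs_mul, abs_of_nonneg ht0]
      nlinarith [hs1 a, hs1 b, abs_nonneg (s a), abs_nonneg (s b),
        mul_le_mul (hs1 a) (hs1 b) (abs_nonneg _) zero_le_one]
    rw [le_div_iff₀ (hpos a b)]
    have := neg_abs_le (t * s a * s b)
    linarith [hmin a b]
  have hpm : ∀ a b, pairMarg q i j a b = pairMarg p i j a b + t * s a * s b := by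
    intro a b
    have : pairMarg q i j a b = pairMarg p i j a b * (1 + h a b) := by
      rw [pairMarg, pairMarg, Finset.sum_mul]
      refine Finset.sum_congr rfl fun x hx => ?_
      obtain ⟨h1, h2⟩ : x i = a ∧ x j = b := by simpa using hx
      simp only [q, h1, h2]
    rw [this]
    have := hpos a b
    simp only [h]
    field_simp
  have hq0 : ∀ x, 0 ≤ q x := fun x => mul_nonneg (hp.1 x) (by linarith [hh (x i) (x j)])
  have hni : ∀ a, nodeMarg q i a = nodeMarg p i a := by
    intro a
    simp only [← sum_pairMarg_right q i j, hpm, Finset.sum_add_distrib, ← Finset.mul_sum, hs,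
      sum_pairMarg_right, mul_zero, add_zero]
  have hnj : ∀ b, nodeMarg q j b = nodeMarg p j b := by
    intro b
    simp only [← sum_pairMarg_left q i j, hpm, Finset.sum_add_distrib, ← Finset.mul_sum,
      ← Finset.sum_mul, hs, sum_pairMarg_left, mul_zero, zero_mul, add_zero]
  have hq : q ∈ stdSimplex ℝ (Fin d → Fin r) := by
    refine ⟨hq0, ?_⟩
    rw [← sum_nodeMarg q i]
    simp only [hni, sum_nodeMarg, hp.2]
  have hac : ∀ x, p x = 0 → q x = 0 := fun x hx => by simp [q, hx]
  refine ⟨q, hq, hac, ?_, o, o, ?_⟩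
  · refine (relEnt_le_chiSq hp hq hac).trans ?_
    have h1 : ∀ x, (q x - p x) ^ 2 / p x = p x * h (x i) (x j) ^ 2 := by
      intro x
      by_cases h0 : p x = 0
      · simp [h0, q]
      · simp only [q]; field_simp; ring
    simp only [h1]
    rw [sum_mul_comp_pair p i j fun a b => h a b ^ 2]
    simp only [Finset.sum_mul]
    refine Finset.sum_le_sum fun a _ => Finset.sum_le_sum fun b _ => ?_
    have h2 : pairMarg p i j a b * h a b ^ 2 = (s a * s b) ^ 2 / pairMarg p i j a b * t ^ 2 := by
      have := hpos a b
      simp only [h]; field_simp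
    rw [h2]
    have h3 : (s a * s b) ^ 2 ≤ 1 := by
      rw [sq_le_one_iff_abs_le_one, abs_mul]
      exact mul_le_one₀ (hs1 a) (abs_nonneg _) (hs1 b)
    gcongr
    exact hmin a b
  · rw [hpm, hni, hnj, hind, hso]
    ring

theorem abs_sum_filter_sub_le {α : Type*} [Fintype α] (q p : α → ℝ) (f : α → Prop)
    [DecidablePred f] {ρ : ℝ} (h : ∀ a, |q a - p a| ≤ ρ) :
    |∑ a with f a, q a - ∑ a with f a, p a| ≤ Fintype.card α * ρ := by
  rw [← Finset.sum_sub_distrib]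
  calc |∑ a with f a, (q a - p a)| ≤ ∑ a with f a, |q a - p a| := Finset.abs_sum_le_sum_abs _ _
    _ ≤ ∑ a, |q a - p a| := Finset.sum_le_univ_sum_of_nonneg fun a => abs_nonneg _
    _ ≤ ∑ a : α, ρ := Finset.sum_le_sum fun a _ => h a
    _ = _ := by simp

/-- Otherwise each marginal moves by at most N√ε, N being the number of points, so the product of
node marginals moves by at most 2N√ε. Mutual information at most ε bounds the dependence under `q`
by 2√ε, so the dependence under `p` is at most (3N + 2)√ε. In use, `p` is the perturbed law and `q`
an empirical one. -/
theorem exists_sqrt_le_abs_sub {p q : (Fin d → Fin r) → ℝ}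
    (hp : p ∈ stdSimplex ℝ (Fin d → Fin r)) (hq : q ∈ stdSimplex ℝ (Fin d → Fin r))
    {i j : Fin d} {a b : Fin r} {ε : ℝ} (hε : 0 < ε)
    (ht : pairMarg p i j a b - nodeMarg p i a * nodeMarg p j b =
      (3 * Fintype.card (Fin d → Fin r) + 3) * √ε)
    (hMI : pairMI q s(i, j) ≤ ε) : ∃ x, √ε ≤ |q x - p x| := by
  by_contra! hcon
  have hs : 0 < √ε := Real.sqrt_pos.2 hε
  have h1 := abs_sum_filter_sub_le q p (fun x => x i = a ∧ x j = b) fun x => (hcon x).le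
  have h2 := abs_sum_filter_sub_le q p (fun x => x i = a) fun x => (hcon x).le
  have h3 := abs_sum_filter_sub_le q p (fun x => x j = b) fun x => (hcon x).le
  change |pairMarg q i j a b - pairMarg p i j a b| ≤ _ at h1
  change |nodeMarg q i a - nodeMarg p i a| ≤ _ at h2
  change |nodeMarg q j b - nodeMarg p j b| ≤ _ at h3
  set N := (Fintype.card (Fin d → Fin r) : ℝ)
  have h4 : |pairMarg q i j a b - nodeMarg q i a * nodeMarg q j b| ≤ 2 * √ε := by
    refine abs_le_of_sq_le_sq ?_ (by positivity)
    rw [mul_pow, Real.sq_sqrt hε.le]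
    linarith [sq_pairMarg_sub_le hq i j a b]
  have h5 : |nodeMarg q i a * nodeMarg q j b - nodeMarg p i a * nodeMarg p j b| ≤
      2 * (N * √ε) := by
    have e : nodeMarg q i a * nodeMarg q j b - nodeMarg p i a * nodeMarg p j b =
      (nodeMarg q i a - nodeMarg p i a) * nodeMarg q j b +
        nodeMarg p i a * (nodeMarg q j b - nodeMarg p j b) := by ring
    have := nodeMarg_nonneg hq.1 j b
    have := nodeMarg_nonneg hp.1 i a
    have := nodeMarg_le_one hq j b
    have := nodeMarg_le_one hp i a
    rw [e]
    refine (abs_add_le _ _).trans ?_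
    rw [abs_mul, abs_mul, abs_of_nonneg (nodeMarg_nonneg hq.1 j b),
      abs_of_nonneg (nodeMarg_nonneg hp.1 i a)]
    nlinarith [abs_nonneg (nodeMarg q i a - nodeMarg p i a),
      abs_nonneg (nodeMarg q j b - nodeMarg p j b)]
  rw [abs_le] at h1 h4 h5
  nlinarith

theorem pairType_eq_pairMarg {n : ℕ} (x : Fin n → Fin d → Fin r) (i j : Fin d) :
    pairType x i j = pairMarg (empirical x) i j := by
  classical
  funext a b
  simp only [pairType, pairMarg, empirical, ← Finset.sum_div]
  congr 1
  norm_cast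
  rw [Finset.card_eq_sum_card_fiberwise (f := x)
    (t := Finset.univ.filter fun y => y i = a ∧ y j = b) (by intro l; simp)]
  refine Finset.sum_congr rfl fun y hy => ?_
  obtain ⟨h1, h2⟩ : y i = a ∧ y j = b := by simpa using hy
  congr 1
  ext l
  simp only [Finset.mem_filter, Finset.mem_univ, true_and]
  constructor
  · exact fun h => h.2
  · exact fun h => ⟨by rw [h]; exact ⟨h1, h2⟩, h⟩

theorem empMI_eq_pairMI {n : ℕ} (x : Fin n → Fin d → Fin r) :
    empMI x = pairMI (empirical x) := by
  funext e
  induction e with | _ i j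
  simp only [pairMI_mk, ← pairType_eq_pairMarg]
  rfl

end PairMarginals

end ForestLearning

namespace ForestLearning

/-! ### Edge exchanges and maximum-weight spanning trees. -/

section Graphs

variable {d : ℕ}

open Classical in
/-- Total weight of the edges of a graph. -/
noncomputable def graphWeight (w : Sym2 (Fin d) → ℝ) (T : SimpleGraph (Fin d)) : ℝ :=
  ∑ e with e ∈ T.edgeSet, w e

theorem isMWST_iff (w : Sym2 (Fin d) → ℝ) (T : SimpleGraph (Fin d)) :
    IsMWST w T ↔ T.IsTree ∧ ∀ T' : SimpleGraph (Fin d), T'.IsTree →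
      graphWeight w T' ≤ graphWeight w T := by
  classical
  have h : ∀ (S : SimpleGraph (Fin d)) [Fintype S.edgeSet],
      ∑ e ∈ S.edgeFinset, w e = graphWeight w S := by
    intro S _
    refine Finset.sum_congr ?_ fun _ _ => rfl
    ext e
    simp
  simp only [IsMWST, h]

theorem graphWeight_mono {w : Sym2 (Fin d) → ℝ} (hw : ∀ e, 0 ≤ w e) {S T : SimpleGraph (Fin d)}
    (h : S ≤ T) : graphWeight w S ≤ graphWeight w T := by
  classical
  refine Finset.sum_le_sum_of_subset_of_nonneg (fun e he => ?_) fun e _ _ => hw e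
  simp only [Finset.mem_filter, Finset.mem_univ, true_and] at he ⊢
  exact SimpleGraph.edgeSet_mono h he

theorem graphWeight_deleteEdges_zero (w : Sym2 (Fin d) → ℝ) (T : SimpleGraph (Fin d)) :
    graphWeight w (T.deleteEdges {e | w e = 0}) = graphWeight w T := by
  classical
  refine Finset.sum_subset (fun e he => ?_) fun e he he' => ?_
  · simp only [SimpleGraph.edgeSet_deleteEdges, Finset.mem_filter, Finset.mem_univ, true_and]
      at he ⊢
    exact he.1
  · simp only [SimpleGraph.edgeSet_deleteEdges, Finset.mem_filter, Finset.mem_univ, true_and,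
      Set.mem_sdiff, Set.mem_ofPred_eq, not_and, not_not] at he he'
    exact he' he

theorem graphWeight_eq_of_edgeSet_eq_insert_diff (w : Sym2 (Fin d) → ℝ)
    {S T : SimpleGraph (Fin d)} {e f : Sym2 (Fin d)} (hf : f ∈ T.edgeSet) (he : e ∉ T.edgeSet)
    (h : S.edgeSet = insert e (T.edgeSet \ {f})) :
    graphWeight w S = graphWeight w T + w e - w f := by
  classical
  have h1 : (Finset.univ.filter fun x => x ∈ S.edgeSet) =
      insert e ((Finset.univ.filter fun x => x ∈ T.edgeSet).erase f) := by
    ext x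
    simp only [h, Set.mem_insert_iff, Set.mem_sdiff, Set.mem_singleton_iff, Finset.mem_filter,
      Finset.mem_univ, true_and, Finset.mem_insert, Finset.mem_erase]
    tauto
  unfold graphWeight
  rw [h1, Finset.sum_insert (by simp [he]), ← Finset.add_sum_erase (Finset.univ.filter fun x =>
    x ∈ T.edgeSet) w (by simpa using hf : f ∈ _)]
  ring

theorem mem_edgeSet_sup_edge {T : SimpleGraph (Fin d)} {a b : Fin d} (hab : a ≠ b)
    (e : Sym2 (Fin d)) :
    e ∈ (T ⊔ SimpleGraph.edge a b).edgeSet ↔ e = s(a, b) ∨ e ∈ T.edgeSet := by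
  induction e with | _ u v
  simp only [SimpleGraph.mem_edgeSet, SimpleGraph.sup_adj, SimpleGraph.edge_adj, Sym2.eq_iff]
  constructor
  · rintro (h | ⟨h, -⟩)
    · exact Or.inr h
    · exact Or.inl h
  · rintro (h | h)
    · refine Or.inr ⟨h, ?_⟩
      rintro rfl
      rcases h with ⟨rfl, rfl⟩ | ⟨rfl, rfl⟩ <;> exact hab rfl
    · exact Or.inl h

theorem graphWeight_sup_edge (w : Sym2 (Fin d) → ℝ) {T : SimpleGraph (Fin d)} {a b : Fin d}
    (hab : a ≠ b) (h : ¬ T.Adj a b) :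
    graphWeight w (T ⊔ SimpleGraph.edge a b) = graphWeight w T + w s(a, b) := by
  classical
  have h1 : graphWeight w (T ⊔ SimpleGraph.edge a b) =
      ∑ x ∈ insert s(a, b) (Finset.univ.filter fun x => x ∈ T.edgeSet), w x := by
    refine Finset.sum_congr ?_ fun _ _ => rfl
    ext x
    simp only [mem_edgeSet_sup_edge hab, Finset.mem_filter, Finset.mem_univ, true_and,
      Finset.mem_insert]
  rw [h1, Finset.sum_insert (by simpa using h), add_comm]
  rfl

theorem ncard_edgeSet_add_one {T : SimpleGraph (Fin d)} (hT : T.IsTree) :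
    T.edgeSet.ncard + 1 = d := by
  have := (SimpleGraph.isTree_iff_connected_and_card.1 hT).2
  simpa [Set.ncard] using this

/-- Adding to a tree `T` an edge `ab` of an acyclic graph `H ≤ T ⊔ ab` and removing a suitable edge
outside of `H` gives a tree. -/
theorem exists_isTree_insert_diff {T H : SimpleGraph (Fin d)} (hT : T.IsTree) (hH : H.IsAcyclic)
    {a b : Fin d} (hHT : H ≤ T ⊔ SimpleGraph.edge a b) (hab : H.Adj a b) (hnot : ¬ T.Adj a b) :
    ∃ f ∈ T.edgeSet, f ∉ H.edgeSet ∧ ∃ T₁ : SimpleGraph (Fin d), T₁.IsTree ∧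
      T₁.edgeSet = insert s(a, b) (T.edgeSet \ {f}) := by
  have hconn : (T ⊔ SimpleGraph.edge a b).Connected := hT.connected.mono le_sup_left
  -- Extend `H` to a spanning tree inside T ⊔ ab. Counting edges, it misses exactly one edge `f`,
  -- which is outside `H` and differs from ab.
  obtain ⟨T₁, h1, h2, h3⟩ := hconn.exists_isTree_le_of_le_of_isAcyclic hHT hH
  have hsub : T₁.edgeSet ⊆ insert s(a, b) T.edgeSet := by
    intro e he
    exact (mem_edgeSet_sup_edge hab.ne e).1 (SimpleGraph.edgeSet_mono h2 he)
  have hmem : s(a, b) ∉ T.edgeSet := by simpa using hnot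
  have hcard : (insert s(a, b) T.edgeSet \ T₁.edgeSet).ncard = 1 := by
    have e1 := Set.ncard_sdiff_add_ncard_of_subset hsub
    rw [Set.ncard_insert_of_notMem hmem] at e1
    have e2 := ncard_edgeSet_add_one hT
    have e3 := ncard_edgeSet_add_one h3
    omega
  obtain ⟨f, hf⟩ := Set.ncard_eq_one.1 hcard
  have hf' : f ∈ insert s(a, b) T.edgeSet \ T₁.edgeSet := hf ▸ Set.mem_singleton f
  have hadd : s(a, b) ∈ T₁.edgeSet := SimpleGraph.edgeSet_mono h1 (by simpa using hab)
  have hne : f ≠ s(a, b) := fun h => hf'.2 (h ▸ hadd)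
  refine ⟨f, Set.mem_of_mem_insert_of_ne hf'.1 hne, fun h => hf'.2 (SimpleGraph.edgeSet_mono h1 h),
    T₁, h3, ?_⟩
  ext e
  constructor
  · intro he
    rcases hsub he with h | h
    · exact Or.inl h
    · exact Or.inr ⟨h, fun h' => hf'.2 (h' ▸ he)⟩
  · rintro (h | ⟨h, h'⟩)
    · exact h ▸ hadd
    · by_contra hcon
      exact h' (hf ▸ ⟨Or.inr h, hcon⟩)

/-- G ⊔ ab is still acyclic, so ab can be exchanged for an edge `f` of `T` outside `G`; maximality
of `T` compares the two weights. -/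
theorem exists_le_weight_of_not_reachable {w : Sym2 (Fin d) → ℝ} {T G : SimpleGraph (Fin d)}
    (hT : IsMWST w T) (hG : G ≤ T) {a b : Fin d} (hab : ¬ G.Reachable a b) :
    ∃ f ∈ T.edgeSet, f ∉ G.edgeSet ∧ w s(a, b) ≤ w f := by
  rw [isMWST_iff] at hT
  have hne : a ≠ b := fun h => hab (h ▸ SimpleGraph.Reachable.refl a)
  have hadj : ¬ G.Adj a b := fun h => hab h.reachable
  by_cases h : T.Adj a b
  · exact ⟨s(a, b), by simpa using h, by simpa using hadj, le_rfl⟩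
  have hGa : G.IsAcyclic := hT.1.isAcyclic.anti hG
  obtain ⟨f, hf, hfH, T₁, hT₁, he⟩ := exists_isTree_insert_diff hT.1
    (hGa.sup_edge_of_not_reachable hab) (sup_le_sup_right hG _)
    (by simp [SimpleGraph.edge_adj, hne]) h
  refine ⟨f, hf, fun h' => hfH (SimpleGraph.edgeSet_mono le_sup_left h'), ?_⟩
  have h1 := hT.2 T₁ hT₁
  rw [graphWeight_eq_of_edgeSet_eq_insert_diff w hf (by simpa using h) he] at h1
  linarith

/-- If a tree is not the unique tree of maximal weight, then some tree obtained by exchanging one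
edge is at least as heavy. -/
theorem exists_single_exchange (w : Sym2 (Fin d) → ℝ) {G : SimpleGraph (Fin d)} (hG : G.IsTree)
    (h : ∃ T : SimpleGraph (Fin d), T.IsTree ∧ T ≠ G ∧ graphWeight w G ≤ graphWeight w T) :
    ∃ T : SimpleGraph (Fin d), T.IsTree ∧ ∃ e ∈ G.edgeSet, ∃ e' ∉ G.edgeSet,
      T.edgeSet = insert e' (G.edgeSet \ {e}) ∧ w e ≤ w e' := by
  classical
  -- Among the competitors of `G`, take one missing the fewest edges of `G`; `e` is then a heaviest
  -- missing edge.
  obtain ⟨T, ⟨hT, hTG, hw⟩, hmin⟩ := exists_minimalFor_of_wellFoundedLT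
    (fun T : SimpleGraph (Fin d) => T.IsTree ∧ T ≠ G ∧ graphWeight w G ≤ graphWeight w T)
    (fun T => (G.edgeSet \ T.edgeSet).ncard) h
  have hnot : ¬ G.edgeSet ⊆ T.edgeSet := by
    intro hsub
    apply hTG
    refine SimpleGraph.edgeSet_injective (Set.eq_of_subset_of_ncard_le hsub ?_).symm
    have := ncard_edgeSet_add_one hG
    have := ncard_edgeSet_add_one hT
    omega
  obtain ⟨e₀, he₀, he₀'⟩ := Set.not_subset.1 hnot
  obtain ⟨e, ⟨heG, heT⟩, hmax⟩ := (Set.toFinite (G.edgeSet \ T.edgeSet)).exists_maximalFor w _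
    ⟨e₀, he₀, he₀'⟩
  have hmax' : ∀ x ∈ G.edgeSet \ T.edgeSet, w x ≤ w e := by
    intro x hx
    rcases le_total (w x) (w e) with h | h
    · exact h
    · exact hmax hx h
  induction e with | _ a b
  have hGa : G.Adj a b := heG
  have hTa : ¬ T.Adj a b := heT
  -- exchange in `T`
  obtain ⟨f, hfT, hfH, T₁, hT₁, hE₁⟩ := exists_isTree_insert_diff (H := (T ⊓ G) ⊔
      SimpleGraph.edge a b) hT (hG.isAcyclic.anti (sup_le inf_le_right
        (by rw [SimpleGraph.edge_le_iff]; exact Or.inr hGa)))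
    (sup_le_sup_right inf_le_left _) (by simp [SimpleGraph.edge_adj, hGa.ne]) hTa
  have hfG : f ∉ G.edgeSet := fun hf => hfH
    (SimpleGraph.edgeSet_mono le_sup_left (by rw [SimpleGraph.edgeSet_inf]; exact ⟨hfT, hf⟩))
  have hW₁ := graphWeight_eq_of_edgeSet_eq_insert_diff w hfT heT hE₁
  -- If the exchange leads to `G`, then `T` itself is one exchange away from `G`.
  by_cases hT₁G : T₁ = G
  · subst hT₁G
    refine ⟨T, hT, s(a, b), heG, f, hfG, ?_, ?_⟩
    · rw [hE₁]
      ext x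
      simp only [Set.mem_insert_iff, Set.mem_sdiff, Set.mem_singleton_iff]
      constructor
      · intro hx
        by_cases hxf : x = f
        · exact Or.inl hxf
        · exact Or.inr ⟨Or.inr ⟨hx, hxf⟩, fun hxe => heT (hxe ▸ hx)⟩
      · rintro (hx | ⟨hx | hx, hx'⟩)
        · exact hx ▸ hfT
        · exact absurd hx hx'
        · exact hx.1
    · linarith
  -- Otherwise `T₁` would be a competitor at least as heavy as `T` but closer to `G`.
  have hlt : w s(a, b) < w f := by
    by_contra! hcon
    have hle := hmin ⟨hT₁, hT₁G, by linarith⟩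
    have hss : G.edgeSet \ T₁.edgeSet ⊂ G.edgeSet \ T.edgeSet := by
      refine ⟨fun x hx => ⟨hx.1, fun hxT => hx.2 ?_⟩, fun hsub => ?_⟩
      · rw [hE₁]
        exact Or.inr ⟨hxT, fun hxf => hfG (hxf ▸ hx.1)⟩
      · exact (hsub ⟨heG, heT⟩).2 (by rw [hE₁]; exact Or.inl rfl)
    have hlt := Set.ncard_lt_ncard hss
    exact absurd (hle hlt.le) (not_le.2 hlt)
  -- exchange in `G`
  induction f with | _ u v
  have hTu : T.Adj u v := hfT
  obtain ⟨g, hgG, hgH, T₂, hT₂, hE₂⟩ := exists_isTree_insert_diff (H := (G ⊓ T) ⊔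
      SimpleGraph.edge u v) hG (hT.isAcyclic.anti (sup_le inf_le_right
        (by rw [SimpleGraph.edge_le_iff]; exact Or.inr hTu)))
    (sup_le_sup_right inf_le_left _) (by simp [SimpleGraph.edge_adj, hTu.ne]) hfG
  have hgT : g ∉ T.edgeSet := fun hg => hgH
    (SimpleGraph.edgeSet_mono le_sup_left (by rw [SimpleGraph.edgeSet_inf]; exact ⟨hgG, hg⟩))
  -- The removed edge `g` is also missing from `T`, so w g ≤ w e < w f by the choice of `e`.
  exact ⟨T₂, hT₂, g, hgG, s(u, v), hfG, hE₂, (hmax' g ⟨hgG, hgT⟩).trans hlt.le⟩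

theorem exists_isTree_ge {H : SimpleGraph (Fin d)} (hd : d ≠ 0) (hH : H.IsAcyclic) :
    ∃ T : SimpleGraph (Fin d), H ≤ T ∧ T.IsTree := by
  have : Nonempty (Fin d) := ⟨⟨0, Nat.pos_of_ne_zero hd⟩⟩
  obtain ⟨T, h1, _, h2⟩ :=
    (SimpleGraph.connected_top (V := Fin d)).exists_isTree_le_of_le_of_isAcyclic
      (le_top : H ≤ ⊤) hH
  exact ⟨T, h1, h2⟩

theorem exists_isMWST (hd : d ≠ 0) (w : Sym2 (Fin d) → ℝ) :
    ∃ T : SimpleGraph (Fin d), IsMWST w T := by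
  classical
  obtain ⟨T₀, _, hT₀⟩ := exists_isTree_ge hd (SimpleGraph.isAcyclic_bot (V := Fin d))
  obtain ⟨T, hT, hmax⟩ := (Set.toFinite {T : SimpleGraph (Fin d) | T.IsTree}).exists_maximalFor
    (graphWeight w) _ ⟨T₀, hT₀⟩
  refine ⟨T, (isMWST_iff w T).2 ⟨hT, fun T' hT' => ?_⟩⟩
  rcases le_total (graphWeight w T') (graphWeight w T) with h | h
  · exact h
  · exact hmax hT' h

/-- Otherwise ab could be added to the part of `T` with nonzero weights and the result extended to a
tree. Deleted edges weigh nothing and added ones weigh at least zero, so this tree would beat `T` by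
at least w(ab). -/
theorem reachable_deleteEdges_zero {w : Sym2 (Fin d) → ℝ} (hw : ∀ e, 0 ≤ w e)
    {T : SimpleGraph (Fin d)} (hT : IsMWST w T) {a b : Fin d} (hab : 0 < w s(a, b)) (hne : a ≠ b) :
    (T.deleteEdges {e | w e = 0}).Reachable a b := by
  rw [isMWST_iff] at hT
  by_contra hcon
  set F := T.deleteEdges {e | w e = 0} with hF
  have hFa : F.IsAcyclic := hT.1.isAcyclic.anti (SimpleGraph.deleteEdges_le _)
  have hd : d ≠ 0 := by rintro rfl; exact a.elim0
  obtain ⟨T₁, h1, h2⟩ := exists_isTree_ge hd (hFa.sup_edge_of_not_reachable hcon)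
  have h3 := graphWeight_mono hw h1
  rw [graphWeight_sup_edge w hne (fun h => hcon h.reachable), hF,
    graphWeight_deleteEdges_zero] at h3
  linarith [hT.2 T₁ h2]

/-- All maximum-weight spanning trees have the same number of edges of positive weight. -/
theorem ncard_deleteEdges_zero_le {w : Sym2 (Fin d) → ℝ} (hw : ∀ e, 0 ≤ w e)
    {T T₀ : SimpleGraph (Fin d)} (hT : IsMWST w T) (hT₀ : IsMWST w T₀) :
    (T.deleteEdges {e | w e = 0}).edgeSet.ncard ≤
      (T₀.deleteEdges {e | w e = 0}).edgeSet.ncard := by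
  set F₀ := T₀.deleteEdges {e | w e = 0} with hF₀
  set Z := T.deleteEdges {e | w e ≠ 0} with hZ
  -- The positive edges of `T₀` bridge each positive edge of `T`, so with the zero edges of `T` they
  -- connect everything. Hence they number at least d − 1 − |Z|, which is the number of positive
  -- edges of `T`.
  have hconn : (F₀ ⊔ Z).Connected := by
    have := hT.1.connected.nonempty
    refine ⟨fun u v => ?_⟩
    have hadj : ∀ a b, T.Adj a b → (F₀ ⊔ Z).Reachable a b := by
      intro a b hab
      by_cases h0 : w s(a, b) = 0
      · refine SimpleGraph.Adj.reachable (Or.inr ?_)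
        rw [hZ, SimpleGraph.deleteEdges_adj]
        exact ⟨hab, fun h => h h0⟩
      · exact (reachable_deleteEdges_zero hw hT₀ ((hw _).lt_of_ne' h0) hab.ne).mono le_sup_left
    obtain ⟨p⟩ := hT.1.connected.preconnected u v
    induction p with
    | nil => exact SimpleGraph.Reachable.refl _
    | cons h _ ih => exact (hadj _ _ h).trans ih
  have h1 := hconn.card_vert_le_card_edgeSet_add_one
  rw [SimpleGraph.edgeSet_sup, Nat.card_coe_set_eq, Nat.card_eq_fintype_card, Fintype.card_fin]
    at h1
  have h2 := Set.ncard_union_le F₀.edgeSet Z.edgeSet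
  have h3 := ncard_edgeSet_add_one hT.1
  have h4 : T.edgeSet.ncard = (T.deleteEdges {e | w e = 0}).edgeSet.ncard + Z.edgeSet.ncard := by
    rw [← Set.ncard_union_eq, hZ]
    · congr 1
      ext e
      simp only [SimpleGraph.edgeSet_deleteEdges, Set.mem_union, Set.mem_sdiff, Set.mem_ofPred_eq]
      tauto
    · rw [Set.disjoint_left, hZ]
      intro e h h'
      simp only [SimpleGraph.edgeSet_deleteEdges, Set.mem_sdiff, Set.mem_ofPred_eq] at h h'
      tauto
  omega

end Graphs

end ForestLearning

namespace ForestLearning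

/-! ### From the local Markov property on a forest to a factorization. -/

section Markov

variable {d r : ℕ}

open Classical in
/-- Marginal of a mass function on the coordinates in `S`. -/
noncomputable def setMarg (q : (Fin d → Fin r) → ℝ) (S : Set (Fin d)) (x : Fin d → Fin r) : ℝ :=
  ∑ y with ∀ j ∈ S, y j = x j, q y

/-- Local Markov property of a mass function. -/
def IsMarkovMass (q : (Fin d → Fin r) → ℝ) (G : SimpleGraph (Fin d)) : Prop :=
  ∀ (i : Fin d) (x : Fin d → Fin r), q x * setMarg q (G.neighborSet i) x =
    setMarg q (insert i (G.neighborSet i)) x * setMarg q {i}ᶜ x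

/-- Local Markov property of the marginal on `S`. -/
def IsMarkovMassOn (q : (Fin d → Fin r) → ℝ) (G : SimpleGraph (Fin d)) (S : Set (Fin d)) :
    Prop :=
  ∀ i ∈ S, ∀ x : Fin d → Fin r, setMarg q S x * setMarg q (G.neighborSet i ∩ S) x =
    setMarg q (insert i (G.neighborSet i ∩ S)) x * setMarg q (S \ {i}) x

theorem setMarg_congr (q : (Fin d → Fin r) → ℝ) {S : Set (Fin d)} {x y : Fin d → Fin r}
    (h : ∀ j ∈ S, x j = y j) : setMarg q S x = setMarg q S y := by
  classical
  refine Finset.sum_congr ?_ fun _ _ => rfl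
  ext z
  simp only [Finset.mem_filter, Finset.mem_univ, true_and]
  exact forall₂_congr fun j hj => by rw [h j hj]

theorem setMarg_update (q : (Fin d → Fin r) → ℝ) {S : Set (Fin d)} {i : Fin d} (hi : i ∉ S)
    (x : Fin d → Fin r) (a : Fin r) : setMarg q S (Function.update x i a) = setMarg q S x :=
  setMarg_congr q fun j hj => by
    rw [Function.update_of_ne]
    rintro rfl
    exact hi hj

theorem sum_setMarg_update (q : (Fin d → Fin r) → ℝ) {S : Set (Fin d)} {i : Fin d} (hi : i ∈ S)
    (x : Fin d → Fin r) :
    ∑ a, setMarg q S (Function.update x i a) = setMarg q (S \ {i}) x := by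
  classical
  unfold setMarg
  refine Eq.trans ?_ (Finset.sum_fiberwise _ (fun y => y i) _)
  refine Finset.sum_congr rfl fun a _ => Finset.sum_congr ?_ fun _ _ => rfl
  ext y
  simp only [Finset.mem_filter, Finset.mem_univ, true_and, Set.mem_sdiff, Set.mem_singleton_iff]
  constructor
  · intro h
    refine ⟨fun j hj => ?_, ?_⟩
    · rw [h j hj.1, Function.update_of_ne hj.2]
    · rw [h i hi, Function.update_self]
  · rintro ⟨h1, h2⟩ j hj
    by_cases hji : j = i
    · subst hji; rw [h2, Function.update_self]
    · rw [Function.update_of_ne hji, h1 j ⟨hj, hji⟩]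

theorem setMarg_univ (q : (Fin d → Fin r) → ℝ) (x : Fin d → Fin r) :
    setMarg q Set.univ x = q x := by
  classical
  unfold setMarg
  rw [Finset.sum_eq_single x]
  · intro y hy hne
    exact absurd (funext fun j => by simp only [Finset.mem_filter] at hy; exact hy.2 j trivial) hne
  · simp

theorem setMarg_empty (q : (Fin d → Fin r) → ℝ) (x : Fin d → Fin r) :
    setMarg q ∅ x = ∑ y, q y := by
  simp [setMarg]

theorem setMarg_singleton (q : (Fin d → Fin r) → ℝ) (i : Fin d) (x : Fin d → Fin r) :
    setMarg q {i} x = nodeMarg q i (x i) := by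
  simp [setMarg, nodeMarg]

theorem setMarg_pair (q : (Fin d → Fin r) → ℝ) (i j : Fin d) (x : Fin d → Fin r) :
    setMarg q {i, j} x = pairMarg q i j (x i) (x j) := by
  simp [setMarg, pairMarg]

theorem isMarkovMassOn_univ {q : (Fin d → Fin r) → ℝ} {G : SimpleGraph (Fin d)}
    (h : IsMarkovMass q G) : IsMarkovMassOn q G Set.univ := by
  intro i _ x
  rw [setMarg_univ, Set.inter_univ, ← Set.compl_eq_univ_sdiff]
  exact h i x

/-- The coordinate `i` occurs in one factor only on each side, so it can be summed out without
disturbing the product form. -/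
theorem sum_update_mul_eq (q : (Fin d → Fin r) → ℝ) {A B C D : Set (Fin d)} {i : Fin d}
    (hA : i ∈ A) (hB : i ∉ B) (hC : i ∉ C) (hD : i ∈ D)
    (h : ∀ x, setMarg q A x * setMarg q B x = setMarg q C x * setMarg q D x)
    (x : Fin d → Fin r) :
    setMarg q (A \ {i}) x * setMarg q B x = setMarg q C x * setMarg q (D \ {i}) x := by
  rw [← sum_setMarg_update q hA, ← sum_setMarg_update q hD, Finset.sum_mul, Finset.mul_sum]
  refine Finset.sum_congr rfl fun a _ => ?_
  have := h (Function.update x i a)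
  rwa [setMarg_update q hB, setMarg_update q hC] at this

theorem isMarkovMassOn_diff_aux {q : (Fin d → Fin r) → ℝ} {G : SimpleGraph (Fin d)}
    {S : Set (Fin d)} (h : IsMarkovMassOn q G S) {i k : Fin d} (hi : i ∈ S) (hk : k ∈ S)
    (hki : k ≠ i) (hadj : ¬ G.Adj k i) (x : Fin d → Fin r) :
    setMarg q (S \ {i}) x * setMarg q (G.neighborSet k ∩ (S \ {i})) x =
      setMarg q (insert k (G.neighborSet k ∩ (S \ {i}))) x * setMarg q ((S \ {i}) \ {k}) x := by
  have hN : G.neighborSet k ∩ (S \ {i}) = G.neighborSet k ∩ S := by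
    ext v
    simp only [Set.mem_inter_iff, SimpleGraph.mem_neighborSet, Set.mem_sdiff,
      Set.mem_singleton_iff]
    constructor
    · tauto
    · rintro ⟨h1, h2⟩
      exact ⟨h1, h2, fun hv => hadj (hv ▸ h1)⟩
  rw [hN, Set.sdiff_sdiff_comm]
  refine sum_update_mul_eq q hi (fun h' => hadj h'.1) ?_ 
    (show i ∈ S \ {k} from ⟨hi, fun h' => hki h'.symm⟩) (h k hk) x
  rintro (h' | h')
  · exact hki h'.symm
  · exact hadj h'.1

theorem isMarkovMassOn_diff_of_isolated {q : (Fin d → Fin r) → ℝ} {G : SimpleGraph (Fin d)}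
    {S : Set (Fin d)} (h : IsMarkovMassOn q G S) {i : Fin d} (hi : i ∈ S)
    (hN : ∀ k ∈ S, ¬ G.Adj i k) : IsMarkovMassOn q G (S \ {i}) := fun k hk x =>
  isMarkovMassOn_diff_aux h hi hk.1 hk.2 (fun h' => hN k hk.1 h'.symm) x

/-- Only the identity at the neighbour of the leaf is delicate, since there `i` occurs in several
factors. The Markov property at `i`, with other coordinates summed out, says that `i` depends on the
rest through its neighbour alone. This turns the identity at the neighbour into one with `i` in a
single factor on each side, which can be summed over `i`. -/
theorem isMarkovMassOn_diff_of_leaf {q : (Fin d → Fin r) → ℝ} {G : SimpleGraph (Fin d)}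
    {S : Set (Fin d)} (h : IsMarkovMassOn q G S) {i j : Fin d} (hi : i ∈ S) (hj : j ∈ S)
    (hij : G.Adj i j) (hN : G.neighborSet i ∩ S = {j})
    (hpos : ∀ a b, 0 < pairMarg q i j a b) : IsMarkovMassOn q G (S \ {i}) := by
  intro k hk x
  by_cases hkj : k = j
  swap
  · refine isMarkovMassOn_diff_aux h hi hk.1 hk.2 (fun h' => hkj ?_) x
    have : k ∈ G.neighborSet i ∩ S := ⟨h'.symm, hk.1⟩
    rwa [hN] at this
  subst hkj
  have h1 : ∀ W : Finset (Fin d), i ∉ W → k ∉ W → ∀ x,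
      setMarg q (S \ W) x * setMarg q {k} x =
        setMarg q {i, k} x * setMarg q ((S \ W) \ {i}) x := by
    intro W
    induction W using Finset.induction with
    | empty =>
      intro _ _ x
      have := h i hi x
      rw [hN] at this
      simpa using this
    | insert u W _ ih =>
      intro hi' hk' x
      simp only [Finset.mem_insert, not_or] at hi' hk'
      have ih := ih hi'.2 hk'.2
      have e1 : S \ ((insert u W : Finset (Fin d)) : Set (Fin d)) = (S \ W) \ {u} := by
        rw [Finset.coe_insert, Set.insert_eq, Set.union_comm, ← Set.sdiff_sdiff]
      rw [e1]
      by_cases hu : u ∈ S \ (W : Set (Fin d))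
      · have e2 : ((S \ (W : Set (Fin d))) \ {u}) \ {i} =
            ((S \ (W : Set (Fin d))) \ {i}) \ {u} :=
          Set.sdiff_sdiff_comm
        rw [e2]
        refine sum_update_mul_eq q hu (fun h' => hk'.1 h'.symm) ?_
          (show u ∈ (S \ (W : Set (Fin d))) \ {i} from ⟨hu, fun h' => hi'.1 h'.symm⟩) ih x
        rintro (h' | h')
        · exact hi'.1 h'.symm
        · exact hk'.1 h'.symm
      · rw [Set.sdiff_singleton_eq_self hu]
        exact ih x
  set U := insert k (G.neighborSet k ∩ S) with hU
  have hUS : U ⊆ S := Set.insert_subset hk.1 Set.inter_subset_right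
  have hiU : i ∈ U := Or.inr ⟨hij.symm, hi⟩
  have hkU : k ∈ U := Or.inl rfl
  have h2 := h1 (Set.toFinite (S \ U)).toFinset (by simp [hiU]) (by simp [hkU])
  rw [Set.Finite.coe_toFinset, Set.sdiff_sdiff_cancel_left hUS] at h2
  have h3 := h k hk.1
  have h4 := h1 ∅ (by simp) (by simp)
  simp only [Finset.coe_empty, Set.sdiff_empty] at h4
  -- Combines the leaf identity for all of `S`, the one for the closed neighbourhood `U`, and the
  -- Markov identity at `k`; positivity of the pair marginal permits cancelling it.
  have h5 : ∀ x, setMarg q (G.neighborSet k ∩ S) x * setMarg q (S \ {i}) x =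
      setMarg q (S \ {k}) x * setMarg q (U \ {i}) x := by
    intro x
    have hp : setMarg q {i, k} x ≠ 0 := by
      rw [setMarg_pair]
      exact (hpos _ _).ne'
    refine mul_left_cancel₀ hp ?_
    linear_combination (-setMarg q (G.neighborSet k ∩ S) x) * h4 x +
      setMarg q {k} x * h3 x + setMarg q (S \ {k}) x * h2 x
  have h6 : insert k (G.neighborSet k ∩ (S \ {i})) = U \ {i} := by
    rw [hU, Set.insert_sdiff_of_notMem _ (by simpa using hij.ne'), Set.inter_sdiff_assoc]
  rw [h6, Set.sdiff_sdiff_comm, ← Set.inter_sdiff_assoc]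
  rw [mul_comm, mul_comm (setMarg q (U \ {i}) x)]
  rw [← sum_setMarg_update q (show i ∈ G.neighborSet k ∩ S from ⟨hij.symm, hi⟩),
    ← sum_setMarg_update q (show i ∈ S \ {k} from ⟨hi, hij.ne⟩), Finset.sum_mul, Finset.sum_mul]
  refine Finset.sum_congr rfl fun a _ => ?_
  have := h5 (Function.update x i a)
  rwa [setMarg_update q (S := S \ {i}) (by simp), setMarg_update q (S := U \ {i}) (by simp)] at this

/-- Extend the induced forest to a tree on `S` and take a leaf of that tree. -/
theorem exists_mem_forall_adj_eq {G : SimpleGraph (Fin d)} (hG : G.IsAcyclic) {S : Set (Fin d)}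
    (hS : S.Nonempty) : ∃ i ∈ S, ∀ j ∈ S, ∀ k ∈ S, G.Adj i j → G.Adj i k → j = k := by
  classical
  by_cases hsub : S.Subsingleton
  · obtain ⟨i, hi⟩ := hS
    exact ⟨i, hi, fun j hj k hk _ _ => hsub hj hk⟩
  have : Nontrivial S := Set.nontrivial_coe_sort.2 (Set.not_subsingleton_iff.1 hsub)
  obtain ⟨T, h1, _, h2⟩ :=
    (SimpleGraph.connected_top (V := S)).exists_isTree_le_of_le_of_isAcyclic
      (le_top : G.induce S ≤ ⊤) (hG.induce S)
  obtain ⟨v, hv⟩ := h2.exists_vert_degree_one_of_nontrivial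
  rw [SimpleGraph.degree_eq_one_iff_existsUnique_adj] at hv
  refine ⟨v, v.2, fun j hj k hk hvj hvk => ?_⟩
  have e1 : T.Adj v ⟨j, hj⟩ := h1 hvj
  have e2 : T.Adj v ⟨k, hk⟩ := h1 hvk
  exact congrArg Subtype.val (hv.unique e1 e2)

/-- `f` depends only on the coordinates in `e`. -/
def DependsOnPair (e : Sym2 (Fin d)) (f : (Fin d → Fin r) → ℝ) : Prop :=
  ∀ x y : Fin d → Fin r, (∀ i ∈ e, x i = y i) → f x = f y

/-- A positive mass function that factorizes over the nodes and the edges of `G`. -/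
def Factorizes (f : (Fin d → Fin r) → ℝ) (G : SimpleGraph (Fin d)) : Prop :=
  ∃ g : Sym2 (Fin d) → (Fin d → Fin r) → ℝ, (∀ e, DependsOnPair e (g e)) ∧
    (∀ e, ¬ e.IsDiag → e ∉ G.edgeSet → ∀ x, g e x = 0) ∧
    ∀ x, f x = Real.exp (∑ e, g e x)

theorem Factorizes.mul {f h : (Fin d → Fin r) → ℝ} {G : SimpleGraph (Fin d)}
    (hf : Factorizes f G) {e : Sym2 (Fin d)} (he : e.IsDiag ∨ e ∈ G.edgeSet)
    (hh : DependsOnPair e h) (hpos : ∀ x, 0 < h x) : Factorizes (fun x => f x * h x) G := by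
  classical
  obtain ⟨g, h1, h2, h3⟩ := hf
  refine ⟨fun e' x => g e' x + if e' = e then Real.log (h x) else 0, ?_, ?_, ?_⟩
  · intro e' x y hxy
    simp only [h1 e' x y hxy]
    split_ifs with h'
    · subst h'
      rw [hh x y hxy]
    · rfl
  · intro e' hd he' x
    have : e' ≠ e := by
      rintro rfl
      rcases he with h | h
      · exact hd h
      · exact he' h
    simp [h2 e' hd he' x, this]
  · intro x
    simp only [Finset.sum_add_distrib, Finset.sum_ite_eq', Finset.mem_univ, if_true]
    rw [Real.exp_add, Real.exp_log (hpos x), h3]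

/-- A pairwise positive distribution that is Markov on a forest factorizes over it. -/
theorem factorizes_of_isMarkovMass {q : (Fin d → Fin r) → ℝ} {G : SimpleGraph (Fin d)}
    (hG : G.IsAcyclic) (hq : ∑ x, q x = 1) (hnode : ∀ i a, 0 < nodeMarg q i a)
    (hpos : ∀ i j, i ≠ j → ∀ a b, 0 < pairMarg q i j a b) (h : IsMarkovMass q G) :
    Factorizes q G := by
  -- Peel off a vertex `i`: an isolated one contributes the factor q(x_i), a leaf with neighbour `j`
  -- the factor q(x_i, x_j)/q(x_j).
  have key : ∀ (n : ℕ) (S : Set (Fin d)), S.ncard = n → IsMarkovMassOn q G S →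
      Factorizes (setMarg q S) G := by
    intro n
    induction n with
    | zero =>
      intro S hS _
      rw [Set.ncard_eq_zero] at hS
      subst hS
      exact ⟨fun _ _ => 0, fun _ _ _ _ => rfl, fun _ _ _ _ => rfl, fun x => by
        simp [setMarg_empty, hq]⟩
    | succ n ih =>
      intro S hS hM
      have hne : S.Nonempty := Set.nonempty_of_ncard_ne_zero (by omega)
      obtain ⟨i, hi, huniq⟩ := exists_mem_forall_adj_eq hG hne
      have hcard : (S \ {i}).ncard = n := by
        have := Set.ncard_sdiff_singleton_add_one hi
        omega
      by_cases hN : ∃ j ∈ S, G.Adj i j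
      · obtain ⟨j, hj, hij⟩ := hN
        have hNj : G.neighborSet i ∩ S = {j} := by
          ext k
          simp only [Set.mem_inter_iff, SimpleGraph.mem_neighborSet, Set.mem_singleton_iff]
          constructor
          · rintro ⟨h1, h2⟩
            exact huniq k h2 j hj h1 hij
          · rintro rfl
            exact ⟨hij, hj⟩
        have h1 := ih _ hcard (isMarkovMassOn_diff_of_leaf hM hi hj hij hNj (hpos i j hij.ne))
        have h2 := h1.mul (e := s(i, j))
          (h := fun x => pairMarg q i j (x i) (x j) / nodeMarg q j (x j)) (Or.inr hij)
          (fun x y hxy => by simp [hxy i (by simp), hxy j (by simp)])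
          (fun x => div_pos (hpos i j hij.ne _ _) (hnode _ _))
        convert h2 using 1
        funext x
        have h3 := hM i hi x
        rw [hNj, setMarg_singleton, setMarg_pair] at h3
        have := hnode j (x j)
        field_simp
        linarith
      · push Not at hN
        have h1 := ih _ hcard (isMarkovMassOn_diff_of_isolated hM hi hN)
        have h2 := h1.mul (e := s(i, i)) (h := fun x => nodeMarg q i (x i)) (Or.inl (by simp))
          (fun x y hxy => by simp [hxy i (by simp)]) (fun x => hnode _ _)
        convert h2 using 1
        funext x
        have h3 := hM i hi x
        have hN0 : G.neighborSet i ∩ S = ∅ := by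
          ext k
          simp only [Set.mem_inter_iff, SimpleGraph.mem_neighborSet, Set.mem_empty_iff_false,
            iff_false, not_and]
          exact fun h1 h2 => hN k h2 h1
        rw [hN0, setMarg_empty, hq, insert_empty_eq, setMarg_singleton] at h3
        linarith
  obtain ⟨g, h1, h2, h3⟩ := key _ Set.univ rfl (isMarkovMassOn_univ h)
  exact ⟨g, h1, h2, fun x => by rw [← h3, setMarg_univ]⟩

theorem sum_mul_eq_of_dependsOnPair {p q : (Fin d → Fin r) → ℝ} {i j : Fin d}
    (h : pairMarg p i j = pairMarg q i j) {f : (Fin d → Fin r) → ℝ}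
    (hf : DependsOnPair s(i, j) f) : ∑ x, p x * f x = ∑ x, q x * f x := by
  by_cases hne : Nonempty (Fin d → Fin r)
  swap
  · rw [not_nonempty_iff] at hne
    simp
  obtain ⟨z⟩ := hne
  let F : Fin r → Fin r → ℝ := fun a b => f (Function.update (Function.update z i a) j b)
  have hF : ∀ x, f x = F (x i) (x j) := by
    intro x
    refine hf _ _ fun k hk => ?_
    rcases Sym2.mem_iff.1 hk with rfl | rfl
    · by_cases hkj : k = j
      · subst hkj; simp
      · simp [Function.update_of_ne hkj]
    · simp
  simp only [hF]
  rw [sum_mul_comp_pair, sum_mul_comp_pair, h]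

theorem pairMarg_self_eq {p q : (Fin d → Fin r) → ℝ} {i : Fin d}
    (h : nodeMarg p i = nodeMarg q i) : pairMarg p i i = pairMarg q i i := by
  funext a b
  by_cases hab : a = b
  · subst hab
    have := congrFun h a
    simpa [pairMarg, nodeMarg] using this
  · have : ∀ x : Fin d → Fin r, ¬ (x i = a ∧ x i = b) := fun x hx => hab (hx.1.symm.trans hx.2)
    simp [pairMarg, this]

/-- log f is a sum of potentials on nodes and edges of `G`, so its expectation depends only on those
marginals. -/
theorem Factorizes.sum_mul_log_eq {p q f : (Fin d → Fin r) → ℝ} {G : SimpleGraph (Fin d)}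
    (hf : Factorizes f G) (hnode : ∀ i, nodeMarg p i = nodeMarg q i)
    (hpair : ∀ i j, G.Adj i j → pairMarg p i j = pairMarg q i j) :
    ∑ x, p x * Real.log (f x) = ∑ x, q x * Real.log (f x) := by
  obtain ⟨g, h1, h2, h3⟩ := hf
  simp only [h3, Real.log_exp, Finset.mul_sum]
  rw [Finset.sum_comm]
  conv_rhs => rw [Finset.sum_comm]
  refine Finset.sum_congr rfl fun e _ => ?_
  by_cases he : e.IsDiag ∨ e ∈ G.edgeSet
  · have hd := h1 e
    induction e with | _ i j
    refine sum_mul_eq_of_dependsOnPair ?_ hd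
    rcases he with he | he
    · rw [Sym2.mk_isDiag_iff] at he
      subst he
      exact pairMarg_self_eq (hnode i)
    · exact hpair i j he
  · push Not at he
    simp [h2 e he.1 he.2]

theorem Factorizes.mono {f : (Fin d → Fin r) → ℝ} {G H : SimpleGraph (Fin d)}
    (hf : Factorizes f G) (h : G ≤ H) : Factorizes f H := by
  obtain ⟨g, h1, h2, h3⟩ := hf
  exact ⟨g, h1, fun e hd he => h2 e hd fun h' => he (SimpleGraph.edgeSet_mono h h'), h3⟩

theorem Factorizes.pos {f : (Fin d → Fin r) → ℝ} {G : SimpleGraph (Fin d)}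
    (hf : Factorizes f G) (x : Fin d → Fin r) : 0 < f x := by
  obtain ⟨g, _, _, h3⟩ := hf
  rw [h3]
  exact Real.exp_pos _

end Markov

end ForestLearning

namespace ForestLearning

/-! ### Markov property of factorizing laws, and the tree approximation `chowLiu`. -/

section Factorization

variable {d r : ℕ}

/-- Potentials involving `i` take the same two values in exchanged order, as the other endpoint
agrees in `x` and `y`; the remaining potentials do not see the swap. -/
theorem Factorizes.mul_swap {f : (Fin d → Fin r) → ℝ} {G : SimpleGraph (Fin d)}
    (hf : Factorizes f G) {i : Fin d} {x y : Fin d → Fin r} (h : ∀ j, G.Adj i j → y j = x j) :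
    f x * f y = f (Function.update y i (x i)) * f (Function.update x i (y i)) := by
  obtain ⟨g, h1, h2, h3⟩ := hf
  simp only [h3, ← Real.exp_add, ← Finset.sum_add_distrib]
  congr 1
  refine Finset.sum_congr rfl fun e _ => ?_
  by_cases hi : i ∈ e
  · by_cases he : e.IsDiag ∨ e ∈ G.edgeSet
    · have hxy : ∀ k ∈ e, k ≠ i → y k = x k := by
        intro k hk hki
        have hek : e = s(i, k) := (Sym2.mem_and_mem_iff (Ne.symm hki)).1 ⟨hi, hk⟩
        subst hek
        rcases he with he | he
        · exact absurd (Sym2.mk_isDiag_iff.1 he) (Ne.symm hki)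
        · exact h k he
      congr 1
      · refine h1 e _ _ fun k hk => ?_
        by_cases hki : k = i
        · subst hki; simp
        · rw [Function.update_of_ne hki, hxy k hk hki]
      · refine h1 e _ _ fun k hk => ?_
        by_cases hki : k = i
        · subst hki; simp
        · rw [Function.update_of_ne hki, hxy k hk hki]
    · push Not at he
      simp [h2 e he.1 he.2]
  · have : ∀ (u : Fin d → Fin r) a, g e (Function.update u i a) = g e u := fun u a =>
      h1 e _ _ fun k hk => Function.update_of_ne (by rintro rfl; exact hi hk) _ _
    rw [this, this, add_comm]

/-- Expanding both sides into sums of products of two values of `f`, swapping the `i`-th coordinates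
matches the terms bijectively. -/
theorem Factorizes.isMarkovMass {f : (Fin d → Fin r) → ℝ} {G : SimpleGraph (Fin d)}
    (hf : Factorizes f G) : IsMarkovMass f G := by
  classical
  intro i x
  unfold setMarg
  rw [Finset.mul_sum, Finset.sum_mul_sum, ← Finset.sum_product']
  refine Finset.sum_nbij' (fun y => (Function.update y i (x i), Function.update x i (y i)))
    (fun c => Function.update c.1 i (c.2 i)) ?_ ?_ ?_ ?_ ?_
  · intro y hy
    simp only [Finset.mem_filter, Finset.mem_univ, true_and, Finset.mem_product] at hy ⊢
    constructor
    · rintro j (rfl | hj)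
      · simp
      · rw [Function.update_of_ne (by rintro rfl; exact G.loopless.irrefl _ hj), hy j hj]
    · intro j hj
      rw [Function.update_of_ne (by simpa using hj)]
  · intro c hc
    simp only [Finset.mem_filter, Finset.mem_univ, true_and, Finset.mem_product] at hc ⊢
    intro j hj
    rw [Function.update_of_ne (by rintro rfl; exact G.loopless.irrefl _ hj)]
    exact hc.1 j (Or.inr hj)
  · intro y _
    simp
  · intro c hc
    simp only [Finset.mem_filter, Finset.mem_univ, true_and, Finset.mem_product] at hc
    refine Prod.ext ?_ ?_
    · have := hc.1 i (Or.inl rfl)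
      simp [← this]
    · funext j
      by_cases hj : j = i
      · subst hj; simp
      · simp [Function.update_of_ne hj, hc.2 j hj]
  · intro y hy
    simp only [Finset.mem_filter, Finset.mem_univ, true_and] at hy
    exact hf.mul_swap fun j hj => hy j hj

theorem Factorizes.mul_update_eq {f : (Fin d → Fin r) → ℝ} {G : SimpleGraph (Fin d)}
    (hf : Factorizes f G) {i j : Fin d} (hadj : ¬ G.Adj i j) (z : Fin d → Fin r)
    (a a' b b' : Fin r) :
    f (Function.update (Function.update z i a) j b) *
        f (Function.update (Function.update z i a') j b') =
      f (Function.update (Function.update z i a') j b) *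
        f (Function.update (Function.update z i a) j b') := by
  have h := hf.mul_swap (i := j) (x := Function.update (Function.update z i a) j b)
    (y := Function.update (Function.update z i a') j b') (fun k hk => by
      have h1 : k ≠ j := fun h => G.loopless.irrefl _ (h ▸ hk)
      have h2 : k ≠ i := fun h => hadj (h ▸ hk).symm
      simp [h1, h2])
  simpa using h

/-- Both `q` and `L` have trivial cross-ratio in the coordinates i and j: `q` because `i` and `j`
are nonadjacent in `G`, `L` because they are nonadjacent in `H`. So the pair marginal of `p` has
trivial cross-ratio, and summing over the second pair of values gives independence. -/
theorem pairMI_eq_zero_of_isMarkovMass {p q L : (Fin d → Fin r) → ℝ}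
    (hp : p ∈ stdSimplex ℝ (Fin d → Fin r)) {G H : SimpleGraph (Fin d)} {i j : Fin d}
    (hij : i ≠ j) (hnode : ∀ i a, 0 < nodeMarg p i a) (hq : ∀ x, 0 < q x)
    (hL : Factorizes L H) (hH : ¬ H.Adj i j)
    (hqL : ∀ x, q x = L x * (pairMarg p i j (x i) (x j) /
      (nodeMarg p i (x i) * nodeMarg p j (x j))))
    (hM : IsMarkovMass q G) (hG : ¬ G.Adj i j) : pairMI p s(i, j) = 0 := by
  classical
  have hne : Nonempty (Fin d → Fin r) := by
    by_contra hcon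
    rw [not_nonempty_iff] at hcon
    have := hp.2
    simp at this
  obtain ⟨z⟩ := hne
  let x : Fin r → Fin r → (Fin d → Fin r) := fun a b =>
    Function.update (Function.update z i a) j b
  have hx : ∀ a b, x a b i = a ∧ x a b j = b := fun a b => by simp [x, hij]
  have hcross : ∀ a a' b b', q (x a b) * q (x a' b') = q (x a' b) * q (x a b') := by
    intro a a' b b'
    have h1 : ∀ a b, q (x a b) * setMarg q (G.neighborSet i) z =
        setMarg q (insert i (G.neighborSet i)) (Function.update z i a) *
          setMarg q {i}ᶜ (Function.update z j b) := by
      intro a b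
      have h := hM i (x a b)
      have e1 : setMarg q (G.neighborSet i) (x a b) = setMarg q (G.neighborSet i) z := by
        rw [setMarg_update q (by simpa using hG), setMarg_update q (by simp)]
      have e2 : setMarg q (insert i (G.neighborSet i)) (x a b) =
          setMarg q (insert i (G.neighborSet i)) (Function.update z i a) :=
        setMarg_update q (by simpa using ⟨hij.symm, hG⟩) _ _
      have e3 : setMarg q {i}ᶜ (x a b) = setMarg q {i}ᶜ (Function.update z j b) := by
        have : x a b = Function.update (Function.update z j b) i a :=
          (Function.update_comm hij a b z)
        rw [this, setMarg_update q (by simp)]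
      rw [e1, e2, e3] at h
      exact h
    have hpos : 0 < setMarg q (G.neighborSet i) z :=
      Finset.sum_pos (fun y _ => hq y) ⟨z, by simp⟩
    have h2 := h1 a b
    have h3 := h1 a' b'
    have h4 := h1 a' b
    have h5 := h1 a b'
    refine mul_right_cancel₀ (mul_pos hpos hpos).ne' ?_
    calc _ = (q (x a b) * setMarg q (G.neighborSet i) z) *
          (q (x a' b') * setMarg q (G.neighborSet i) z) := by ring
      _ = (q (x a' b) * setMarg q (G.neighborSet i) z) *
          (q (x a b') * setMarg q (G.neighborSet i) z) := by rw [h2, h3, h4, h5]; ring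
      _ = _ := by ring
  have hpair : ∀ a a' b b', pairMarg p i j a b * pairMarg p i j a' b' =
      pairMarg p i j a' b * pairMarg p i j a b' := by
    intro a a' b b'
    have h1 := hcross a a' b b'
    simp only [hqL, hx] at h1
    have h2 : L (x a b) * L (x a' b') = L (x a' b) * L (x a b') :=
      hL.mul_update_eq hH z a a' b b'
    have h3 : 0 < L (x a' b) * L (x a b') := mul_pos (hL.pos _) (hL.pos _)
    have := hnode i a
    have := hnode i a'
    have := hnode j b
    have := hnode j b'
    have h4 : (L (x a b) * L (x a' b')) * (pairMarg p i j a b * pairMarg p i j a' b') =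
        (L (x a' b) * L (x a b')) * (pairMarg p i j a' b * pairMarg p i j a b') := by
      field_simp at h1
      linarith
    rw [h2] at h4
    exact mul_left_cancel₀ h3.ne' h4
  rw [pairMI_eq_zero_iff hp]
  intro a b
  have h1 : ∑ a', ∑ b', pairMarg p i j a b * pairMarg p i j a' b' =
      ∑ a', ∑ b', pairMarg p i j a' b * pairMarg p i j a b' :=
    Finset.sum_congr rfl fun a' _ => Finset.sum_congr rfl fun b' _ => hpair a a' b b'
  simp only [← Finset.mul_sum, sum_pairMarg_right, sum_nodeMarg, hp.2, ← Finset.sum_mul,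
    sum_pairMarg_left, mul_one] at h1
  rw [h1, mul_comm]

/-- The ratio `P(x_i, x_j) / (P(x_i) P(x_j))` for an unordered pair of coordinates. -/
noncomputable def pairRatio (p : (Fin d → Fin r) → ℝ) (e : Sym2 (Fin d)) (x : Fin d → Fin r) :
    ℝ :=
  Sym2.lift ⟨fun i j => pairMarg p i j (x i) (x j) / (nodeMarg p i (x i) * nodeMarg p j (x j)),
    fun i j => by simp only [pairMarg_swap p i j, mul_comm]⟩ e

theorem pairRatio_mk (p : (Fin d → Fin r) → ℝ) (i j : Fin d) (x : Fin d → Fin r) :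
    pairRatio p s(i, j) x =
      pairMarg p i j (x i) (x j) / (nodeMarg p i (x i) * nodeMarg p j (x j)) := rfl

open Classical in
/-- The product of the node marginals of `p` and of the pair ratios along the edges of `H`. -/
noncomputable def chowLiu (p : (Fin d → Fin r) → ℝ) (H : SimpleGraph (Fin d))
    (x : Fin d → Fin r) : ℝ :=
  (∏ i, nodeMarg p i (x i)) * ∏ e with e ∈ H.edgeSet, pairRatio p e x

theorem dependsOnPair_pairRatio (p : (Fin d → Fin r) → ℝ) (e : Sym2 (Fin d)) :
    DependsOnPair e (pairRatio p e) := by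
  induction e with | _ i j
  intro x y h
  simp only [pairRatio_mk, h i (by simp), h j (by simp)]

/-- Single and pair marginals of `p` are positive. -/
structure PositiveMarginals (p : (Fin d → Fin r) → ℝ) : Prop where
  mem : p ∈ stdSimplex ℝ (Fin d → Fin r)
  node : ∀ i a, 0 < nodeMarg p i a
  pair : ∀ i j, i ≠ j → ∀ a b, 0 < pairMarg p i j a b

theorem PositiveMarginals.pairRatio_pos {p : (Fin d → Fin r) → ℝ} (hp : PositiveMarginals p)
    {e : Sym2 (Fin d)} (he : ¬ e.IsDiag) (x : Fin d → Fin r) : 0 < pairRatio p e x := by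
  induction e with | _ i j
  rw [Sym2.mk_isDiag_iff] at he
  exact div_pos (hp.pair i j he _ _) (mul_pos (hp.node _ _) (hp.node _ _))

theorem PositiveMarginals.factorizes_chowLiu {p : (Fin d → Fin r) → ℝ}
    (hp : PositiveMarginals p) (H : SimpleGraph (Fin d)) : Factorizes (chowLiu p H) H := by
  classical
  have h1 : ∀ s : Finset (Fin d), Factorizes (fun x => ∏ i ∈ s, nodeMarg p i (x i)) H := by
    intro s
    induction s using Finset.induction with
    | empty =>
      exact ⟨fun _ _ => 0, fun _ _ _ _ => rfl, fun _ _ _ _ => rfl, fun x => by simp⟩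
    | insert i s hi ih =>
      have := ih.mul (e := s(i, i)) (h := fun x => nodeMarg p i (x i)) (Or.inl (by simp))
        (fun x y h => by simp [h i (by simp)]) (fun x => hp.node _ _)
      convert! this using 2 with x
      rw [Finset.prod_insert hi, mul_comm]
  have h2 : ∀ s : Finset (Sym2 (Fin d)), (∀ e ∈ s, e ∈ H.edgeSet) →
      Factorizes (fun x => (∏ i, nodeMarg p i (x i)) * ∏ e ∈ s, pairRatio p e x) H := by
    intro s
    induction s using Finset.induction with
    | empty => intro _; simpa using h1 Finset.univ
    | insert e s he ih =>
      intro hs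
      have hmem := hs e (Finset.mem_insert_self _ _)
      have := (ih fun e' he' => hs e' (Finset.mem_insert_of_mem he')).mul (e := e)
        (h := pairRatio p e) (Or.inr hmem) (dependsOnPair_pairRatio p e)
        (hp.pairRatio_pos (SimpleGraph.not_isDiag_of_mem_edgeSet H hmem))
      convert! this using 2 with x
      rw [Finset.prod_insert he]
      ring
  exact h2 _ fun e he => by simpa using he

theorem chowLiu_deleteEdges_singleton (p : (Fin d → Fin r) → ℝ) {H : SimpleGraph (Fin d)}
    {f : Sym2 (Fin d)} (hf : f ∈ H.edgeSet) (x : Fin d → Fin r) :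
    chowLiu p H x = chowLiu p (H.deleteEdges {f}) x * pairRatio p f x := by
  classical
  unfold chowLiu
  rw [mul_assoc]
  congr 1
  rw [← Finset.prod_erase_mul (Finset.univ.filter fun e => e ∈ H.edgeSet)
    (fun e => pairRatio p e x) (by simpa using hf : f ∈ _)]
  congr 1
  refine Finset.prod_congr ?_ fun _ _ => rfl
  ext e
  simp [SimpleGraph.edgeSet_deleteEdges, and_comm]

theorem chowLiu_deleteEdges_zero {p : (Fin d → Fin r) → ℝ} (hp : PositiveMarginals p)
    (T : SimpleGraph (Fin d)) : chowLiu p (T.deleteEdges {e | pairMI p e = 0}) = chowLiu p T := by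
  classical
  funext x
  unfold chowLiu
  congr 1
  refine Finset.prod_subset (fun e he => ?_) fun e he he' => ?_
  · simp only [SimpleGraph.edgeSet_deleteEdges, Finset.mem_filter, Finset.mem_univ, true_and]
      at he ⊢
    exact he.1
  · simp only [SimpleGraph.edgeSet_deleteEdges, Finset.mem_filter, Finset.mem_univ, true_and,
      Set.mem_sdiff, Set.mem_ofPred_eq, not_and, not_not] at he he'
    have h0 := he' he
    induction e with | _ i j
    rw [pairMI_eq_zero_iff hp.mem] at h0
    rw [pairRatio_mk, h0, div_self (mul_pos (hp.node _ _) (hp.node _ _)).ne']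

theorem exists_chowLiu_eq_mul_of_isolated (p : (Fin d → Fin r) → ℝ) {H : SimpleGraph (Fin d)}
    {i : Fin d} (hi : ∀ j, ¬ H.Adj i j) :
    ∃ K : (Fin d → Fin r) → ℝ, (∀ x a, K (Function.update x i a) = K x) ∧
      ∀ x, chowLiu p H x = nodeMarg p i (x i) * K x := by
  classical
  refine ⟨fun x => (∏ k ∈ Finset.univ.erase i, nodeMarg p k (x k)) *
    ∏ e with e ∈ H.edgeSet, pairRatio p e x, fun x a => ?_, fun x => ?_⟩
  · refine congrArg₂ (· * ·) ?_ ?_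
    · refine Finset.prod_congr rfl fun k hk => ?_
      rw [Function.update_of_ne (Finset.ne_of_mem_erase hk)]
    · refine Finset.prod_congr rfl fun e he => dependsOnPair_pairRatio p e _ _ fun k hk => ?_
      refine Function.update_of_ne ?_ _ _
      rintro rfl
      obtain ⟨j, rfl⟩ := hk
      exact hi j (by simpa using he)
  · simp only [chowLiu]
    rw [← Finset.mul_prod_erase Finset.univ (fun i => nodeMarg p i (x i)) (Finset.mem_univ i),
      mul_assoc]

theorem sum_eq_of_sum_update_eq (i : Fin d) {f g : (Fin d → Fin r) → ℝ}
    (h : ∀ x, ∑ a, f (Function.update x i a) = ∑ a, g (Function.update x i a)) :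
    ∑ x, f x = ∑ x, g x := by
  by_cases hr : r = 0
  · subst hr
    have : IsEmpty (Fin d → Fin 0) := ⟨fun x => (x i).elim0⟩
    simp
  have hf := sum_sum_update i fun x (_ : Fin r) => f x
  have hg := sum_sum_update i fun x (_ : Fin r) => g x
  simp only [h] at hf
  rw [hf] at hg
  simp only [Finset.sum_const, Finset.card_univ, Fintype.card_fin, nsmul_eq_mul,
    ← Finset.mul_sum] at hg
  exact mul_left_cancel₀ (by exact_mod_cast hr) hg

/-- Induct on the number of edges by deleting the edge at a leaf `i` with neighbour `j`. The leaf
enters only through the conditional law p(x_i | x_j), which sums to one. So marginals avoiding `i`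
are those of the smaller forest, and the pair ij acquires p(x_j)·p(x_i | x_j). -/
theorem PositiveMarginals.chowLiu_marginals {p : (Fin d → Fin r) → ℝ}
    (hp : PositiveMarginals p) {H : SimpleGraph (Fin d)} (hH : H.IsAcyclic) :
    ∑ x, chowLiu p H x = 1 ∧ (∀ i, nodeMarg (chowLiu p H) i = nodeMarg p i) ∧
      ∀ i j, H.Adj i j → pairMarg (chowLiu p H) i j = pairMarg p i j := by
  classical
  generalize hn : H.edgeSet.ncard = n
  induction n generalizing H with
  | zero =>
    rw [Set.ncard_eq_zero, SimpleGraph.edgeSet_eq_empty] at hn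
    subst hn
    have hcl : ∀ x, chowLiu p ⊥ x = ∏ k, nodeMarg p k (x k) := by
      intro x
      simp [chowLiu]
    have hsum : ∑ x, chowLiu p ⊥ x = 1 := by
      have := Finset.prod_univ_sum (fun _ : Fin d => (Finset.univ : Finset (Fin r)))
        (fun k a => nodeMarg p k a)
      simp only [sum_nodeMarg, hp.mem.2, Finset.prod_const_one, Fintype.piFinset_univ] at this
      simp only [hcl, this]
    refine ⟨hsum, fun i => ?_, fun i j h => absurd h (by simp)⟩
    funext a
    obtain ⟨K, hK, hc⟩ := exists_chowLiu_eq_mul_of_isolated p (H := ⊥) (i := i) (by simp)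
    rw [nodeMarg_eq_sum_ite]
    have := sum_eq_of_sum_update_eq i (f := fun x => chowLiu p ⊥ x * if x i = a then 1 else 0)
      (g := fun x => chowLiu p ⊥ x * nodeMarg p i a) (fun x => by
        simp only [hc, hK, Function.update_self, ← Finset.sum_mul, sum_nodeMarg, hp.mem.2]
        simp [mul_comm])
    rw [this, ← Finset.sum_mul, hsum, one_mul]
  | succ n ih =>
    -- The leaf is sought among non-isolated vertices, so that it has a neighbour.
    have hne : {v | ∃ u, H.Adj v u}.Nonempty := by
      obtain ⟨e, he⟩ := Set.nonempty_of_ncard_ne_zero (show H.edgeSet.ncard ≠ 0 by omega)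
      induction e with | _ u v
      exact ⟨u, v, he⟩
    obtain ⟨i, ⟨j, hij⟩, huniq⟩ := exists_mem_forall_adj_eq hH hne
    have hleaf : ∀ k, H.Adj i k → k = j := fun k hk =>
      huniq k ⟨i, hk.symm⟩ j ⟨i, hij.symm⟩ hk hij
    set H' := H.deleteEdges {s(i, j)} with hH'
    have hmem : s(i, j) ∈ H.edgeSet := hij
    have hcard : H'.edgeSet.ncard = n := by
      have := Set.ncard_sdiff_singleton_add_one hmem
      rw [hH', SimpleGraph.edgeSet_deleteEdges]
      omega
    obtain ⟨ih1, ih2, ih3⟩ := ih (H := H') (hH.anti (SimpleGraph.deleteEdges_le _)) hcard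
    have hiso : ∀ k, ¬ H'.Adj i k := by
      intro k hk
      rw [hH', SimpleGraph.deleteEdges_adj] at hk
      exact hk.2 (by rw [hleaf k hk.1]; rfl)
    obtain ⟨K, hK, hc⟩ := exists_chowLiu_eq_mul_of_isolated p hiso
    have hcH : ∀ x, chowLiu p H x = K x * (pairMarg p i j (x i) (x j) / nodeMarg p j (x j)) := by
      intro x
      rw [chowLiu_deleteEdges_singleton p hmem, hc, pairRatio_mk]
      have := hp.node i (x i)
      have := hp.node j (x j)
      field_simp
    have hji : j ≠ i := hij.ne'
    have hpres : ∀ f : (Fin d → Fin r) → ℝ, (∀ x a, f (Function.update x i a) = f x) →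
        ∑ x, chowLiu p H x * f x = ∑ x, chowLiu p H' x * f x := by
      intro f hf
      refine sum_eq_of_sum_update_eq i fun x => ?_
      simp only [hcH, hc, hK, hf, Function.update_self, Function.update_of_ne hji,
        ← Finset.sum_mul, ← Finset.mul_sum, ← Finset.sum_div, sum_pairMarg_left, sum_nodeMarg,
        hp.mem.2, div_self (hp.node j (x j)).ne']
      ring
    have hpair : pairMarg (chowLiu p H) i j = pairMarg p i j := by
      funext a b
      rw [pairMarg_eq_sum_ite]
      have := sum_eq_of_sum_update_eq i
        (f := fun x => chowLiu p H x * if x i = a ∧ x j = b then 1 else 0)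
        (g := fun x => chowLiu p H' x *
          ((if x j = b then 1 else 0) * (pairMarg p i j a b / nodeMarg p j b))) (fun x => by
          simp only [hcH, hc, hK, Function.update_self, Function.update_of_ne hji]
          by_cases hb : x j = b
          · simp only [hb, and_true, if_true, one_mul, ← Finset.sum_mul, sum_nodeMarg, hp.mem.2]
            simp
          · simp [hb])
      rw [this]
      simp only [← mul_assoc, ← Finset.sum_mul, ← nodeMarg_eq_sum_ite, ih2 j]
      rw [mul_div_cancel₀ _ (hp.node j b).ne']
    have hpairs : ∀ u v, H.Adj u v → pairMarg (chowLiu p H) u v = pairMarg p u v := by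
      intro u v huv
      by_cases hui : u = i
      · subst hui
        rw [hleaf v huv]
        exact hpair
      by_cases hvi : v = i
      · subst hvi
        rw [hleaf u huv.symm]
        funext a b
        rw [pairMarg_swap, hpair, pairMarg_swap]
      have huv' : H'.Adj u v := by
        rw [hH', SimpleGraph.deleteEdges_adj]
        refine ⟨huv, fun h => ?_⟩
        rcases Sym2.eq_iff.1 (Set.mem_singleton_iff.1 h) with h | h
        · exact hui h.1
        · exact hvi h.2
      funext a b
      rw [← ih3 u v huv', pairMarg_eq_sum_ite, pairMarg_eq_sum_ite]
      exact hpres _ fun x c => by simp [Function.update_of_ne hui, Function.update_of_ne hvi]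
    refine ⟨?_, fun k => ?_, hpairs⟩
    · have := hpres (fun _ => 1) fun _ _ => rfl
      simpa [ih1] using this
    · funext a
      by_cases hki : k = i
      · subst hki
        rw [← sum_pairMarg_right _ k j, ← sum_pairMarg_right _ k j, hpair]
      · rw [← ih2 k, nodeMarg_eq_sum_ite, nodeMarg_eq_sum_ite]
        exact hpres _ fun x c => by simp [Function.update_of_ne hki]

theorem PositiveMarginals.chowLiu_mem_stdSimplex {p : (Fin d → Fin r) → ℝ}
    (hp : PositiveMarginals p) {H : SimpleGraph (Fin d)} (hH : H.IsAcyclic) :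
    chowLiu p H ∈ stdSimplex ℝ (Fin d → Fin r) :=
  ⟨fun x => ((hp.factorizes_chowLiu H).pos x).le, (hp.chowLiu_marginals hH).1⟩

/-- The expected logarithm of a pair ratio is the mutual information of the pair, so maximizing the
likelihood over trees is maximizing their weight. -/
theorem PositiveMarginals.sum_mul_log_chowLiu {p : (Fin d → Fin r) → ℝ}
    (hp : PositiveMarginals p) (H : SimpleGraph (Fin d)) :
    ∑ x, p x * Real.log (chowLiu p H x) =
      ∑ i, ∑ x, p x * Real.log (nodeMarg p i (x i)) + graphWeight (pairMI p) H := by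
  classical
  have h1 : ∀ x, p x * Real.log (chowLiu p H x) = ∑ i, p x * Real.log (nodeMarg p i (x i)) +
      ∑ e with e ∈ H.edgeSet, p x * Real.log (pairRatio p e x) := by
    intro x
    have h2 : ∀ e ∈ Finset.univ.filter fun e => e ∈ H.edgeSet, pairRatio p e x ≠ 0 := fun e he =>
      (hp.pairRatio_pos (SimpleGraph.not_isDiag_of_mem_edgeSet H (by simpa using he)) x).ne'
    have h3 : ∀ i ∈ (Finset.univ : Finset (Fin d)), nodeMarg p i (x i) ≠ 0 := fun i _ =>
      (hp.node i _).ne'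
    rw [chowLiu, Real.log_mul (Finset.prod_ne_zero_iff.2 h3) (Finset.prod_ne_zero_iff.2 h2),
      Real.log_prod h3, Real.log_prod h2, mul_add, Finset.mul_sum, Finset.mul_sum]
  simp only [h1, Finset.sum_add_distrib]
  rw [Finset.sum_comm]
  congr 1
  rw [Finset.sum_comm]
  refine Finset.sum_congr rfl fun e _ => ?_
  induction e with | _ i j
  rw [pairMI_mk, mutualInfo_pairMarg, ← sum_mul_comp_pair p i j fun a b =>
    Real.log (pairMarg p i j a b / (nodeMarg p i a * nodeMarg p j b))]
  rfl

/-- An edge of positive weight cannot be dropped from any Markov graph; hence removing the zero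
edges from a forest already gives the minimal graph. -/
theorem PositiveMarginals.adj_of_isMarkovMass_chowLiu {p : (Fin d → Fin r) → ℝ}
    (hp : PositiveMarginals p) {T G : SimpleGraph (Fin d)} (hM : IsMarkovMass (chowLiu p T) G) :
    T.deleteEdges {e | pairMI p e = 0} ≤ G := by
  intro i j hij
  rw [SimpleGraph.deleteEdges_adj] at hij
  by_contra hG
  refine hij.2 (pairMI_eq_zero_of_isMarkovMass hp.mem hij.1.ne hp.node
    (fun x => (hp.factorizes_chowLiu T).pos x)
    (hp.factorizes_chowLiu (T.deleteEdges {s(i, j)})) (by simp) (fun x => ?_) hM hG)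
  rw [chowLiu_deleteEdges_singleton p (show s(i, j) ∈ T.edgeSet from hij.1), pairRatio_mk]

end Factorization

end ForestLearning

namespace ForestLearning

/-! ### Mass functions of measures, forest projections and product measures. -/

section Measures

variable {d r : ℕ}

/-- The mass function of a measure on `Fin d → Fin r`. -/
noncomputable def massFn (Q : Measure (Fin d → Fin r)) (x : Fin d → Fin r) : ℝ := Q.real {x}

theorem real_eq_sum_massFn (Q : Measure (Fin d → Fin r)) [IsFiniteMeasure Q]
    (A : Set (Fin d → Fin r)) [DecidablePred (· ∈ A)] :
    Q.real A = ∑ x with x ∈ A, massFn Q x := by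
  unfold massFn
  rw [sum_measureReal_singleton]
  simp

theorem massFn_mem_stdSimplex (Q : Measure (Fin d → Fin r)) [IsProbabilityMeasure Q] :
    massFn Q ∈ stdSimplex ℝ (Fin d → Fin r) := by
  refine ⟨fun x => measureReal_nonneg, ?_⟩
  have := real_eq_sum_massFn Q Set.univ
  simpa using this.symm

theorem marginal_eq_setMarg (Q : Measure (Fin d → Fin r)) [IsFiniteMeasure Q] (S : Set (Fin d))
    (x : Fin d → Fin r) : marginal Q S x = setMarg (massFn Q) S x := by
  classical
  rw [marginal, real_eq_sum_massFn, setMarg]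
  exact Finset.sum_congr (by ext; simp) fun _ _ => rfl

theorem isMarkovOn_iff (Q : Measure (Fin d → Fin r)) [IsFiniteMeasure Q]
    (G : SimpleGraph (Fin d)) : IsMarkovOn Q G ↔ IsMarkovMass (massFn Q) G := by
  simp only [IsMarkovOn, IsMarkovMass, marginal_eq_setMarg]
  rfl

theorem real_pair_eq_pairMarg (Q : Measure (Fin d → Fin r)) [IsFiniteMeasure Q] (i j : Fin d)
    (a b : Fin r) : Q.real {y | y i = a ∧ y j = b} = pairMarg (massFn Q) i j a b := by
  classical
  rw [real_eq_sum_massFn, pairMarg]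
  exact Finset.sum_congr (by ext; simp) fun _ _ => rfl

theorem positiveMarginals_massFn (hd : 2 ≤ d) {Q : Measure (Fin d → Fin r)}
    [IsProbabilityMeasure Q] (hQ : PairwisePositive Q) : PositiveMarginals (massFn Q) := by
  have hpair : ∀ i j, i ≠ j → ∀ a b, 0 < pairMarg (massFn Q) i j a b := by
    intro i j hij a b
    rw [← real_pair_eq_pairMarg]
    exact hQ i j hij a b
  refine ⟨massFn_mem_stdSimplex Q, fun i a => ?_, hpair⟩
  have : Nontrivial (Fin d) := Fin.nontrivial_iff_two_le.2 hd
  obtain ⟨j, hj⟩ := exists_ne i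
  exact (hpair i j hj.symm a a).trans_le
    (pairMarg_le_nodeMarg (massFn_mem_stdSimplex Q).1 i j a a)

theorem exists_isProbabilityMeasure_massFn_eq {q : (Fin d → Fin r) → ℝ}
    (hq : q ∈ stdSimplex ℝ (Fin d → Fin r)) :
    ∃ Q : Measure (Fin d → Fin r), IsProbabilityMeasure Q ∧ massFn Q = q := by
  classical
  let Q : Measure (Fin d → Fin r) := ∑ x, ENNReal.ofReal (q x) • Measure.dirac x
  have hQ : ∀ A, Q A = ∑ x, ENNReal.ofReal (q x) * A.indicator 1 x := by
    intro A
    simp only [Q, Measure.coe_finsetSum, Finset.sum_apply, Measure.smul_apply, smul_eq_mul]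
    exact Finset.sum_congr rfl fun x _ => by rw [Measure.dirac_apply]
  refine ⟨Q, ⟨?_⟩, ?_⟩
  · rw [hQ]
    simp only [Set.indicator_univ, Pi.one_apply, mul_one]
    rw [← ENNReal.ofReal_sum_of_nonneg fun x _ => hq.1 x, hq.2, ENNReal.ofReal_one]
  · funext x
    rw [massFn, measureReal_def, hQ, Finset.sum_eq_single x]
    · simp [hq.1 x]
    · intro y _ hyx
      simp [hyx]
    · simp

theorem klDiv_eq_relEnt {P Q : Measure (Fin d → Fin r)} [IsProbabilityMeasure P]
    [IsProbabilityMeasure Q] (hQ : ∀ x, 0 < massFn Q x) :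
    InformationTheory.klDiv P Q = ENNReal.ofReal (relEnt (massFn P) (massFn Q)) := by
  have hQ0 : ∀ x, Q {x} ≠ 0 := by
    intro x h
    have := hQ x
    simp [massFn, measureReal_def, h] at this
  have hac : P ≪ Q := by
    refine Measure.AbsolutelyContinuous.mk fun s _ hs => ?_
    have : s = ∅ := by
      rw [Set.eq_empty_iff_forall_notMem]
      intro x hx
      exact hQ0 x (measure_mono_null (Set.singleton_subset_iff.2 hx) hs)
    simp [this]
  have hrn : ∀ x, Q {x} * P.rnDeriv Q x = P {x} := by
    intro x
    have h1 := Measure.setLIntegral_rnDeriv hac {x}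
    rw [lintegral_singleton, mul_comm] at h1
    exact h1
  have hllr : ∀ x, llr P Q x = Real.log (massFn P x / massFn Q x) := by
    intro x
    rw [llr]
    congr 1
    have h1 := congrArg ENNReal.toReal (hrn x)
    rw [ENNReal.toReal_mul] at h1
    rw [eq_div_iff (hQ x).ne', mul_comm]
    exact h1
  rw [InformationTheory.klDiv_of_ac_of_integrable hac Integrable.of_finite,
    integral_fintype Integrable.of_finite]
  simp only [probReal_univ, add_sub_cancel_right, hllr, smul_eq_mul]
  rfl

theorem relEnt_eq_sub {α : Type*} [Fintype α] {p q : α → ℝ} (hq : ∀ x, 0 < q x) :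
    relEnt p q = ∑ x, p x * Real.log (p x) - ∑ x, p x * Real.log (q x) := by
  rw [relEnt, ← Finset.sum_sub_distrib]
  refine Finset.sum_congr rfl fun x _ => ?_
  by_cases h : p x = 0
  · simp [h]
  · rw [Real.log_div h (hq x).ne', mul_sub]

/-- Among the distributions that factorize over an acyclic graph, the product of pair ratios is the
unique one closest to `p`. -/
theorem PositiveMarginals.relEnt_chowLiu_le {p q : (Fin d → Fin r) → ℝ}
    (hp : PositiveMarginals p) (hq : q ∈ stdSimplex ℝ (Fin d → Fin r)) {T : SimpleGraph (Fin d)}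
    (hT : T.IsAcyclic) (hqT : Factorizes q T) :
    relEnt p (chowLiu p T) ≤ relEnt p q ∧
      (relEnt p q ≤ relEnt p (chowLiu p T) → q = chowLiu p T) := by
  set c := chowLiu p T with hc
  have hcs : c ∈ stdSimplex ℝ (Fin d → Fin r) := hp.chowLiu_mem_stdSimplex hT
  have hcT : Factorizes c T := hp.factorizes_chowLiu T
  obtain ⟨-, hnode, hpair⟩ := hp.chowLiu_marginals hT
  -- Pythagorean identity: `p` and `c` have the same marginals on `T`, so log q and log c have the
  -- same expectation under both.
  have key : relEnt p q - relEnt p c = relEnt c q := by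
    rw [relEnt_eq_sub hqT.pos, relEnt_eq_sub hcT.pos, relEnt_eq_sub hqT.pos,
      hqT.sum_mul_log_eq (fun i => (hnode i).symm) (fun i j h => (hpair i j h).symm),
      hcT.sum_mul_log_eq (fun i => (hnode i).symm) (fun i j h => (hpair i j h).symm)]
    ring
  have hac : ∀ x, q x = 0 → c x = 0 := fun x hx => absurd hx (hqT.pos x).ne'
  refine ⟨?_, fun h => ?_⟩
  · have := relEnt_nonneg hcs.1 hq.1 hac (by rw [hq.2, hcs.2])
    linarith
  · funext x
    have h1 := sq_sub_le_relEnt hcs hq hac x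
    have h2 : (c x - q x) ^ 2 = 0 := le_antisymm (by linarith) (sq_nonneg _)
    exact (sub_eq_zero.1 (pow_eq_zero_iff two_ne_zero |>.1 h2)).symm

theorem IsForestModel.factorizes (hd : 2 ≤ d) {Q : Measure (Fin d → Fin r)}
    {G : SimpleGraph (Fin d)} (hQ : IsForestModel Q G) : Factorizes (massFn Q) G := by
  have := hQ.isProb
  have h := positiveMarginals_massFn hd hQ.pos
  exact factorizes_of_isMarkovMass hQ.acyclic h.mem.2 h.node h.pair
    ((isMarkovOn_iff Q G).1 hQ.minimal.1)

theorem isForestModel_of_massFn_eq_chowLiu (hd : 2 ≤ d) {P Q : Measure (Fin d → Fin r)}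
    [IsProbabilityMeasure P] [IsProbabilityMeasure Q] (hP : PairwisePositive P)
    {T : SimpleGraph (Fin d)} (hT : T.IsAcyclic) (hQ : massFn Q = chowLiu (massFn P) T) :
    IsForestModel Q (T.deleteEdges {e | pairMI (massFn P) e = 0}) := by
  have hp := positiveMarginals_massFn hd hP
  have hfac := hp.factorizes_chowLiu (T.deleteEdges {e | pairMI (massFn P) e = 0})
  rw [chowLiu_deleteEdges_zero hp, ← hQ] at hfac
  refine ⟨inferInstance, fun i j _ a b => ?_, hT.anti (SimpleGraph.deleteEdges_le _),
    (isMarkovOn_iff _ _).2 hfac.isMarkovMass, fun G' hG' => ?_⟩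
  · rw [real_pair_eq_pairMarg]
    by_cases hij : i = j
    · contradiction
    · refine Finset.sum_pos (fun x _ => hfac.pos x) ?_
      exact ⟨Function.update (fun _ => b) i a, by simp [Ne.symm hij]⟩
  · rw [isMarkovOn_iff, hQ] at hG'
    exact Set.ncard_le_ncard (SimpleGraph.edgeSet_mono (hp.adj_of_isMarkovMass_chowLiu hG'))

theorem PositiveMarginals.relEnt_chowLiu_eq {p : (Fin d → Fin r) → ℝ}
    (hp : PositiveMarginals p) (H : SimpleGraph (Fin d)) :
    relEnt p (chowLiu p H) = ∑ x, p x * Real.log (p x) -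
      ∑ i, ∑ x, p x * Real.log (nodeMarg p i (x i)) - graphWeight (pairMI p) H := by
  rw [relEnt_eq_sub (hp.factorizes_chowLiu H).pos, hp.sum_mul_log_chowLiu]
  ring

/-- If the minimal forest projection has the unique edge set `G`, every maximum-weight spanning
tree for the mutual informations consists of `G` and of edges of weight zero. -/
theorem deleteEdges_zero_eq_of_isMWST (hd : 2 ≤ d) {P Pt : Measure (Fin d → Fin r)}
    [IsProbabilityMeasure P] (hP : PairwisePositive P) {G : SimpleGraph (Fin d)}
    (hPt : IsMinimalForestProjection P Pt G)
    (huniq : ∀ (Q : Measure (Fin d → Fin r)) (G' : SimpleGraph (Fin d)),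
      IsMinimalForestProjection P Q G' → G' = G)
    {T : SimpleGraph (Fin d)} (hT : IsMWST (pairMI (massFn P)) T) :
    T.deleteEdges {e | pairMI (massFn P) e = 0} = G := by
  have hp := positiveMarginals_massFn hd hP
  set p := massFn P with hpdef
  set w := pairMI p with hw
  have hw0 : ∀ e, 0 ≤ w e := pairMI_nonneg hp.mem
  have hTw := (isMWST_iff w T).1 hT
  obtain ⟨Q, hQprob, hQ⟩ := exists_isProbabilityMeasure_massFn_eq
    (hp.chowLiu_mem_stdSimplex hT.1.isAcyclic)
  have hQmodel : IsForestModel Q (T.deleteEdges {e | w e = 0}) :=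
    isForestModel_of_massFn_eq_chowLiu hd hP hT.1.isAcyclic hQ
  have hQpos : ∀ x, 0 < massFn Q x := by
    rw [hQ]; exact (hp.factorizes_chowLiu T).pos
  -- any forest model is at least as far from `P` as some tree model
  have hmodel : ∀ (Q' : Measure (Fin d → Fin r)) (G' : SimpleGraph (Fin d)),
      IsForestModel Q' G' → ∃ T' : SimpleGraph (Fin d), T'.IsTree ∧
        InformationTheory.klDiv P Q' = ENNReal.ofReal (relEnt p (massFn Q')) ∧
        relEnt p (massFn Q) ≤ relEnt p (chowLiu p T') ∧
        relEnt p (chowLiu p T') ≤ relEnt p (massFn Q') ∧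
        (relEnt p (massFn Q') ≤ relEnt p (chowLiu p T') → massFn Q' = chowLiu p T') := by
    intro Q' G' hQ'
    have := hQ'.isProb
    obtain ⟨T', hT'1, hT'2⟩ := exists_isTree_ge (by omega) hQ'.acyclic
    have hfac := (hQ'.factorizes hd).mono hT'1
    obtain ⟨h1, h2⟩ := hp.relEnt_chowLiu_le (massFn_mem_stdSimplex Q') hT'2.isAcyclic hfac
    refine ⟨T', hT'2, klDiv_eq_relEnt hfac.pos, ?_, h1, h2⟩
    rw [hQ, hp.relEnt_chowLiu_eq, hp.relEnt_chowLiu_eq]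
    have := hTw.2 T' hT'2
    linarith
  have hQproj : IsForestProjection P Q (T.deleteEdges {e | w e = 0}) := by
    refine ⟨hQmodel, fun Q' G' hQ' => ?_⟩
    obtain ⟨T', _, h1, h2, h3, _⟩ := hmodel Q' G' hQ'
    rw [h1, klDiv_eq_relEnt hQpos]
    exact ENNReal.ofReal_le_ofReal (h2.trans h3)
  refine huniq Q _ ⟨hQproj, fun Q' G' hQ' => ?_⟩
  refine le_trans ?_ (hPt.2 Q' G' hQ')
  -- compare with the given minimal projection
  obtain ⟨T', hT', h1, h2, h3, h4⟩ := hmodel Pt G hPt.1.1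
  have h5 := hPt.1.2 Q _ hQmodel
  have hnn : 0 ≤ relEnt p (massFn Q) := by
    refine relEnt_nonneg hp.mem.1 (fun x => (hQpos x).le) (fun x hx => absurd hx (hQpos x).ne') ?_
    rw [hp.mem.2, (massFn_mem_stdSimplex Q).2]
  rw [h1, klDiv_eq_relEnt hQpos, ENNReal.ofReal_le_ofReal_iff hnn] at h5
  -- Optimality closes the chain of inequalities: the given projection is the tree approximation on
  -- `T'`, and `T'` has maximal weight.
  have hPteq := h4 (h5.trans h2)
  have hT'w : IsMWST w T' := by
    rw [isMWST_iff]
    refine ⟨hT', fun S hS => ?_⟩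
    have h6 := h3.trans h5
    rw [hQ, hp.relEnt_chowLiu_eq, hp.relEnt_chowLiu_eq] at h6
    have := hTw.2 S hS
    linarith
  -- Maximum-weight trees all have equally many positive edges, and those of `T'` lie in `G`, on
  -- which the given projection is Markov.
  refine (ncard_deleteEdges_zero_le hw0 hT hT'w).trans ?_
  have hM : IsMarkovMass (chowLiu p T') G := by
    have := hPt.1.1.isProb
    rw [← hPteq, ← isMarkovOn_iff]
    exact hPt.1.1.minimal.1
  exact Set.ncard_le_ncard (SimpleGraph.edgeSet_mono (hp.adj_of_isMarkovMass_chowLiu hM))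

theorem pi_real_eq_iidSetProb (P : Measure (Fin d → Fin r)) [IsProbabilityMeasure P] {n : ℕ}
    (A : Set (Fin n → Fin d → Fin r)) :
    (Measure.pi fun _ : Fin n => P).real A = iidSetProb (massFn P) A := by
  classical
  have h1 : ∀ x, (Measure.pi fun _ : Fin n => P).real {x} = iidProb (massFn P) x := by
    intro x
    rw [measureReal_def, Measure.pi_singleton, ENNReal.toReal_prod]
    rfl
  unfold iidSetProb
  simp only [← h1]
  rw [sum_measureReal_singleton]
  simp

end Measures

end ForestLearning

namespace ForestLearning

/-! ### Deterministic analysis of the output, and probabilities of the bad samples. -/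

section Algorithm

variable {d r n : ℕ}

/-- The decreasing order spreads the two conditions at the cut to all kept and all discarded edges.
The ordering and `k` are not needed afterwards. -/
theorem IsCLThresOutput.exists_isMWST {x : Fin n → Fin d → Fin r} {ε : ℝ}
    {E : Set (Sym2 (Fin d))} (h : IsCLThresOutput x ε E) :
    ∃ T : SimpleGraph (Fin d), IsMWST (pairMI (empirical x)) T ∧ E ⊆ T.edgeSet ∧
      (∀ f ∈ E, ε ≤ pairMI (empirical x) f) ∧
      ∀ f ∈ T.edgeSet, f ∉ E → pairMI (empirical x) f ≤ ε := by
  obtain ⟨T, e, k, hT, -, hrange, hanti, hk, hge, hle, rfl⟩ := h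
  rw [← empMI_eq_pairMI]
  refine ⟨T, hT, ?_, ?_, ?_⟩
  · rw [← hrange]
    exact Set.image_subset_range _ _
  · rintro _ ⟨i, hi, rfl⟩
    have hi : i.val < k := hi
    have hi' := i.2
    exact (hge ⟨k - 1, by omega⟩ (by simp only; omega)).trans (hanti _ _ (by
      rw [Fin.le_def]; simp only; omega))
  · intro f hf hfE
    rw [← hrange] at hf
    obtain ⟨i, rfl⟩ := hf
    have hi : k ≤ i.val := by
      by_contra hcon
      exact hfE ⟨i, not_le.1 hcon, rfl⟩
    exact (hanti ⟨k, hi.trans_lt i.2⟩ i hi).trans (hle _ rfl)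

theorem exists_pos_forall_le {ι : Type*} [Finite ι] (f : ι → ℝ) :
    ∃ δ > 0, ∀ i, 0 < f i → δ ≤ f i := by
  rcases isEmpty_or_nonempty ι with h | h
  · exact ⟨1, one_pos, fun i => h.elim i⟩
  obtain ⟨i₀, hi₀⟩ := Finite.exists_min fun i => if 0 < f i then f i else 1
  refine ⟨if 0 < f i₀ then f i₀ else 1, by split_ifs <;> simp_all, fun i hi => ?_⟩
  have := hi₀ i
  rwa [if_pos hi] at this

theorem abs_graphWeight_sub_le {w v : Sym2 (Fin d) → ℝ} {δ : ℝ} (h : ∀ e, |v e - w e| ≤ δ)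
    (T : SimpleGraph (Fin d)) :
    |graphWeight v T - graphWeight w T| ≤ Fintype.card (Sym2 (Fin d)) * δ := by
  classical
  exact abs_sum_filter_sub_le v w _ h

/-- A strict inequality between weights of graphs is stable under perturbation of the weights. -/
theorem graphWeight_lt_of_abs_sub_lt {w v : Sym2 (Fin d) → ℝ} {δ : ℝ} {S T : SimpleGraph (Fin d)}
    (h : ∀ e, |v e - w e| < δ)
    (hδ : δ ≤ (graphWeight w T - graphWeight w S) / (2 * Fintype.card (Sym2 (Fin d)) + 1))
    (hST : graphWeight w S < graphWeight w T) : graphWeight v S < graphWeight v T := by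
  have h1 := abs_graphWeight_sub_le (fun e => (h e).le) S
  have h2 := abs_graphWeight_sub_le (fun e => (h e).le) T
  set M := (Fintype.card (Sym2 (Fin d)) : ℝ)
  have hM : 0 ≤ M := Nat.cast_nonneg _
  rw [le_div_iff₀ (by positivity)] at hδ
  rw [abs_le] at h1 h2
  rcases le_or_gt δ 0 with h0 | h0
  · nlinarith
  · nlinarith

theorem eq_of_le_of_isTree {S T : SimpleGraph (Fin d)} (hS : S.IsTree) (hT : T.IsTree)
    (h : S.edgeSet ⊆ T.edgeSet) : S = T := by
  refine SimpleGraph.edgeSet_injective (Set.eq_of_subset_of_ncard_le h ?_)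
  have := ncard_edgeSet_add_one hS
  have := ncard_edgeSet_add_one hT
  omega

/-- If the empirical weights are close to the true ones and the threshold separates the edges of
weight zero from the other ones, the algorithm returns `G`. -/
theorem exists_forall_output_eq {w : Sym2 (Fin d) → ℝ} (hw : ∀ e, 0 ≤ w e)
    {G : SimpleGraph (Fin d)}
    (hG : ∀ T : SimpleGraph (Fin d), IsMWST w T → T.deleteEdges {e | w e = 0} = G) :
    ∃ δ > 0, ∀ {n : ℕ} (x : Fin n → Fin d → Fin r) (ε : ℝ) (E : Set (Sym2 (Fin d))),
      ε < δ → (∀ e, |pairMI (empirical x) e - w e| < δ) →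
      (∀ T : SimpleGraph (Fin d), IsMWST w T → ∀ e ∈ T.edgeSet, w e = 0 →
        pairMI (empirical x) e < ε) →
      IsCLThresOutput x ε E → E = G.edgeSet := by
  -- `δ₁` is below every positive gap between weights of graphs, suitably scaled, so an empirically
  -- heaviest tree is truly heaviest. `δ₂` is at most half of each positive weight, so edges of
  -- positive weight stay above the threshold.
  obtain ⟨δ₁, hδ₁, h1⟩ := exists_pos_forall_le
    fun c : SimpleGraph (Fin d) × SimpleGraph (Fin d) =>
      (graphWeight w c.1 - graphWeight w c.2) / (2 * Fintype.card (Sym2 (Fin d)) + 1)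
  obtain ⟨δ₂, hδ₂, h2⟩ := exists_pos_forall_le fun e => w e / 2
  refine ⟨min δ₁ δ₂, lt_min hδ₁ hδ₂, fun x ε E hε hclose hzero hout => ?_⟩
  obtain ⟨T, hT, hET, hge, hle⟩ := hout.exists_isMWST
  set v := pairMI (empirical x)
  have hTw : IsMWST w T := by
    rw [isMWST_iff] at hT ⊢
    refine ⟨hT.1, fun S hS => ?_⟩
    by_contra! hcon
    have hpos : 0 < (graphWeight w S - graphWeight w T) /
        (2 * Fintype.card (Sym2 (Fin d)) + 1 : ℝ) := by
      have := sub_pos.2 hcon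
      positivity
    have := graphWeight_lt_of_abs_sub_lt hclose ((min_le_left _ _).trans (h1 (S, T) hpos)) hcon
    exact absurd (hT.2 S hS) (not_le.2 this)
  have hTG : T.edgeSet \ {e | w e = 0} = G.edgeSet := by
    rw [← hG T hTw, SimpleGraph.edgeSet_deleteEdges]
  rw [← hTG]
  ext f
  constructor
  · intro hf
    exact ⟨hET hf, fun h0 => absurd (hge f hf) (not_le.2 (hzero T hTw f (hET hf) h0))⟩
  · rintro ⟨hfT, hf0⟩
    by_contra hfE
    have h3 := hle f hfT hfE
    have hpos : 0 < w f := (hw f).lt_of_ne' hf0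
    have h4 := h2 f (half_pos hpos)
    have h5 := abs_lt.1 (hclose f)
    have h6 := min_le_right δ₁ δ₂
    linarith [h5.1]

/-- If `G` were returned, the cut property would give a discarded edge of the empirical tree at
least as heavy as ab, hence above the threshold. -/
theorem IsCLThresOutput.ne_of_lt {x : Fin n → Fin d → Fin r} {ε : ℝ} {E : Set (Sym2 (Fin d))}
    (h : IsCLThresOutput x ε E) {G : SimpleGraph (Fin d)} {a b : Fin d}
    (hab : ¬ G.Reachable a b) (hlt : ε < pairMI (empirical x) s(a, b)) : E ≠ G.edgeSet := by
  rintro rfl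
  obtain ⟨T, hT, hET, -, hle⟩ := h.exists_isMWST
  obtain ⟨f, hf, hfG, hw⟩ := exists_le_weight_of_not_reachable hT
    (SimpleGraph.edgeSet_subset_edgeSet.1 hET) hab
  exact absurd (hw.trans (hle f hf hfG)) (not_le.2 hlt)

theorem IsCLThresOutput.of_ne_tree {x : Fin n → Fin d → Fin r} {ε : ℝ} {E : Set (Sym2 (Fin d))}
    (h : IsCLThresOutput x ε E) {G : SimpleGraph (Fin d)} (hG : G.IsTree) (hE : E ≠ G.edgeSet) :
    (∃ T : SimpleGraph (Fin d), T.IsTree ∧ T ≠ G ∧ graphWeight (pairMI (empirical x)) G ≤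
      graphWeight (pairMI (empirical x)) T) ∨ ∃ e ∈ G.edgeSet, pairMI (empirical x) e ≤ ε := by
  obtain ⟨T, hT, hET, -, hle⟩ := h.exists_isMWST
  rw [isMWST_iff] at hT
  by_cases hTG : T = G
  · subst hTG
    right
    by_contra! hcon
    refine hE (hET.antisymm fun f hf => ?_)
    by_contra hfE
    exact absurd (hle f hf hfE) (not_le.2 (hcon f hf))
  · exact Or.inl ⟨T, hT.1, hTG, hT.2 G hG⟩

theorem IsCLThresOutput.of_eq_tree {x : Fin n → Fin d → Fin r} {ε : ℝ}
    {G : SimpleGraph (Fin d)} (h : IsCLThresOutput x ε G.edgeSet) (hG : G.IsTree) :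
    (∀ T : SimpleGraph (Fin d), T.IsTree → graphWeight (pairMI (empirical x)) T ≤
      graphWeight (pairMI (empirical x)) G) ∧ ∀ e ∈ G.edgeSet, ε ≤ pairMI (empirical x) e := by
  obtain ⟨T, hT, hET, hge, -⟩ := h.exists_isMWST
  rw [isMWST_iff] at hT
  obtain rfl := eq_of_le_of_isTree hG hT.1 hET
  exact ⟨hT.2, hge⟩

/-- Uniform continuity at a point of the mutual informations. -/
theorem exists_forall_abs_pairMI_sub_lt {q : (Fin d → Fin r) → ℝ}
    (hq : q ∈ stdSimplex ℝ (Fin d → Fin r)) {δ : ℝ} (hδ : 0 < δ) :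
    ∃ ρ > 0, ∀ q' ∈ stdSimplex ℝ (Fin d → Fin r), (∀ x, |q' x - q x| < ρ) →
      ∀ e, |pairMI q' e - pairMI q e| < δ := by
  have h : ∀ᶠ q' in 𝓝[stdSimplex ℝ (Fin d → Fin r)] q, ∀ e, |pairMI q' e - pairMI q e| < δ := by
    rw [eventually_all]
    intro e
    exact (Metric.tendsto_nhds.1 (continuousOn_pairMI e q hq)) δ hδ
  rw [eventually_nhdsWithin_iff, Metric.eventually_nhds_iff] at h
  obtain ⟨ρ, hρ, h⟩ := h
  refine ⟨ρ, hρ, fun q' hq' hx => h ?_ hq'⟩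
  rw [dist_pi_lt_iff hρ]
  exact hx

theorem exists_iidSetProb_le_of_pairMI {q : (Fin d → Fin r) → ℝ}
    (hq : q ∈ stdSimplex ℝ (Fin d → Fin r)) {δ : ℝ} (hδ : 0 < δ) :
    ∃ c > 0, ∀ n : ℕ, n ≠ 0 → ∀ A : Set (Fin n → Fin d → Fin r),
      (∀ x ∈ A, ∃ e, δ ≤ |pairMI (empirical x) e - pairMI q e|) →
      iidSetProb q A ≤
        ((n : ℝ) + 1) ^ Fintype.card (Fin d → Fin r) * Real.exp (-(n * c)) := by
  obtain ⟨ρ, hρ, h⟩ := exists_forall_abs_pairMI_sub_lt hq hδ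
  refine ⟨ρ ^ 2 / 4, by positivity, fun n hn A hA => ?_⟩
  refine iidSetProb_le_of_le_abs_sub hn hq hρ.le fun x hx => ?_
  by_contra! hcon
  obtain ⟨e, he⟩ := hA x hx
  exact absurd (h _ (empirical_mem_stdSimplex hn x) hcon e) (not_lt.2 he)

/-- Relative entropy dominates mutual information with constant 1; this is the source of the −1 in
the theorem. -/
theorem iidSetProb_le_of_le_pairMI {q : (Fin d → Fin r) → ℝ}
    (hq : q ∈ stdSimplex ℝ (Fin d → Fin r)) (hn : n ≠ 0) {ε : ℝ}
    {A : Set (Fin n → Fin d → Fin r)}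
    (hA : ∀ x ∈ A, ∃ e, pairMI q e = 0 ∧ ε ≤ pairMI (empirical x) e) :
    iidSetProb q A ≤
      ((n : ℝ) + 1) ^ Fintype.card (Fin d → Fin r) * Real.exp (-(n * ε)) := by
  refine iidSetProb_le_of_le_relEnt hn hq.1 fun x hx hx0 => ?_
  obtain ⟨e, he0, he⟩ := hA x hx
  exact he.trans (pairMI_le_relEnt hq (empirical_mem_stdSimplex hn x)
    (empirical_eq_zero_of_iidProb_ne_zero hx0) he0)

end Algorithm

end ForestLearning

namespace ForestLearning

/-! ### Error exponents. -/

section Asymptotics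

variable {d r : ℕ}

theorem eventually_mul_log_succ_le {a : ℕ → ℝ}
    (ha : Tendsto (fun n : ℕ => a n / Real.log n) atTop atTop) (M : ℝ) {κ : ℝ} (hκ : 0 < κ) :
    ∀ᶠ n : ℕ in atTop, M * Real.log (n + 1) ≤ κ * a n := by
  filter_upwards [ha.eventually_ge_atTop (2 * |M| / κ), eventually_ge_atTop 2] with n hn h2
  have h2' : (2 : ℝ) ≤ n := by exact_mod_cast h2
  have hlog : 0 < Real.log n := Real.log_pos (by linarith)
  have h3 : Real.log (n + 1) ≤ 2 * Real.log n := by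
    have : Real.log ((n : ℝ) + 1) ≤ Real.log ((n : ℝ) ^ 2) :=
      Real.log_le_log (by positivity) (by nlinarith)
    rwa [Real.log_pow, Nat.cast_ofNat] at this
  rw [div_le_div_iff₀ hκ hlog] at hn
  have h4 : 0 ≤ Real.log ((n : ℝ) + 1) := Real.log_nonneg (by linarith)
  calc M * Real.log (n + 1) ≤ |M| * Real.log (n + 1) :=
        mul_le_mul_of_nonneg_right (le_abs_self M) h4
    _ ≤ |M| * (2 * Real.log n) := mul_le_mul_of_nonneg_left h3 (abs_nonneg M)
    _ ≤ κ * a n := by linarith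

theorem tendsto_natCast_mul_div_log {c : ℝ} (hc : 0 < c) :
    Tendsto (fun n : ℕ => n * c / Real.log n) atTop atTop := by
  have h1 : Tendsto (fun x : ℝ => Real.log x / x) atTop (𝓝 0) :=
    Real.isLittleO_log_id_atTop.tendsto_div_nhds_zero
  have h2 : Tendsto (fun x : ℝ => x / Real.log x) atTop atTop := by
    have h3 : Tendsto (fun x : ℝ => Real.log x / x) atTop (𝓝[>] 0) := by
      refine tendsto_nhdsWithin_iff.2 ⟨h1, ?_⟩
      filter_upwards [eventually_gt_atTop 1] with x hx
      exact div_pos (Real.log_pos hx) (by linarith)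
    refine h3.inv_tendsto_nhdsGT_zero.congr fun x => ?_
    simp
  refine ((h2.comp tendsto_natCast_atTop_atTop).atTop_mul_const hc).congr fun n => ?_
  simp only [Function.comp_apply]
  ring

/-- Polynomial factors do not matter. -/
theorem eventually_pow_mul_exp_le {a : ℕ → ℝ}
    (ha : Tendsto (fun n : ℕ => a n / Real.log n) atTop atTop) (K : ℝ) (N : ℕ) {κ : ℝ}
    (hκ : 0 < κ) :
    ∀ᶠ n : ℕ in atTop, K * (((n : ℝ) + 1) ^ N * Real.exp (-a n)) ≤ Real.exp (-((1 - κ) * a n)) := by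
  filter_upwards [eventually_mul_log_succ_le ha (N + 1) hκ,
    tendsto_natCast_atTop_atTop.eventually_ge_atTop K] with n hn hK
  have h1 : (0 : ℝ) < (n : ℝ) + 1 := by positivity
  calc K * (((n : ℝ) + 1) ^ N * Real.exp (-a n)) ≤
        ((n : ℝ) + 1) * (((n : ℝ) + 1) ^ N * Real.exp (-a n)) := by
        gcongr
        linarith
    _ = Real.exp ((N + 1) * Real.log (n + 1) + -a n) := by
        rw [Real.exp_add, ← mul_assoc, ← pow_succ', ← Nat.cast_succ N, mul_comm (Nat.cast _ : ℝ),
          Real.exp_mul, Real.exp_log h1, Real.rpow_natCast]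
    _ ≤ _ := Real.exp_le_exp.2 (by linarith)

theorem eventually_pow_mul_exp_le_const {a : ℕ → ℝ}
    (ha : Tendsto (fun n : ℕ => a n / Real.log n) atTop atTop) (N : ℕ) {δ : ℝ} (hδ : 0 < δ) :
    ∀ᶠ n : ℕ in atTop, ((n : ℝ) + 1) ^ N * Real.exp (-a n) ≤ δ := by
  filter_upwards [eventually_pow_mul_exp_le ha 1 N (κ := 1 / 2) (by norm_num),
    eventually_mul_log_succ_le ha 1 (κ := 1 / 2) (by norm_num),
    tendsto_natCast_atTop_atTop.eventually_ge_atTop (1 / δ)] with n h1 h2 h3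
  have h4 : (0 : ℝ) < (n : ℝ) + 1 := by positivity
  rw [one_mul] at h1
  refine h1.trans ((Real.exp_le_exp.2 (show -((1 - 1 / 2) * a n) ≤ -Real.log (n + 1) by
    linarith)).trans ?_)
  rw [Real.exp_neg, Real.exp_log h4, inv_le_comm₀ h4 hδ, ← one_div]
  linarith

theorem IsRegularization.eventually_pos {ε : ℕ → ℝ} (hε : IsRegularization ε) :
    ∀ᶠ n : ℕ in atTop, 0 < ε n := by
  filter_upwards [hε.2.eventually_gt_atTop 0, eventually_ge_atTop 2] with n hn h2
  have h2' : (2 : ℝ) ≤ n := by exact_mod_cast h2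
  have hlog : 0 < Real.log n := Real.log_pos (by linarith)
  have h3 := (div_pos_iff_of_pos_right hlog).1 hn
  exact pos_of_mul_pos_right h3 (by linarith)

theorem IsRegularization.tendsto_const_mul {ε : ℕ → ℝ} (hε : IsRegularization ε) {κ : ℝ}
    (hκ : 0 < κ) : Tendsto (fun n : ℕ => (n * (κ * ε n)) / Real.log n) atTop atTop :=
  (hε.2.const_mul_atTop hκ).congr fun n => by ring

theorem logErr_eq (P : Measure (Fin d → Fin r)) [IsProbabilityMeasure P]
    (G : SimpleGraph (Fin d)) (Ehat : (n : ℕ) → (Fin n → Fin d → Fin r) → Set (Sym2 (Fin d)))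
    (n : ℕ) : logErr P G Ehat n =
      ENNReal.log (ENNReal.ofReal (iidSetProb (massFn P) {x | Ehat n x ≠ G.edgeSet})) := by
  rw [logErr, ← pi_real_eq_iidSetProb, ofReal_measureReal]

theorem log_ofReal_le_of_le_exp {π b : ℝ} (h : π ≤ Real.exp b) :
    ENNReal.log (ENNReal.ofReal π) ≤ (b : EReal) := by
  refine (ENNReal.log_monotone (ENNReal.ofReal_le_ofReal h)).trans ?_
  rw [ENNReal.log_ofReal_of_pos (Real.exp_pos b), Real.log_exp]

theorem mul_log_le {c b B : ℝ} {y : EReal} (hc : 0 ≤ c) (hy : y ≤ (b : EReal)) (hB : c * b ≤ B) :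
    (c : EReal) * y ≤ (B : EReal) := by
  refine (mul_le_mul_of_nonneg_left hy (EReal.coe_nonneg.2 hc)).trans ?_
  rw [← EReal.coe_mul]
  exact EReal.coe_le_coe_iff.2 hB

theorem le_mul_log {c b B : ℝ} {y : EReal} (hc : 0 ≤ c) (hy : (b : EReal) ≤ y) (hB : B ≤ c * b) :
    (B : EReal) ≤ (c : EReal) * y := by
  refine le_trans ?_ (mul_le_mul_of_nonneg_left hy (EReal.coe_nonneg.2 hc))
  rw [← EReal.coe_mul]
  exact EReal.coe_le_coe_iff.2 hB

/-- Change of measure for a set that is likely under the alternative. -/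
theorem le_log_iidSetProb {α : Type*} [Fintype α] {n : ℕ} {p q : α → ℝ}
    (hp : p ∈ stdSimplex ℝ α) (hq : q ∈ stdSimplex ℝ α) (hac : ∀ a, p a = 0 → q a = 0)
    {A : Set (Fin n → α)} {θ : ℝ} (hθ : 0 < θ) (hA : θ ≤ iidSetProb q A) :
    ((-((n * relEnt q p + Real.log 2) / θ) : ℝ) : EReal) ≤
      ENNReal.log (ENNReal.ofReal (iidSetProb p A)) := by
  classical
  have hπ : 0 < iidSetProb p A := by
    refine (iidSetProb_nonneg hp.1 A).lt_of_ne' fun h0 => ?_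
    have h1 := (Finset.sum_eq_zero_iff_of_nonneg fun x _ => iidProb_nonneg hp.1 x).1 h0
    have h2 : iidSetProb q A = 0 := by
      refine Finset.sum_eq_zero fun x hx => ?_
      obtain ⟨l, hl, h3⟩ := Finset.prod_eq_zero_iff.1 (h1 x hx)
      exact Finset.prod_eq_zero hl (hac _ h3)
    linarith
  rw [ENNReal.log_ofReal_of_pos hπ, EReal.coe_le_coe_iff]
  have h1 := neg_relEnt_le_iidSetProb_mul_log hp hq hac A
  set D := n * relEnt q p + Real.log 2
  have hD : 0 ≤ D := by
    have := relEnt_nonneg hq.1 hp.1 hac (by rw [hq.2, hp.2])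
    have := Real.log_nonneg one_le_two
    positivity
  set s := iidSetProb q A
  have hs : 0 < s := hθ.trans_le hA
  have h2 : -(D / s) ≤ Real.log (iidSetProb p A) := by
    rw [neg_le, le_div_iff₀ hs]
    linarith
  refine le_trans (neg_le_neg ?_) h2
  gcongr

/-- Upper bound for the error probability. -/
theorem exists_iidSetProb_error_le {P : Measure (Fin d → Fin r)} {G : SimpleGraph (Fin d)}
    {w : Sym2 (Fin d) → ℝ} (hp : massFn P ∈ stdSimplex ℝ _)
    (hw : w = pairMI (massFn P))
    (hG : ∀ T : SimpleGraph (Fin d), IsMWST w T → T.deleteEdges {e | w e = 0} = G) :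
    ∃ δ > 0, ∃ c > 0, ∀ (ε : ℕ → ℝ)
      (Ehat : (n : ℕ) → (Fin n → Fin d → Fin r) → Set (Sym2 (Fin d))), IsCLThres ε Ehat →
      ∀ n : ℕ, n ≠ 0 → ε n < δ →
        iidSetProb (massFn P) {x : Fin n → Fin d → Fin r | Ehat n x ≠ G.edgeSet} ≤
          ((n : ℝ) + 1) ^ Fintype.card (Fin d → Fin r) * Real.exp (-(n * c)) +
          iidSetProb (massFn P) {x : Fin n → Fin d → Fin r | ∃ T : SimpleGraph (Fin d),
            IsMWST w T ∧ ∃ e ∈ T.edgeSet, w e = 0 ∧ ε n ≤ pairMI (empirical x) e} := by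
  subst hw
  obtain ⟨δ, hδ, hout⟩ := exists_forall_output_eq (r := r) (pairMI_nonneg hp) hG
  obtain ⟨c, hc, hconc⟩ := exists_iidSetProb_le_of_pairMI hp hδ
  refine ⟨δ, hδ, c, hc, fun ε Ehat hE n hn hεδ => ?_⟩
  refine le_trans (iidSetProb_mono hp.1 (B := {x : Fin n → Fin d → Fin r | ∃ e,
    δ ≤ |pairMI (empirical x) e - pairMI (massFn P) e|} ∪ _) fun x hx => ?_)
    ((iidSetProb_union_le hp.1 _ _).trans (add_le_add_left (hconc n hn _ fun x hx => hx) _))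
  by_contra hcon
  rw [Set.mem_union, not_or] at hcon
  obtain ⟨h1, h2⟩ := hcon
  simp only [Set.mem_ofPred_eq, not_exists, not_le, not_and] at h1 h2
  exact hx (hout x (ε n) _ hεδ h1 (fun T hT e he h0 => h2 T hT e he h0) (hE n x))

variable {P : Measure (Fin d → Fin r)} [IsProbabilityMeasure P] {G : SimpleGraph (Fin d)}

/-- Lower bound for the error probability when the limiting graph is disconnected. -/
theorem exists_forall_le_logErr (hr : 2 ≤ r) (hp : PositiveMarginals (massFn P)) {a b : Fin d}
    (hab : ¬ G.Reachable a b) (h0 : pairMI (massFn P) s(a, b) = 0) :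
    ∃ C : ℝ, 1 < C ∧ ∀ ε : ℕ → ℝ, IsRegularization ε →
      ∀ Ehat : (n : ℕ) → (Fin n → Fin d → Fin r) → Set (Sym2 (Fin d)), IsCLThres ε Ehat →
      ∀ᶠ n : ℕ in atTop, ((-C : ℝ) : EReal) ≤
        ((1 / (n * ε n) : ℝ) : EReal) * logErr P G Ehat n := by
  classical
  set p := massFn P
  have hne : a ≠ b := fun h => hab (h ▸ SimpleGraph.Reachable.refl a)
  obtain ⟨C, t₀, hC, ht₀, hpert⟩ := exists_dependent_perturbation hr hp.mem (hp.pair a b hne)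
    ((pairMI_eq_zero_iff hp.mem a b).1 h0)
  set N := Fintype.card (Fin d → Fin r)
  set B : ℝ := 3 * N + 3
  have hB : 0 < B := by positivity
  -- The change of measure costs at most C·B²·nε_n + log 2, with log 2 ≤ nε_n eventually, and is
  -- divided by the success probability 1/2.
  refine ⟨2 * (C * B ^ 2) + 2, by nlinarith [mul_pos hC (pow_pos hB 2)], fun ε hε Ehat hE => ?_⟩
  have hsqrt : Tendsto (fun n => B * √(ε n)) atTop (𝓝 0) := by
    have := (hε.1.sqrt).const_mul B
    simpa using this
  filter_upwards [hε.eventually_pos, eventually_ne_atTop 0, hsqrt.eventually_le_const ht₀,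
    eventually_pow_mul_exp_le_const (hε.tendsto_const_mul (κ := 1 / 4) (by norm_num)) N
      (δ := 1 / 2) (by norm_num),
    eventually_mul_log_succ_le hε.2 1 one_pos,
    eventually_ge_atTop 1] with n hpos hn ht hexp hlog h1n
  have hnpos : (0 : ℝ) < n := by positivity
  obtain ⟨q, hq, hac, hD, u, v, huv⟩ := hpert (B * √(ε n)) (by positivity) ht
  -- With dependence B√ε_n, an empirical mutual information at most ε_n forces a deviation of √ε_n
  -- from `q`, of probability at most poly(n)·exp(−nε_n/4).
  have hA : 1 / 2 ≤ iidSetProb q {x : Fin n → Fin d → Fin r | Ehat n x ≠ G.edgeSet} := by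
    have h1 := iidSetProb_compl hq.2 {x : Fin n → Fin d → Fin r | Ehat n x ≠ G.edgeSet}
    have h2 : iidSetProb q {x : Fin n → Fin d → Fin r | Ehat n x ≠ G.edgeSet}ᶜ ≤
        ((n : ℝ) + 1) ^ N * Real.exp (-(n * (√(ε n) ^ 2 / 4))) := by
      refine iidSetProb_le_of_le_abs_sub hn hq (Real.sqrt_nonneg _) fun x hx => ?_
      refine exists_sqrt_le_abs_sub hq (empirical_mem_stdSimplex hn x) hpos huv ?_
      by_contra! hcon
      exact hx ((hE n x).ne_of_lt hab hcon)
    rw [Real.sq_sqrt hpos.le, show ε n / 4 = 1 / 4 * ε n by ring] at h2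
    linarith
  rw [logErr_eq]
  refine le_mul_log (by positivity) (le_log_iidSetProb hp.mem hq hac (by norm_num) hA) ?_
  rw [mul_pow, Real.sq_sqrt hpos.le] at hD
  have hlog2 : Real.log 2 ≤ n * ε n := by
    have h1 : Real.log 2 ≤ Real.log (n + 1) :=
      Real.log_le_log (by norm_num) (by have : (1 : ℝ) ≤ n := by exact_mod_cast h1n
                                        linarith)
    linarith
  have hnε : 0 < n * ε n := by positivity
  rw [one_div, inv_mul_eq_div, le_div_iff₀ hnε]
  have h3 : n * relEnt q p ≤ n * (C * (B ^ 2 * ε n)) := mul_le_mul_of_nonneg_left hD hnpos.le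
  nlinarith

/-- Since ε_n falls below the fixed rate `c`, both parts of the error bound are eventually at most
poly(n)·exp(−nε_n). The slack κ = 1 + z leaves the exponent z·nε_n. -/
theorem limsup_logErr_le_neg_one (hp : massFn P ∈ stdSimplex ℝ _)
    (hG : ∀ T : SimpleGraph (Fin d), IsMWST (pairMI (massFn P)) T →
      T.deleteEdges {e | pairMI (massFn P) e = 0} = G) {ε : ℕ → ℝ} (hε : IsRegularization ε)
    {Ehat : (n : ℕ) → (Fin n → Fin d → Fin r) → Set (Sym2 (Fin d))} (hE : IsCLThres ε Ehat) :
    limsup (fun n : ℕ => ((1 / (n * ε n) : ℝ) : EReal) * logErr P G Ehat n) atTop ≤ -1 := by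
  obtain ⟨δ, hδ, c, hc, hbound⟩ := exists_iidSetProb_error_le hp rfl hG
  refine EReal.le_of_forall_lt_iff_le.1 fun z hz => ?_
  have hz' : -1 < z := by
    rw [← EReal.coe_lt_coe_iff]
    simpa using hz
  refine limsup_le_of_le (h := ?_)
  filter_upwards [hε.eventually_pos, eventually_ne_atTop 0, hε.1.eventually_lt_const hδ,
    hε.1.eventually_lt_const hc,
    eventually_pow_mul_exp_le hε.2 2 (Fintype.card (Fin d → Fin r)) (κ := 1 + z)
      (by linarith)] with n hpos hn hεδ hεc hexp
  have hnpos : (0 : ℝ) < n := by positivity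
  rw [logErr_eq]
  refine mul_log_le (by positivity) (log_ofReal_le_of_le_exp (le_trans ?_ hexp)) ?_
  · refine (hbound ε Ehat hE n hn hεδ).trans ?_
    have h1 := iidSetProb_le_of_le_pairMI hp hn (ε := ε n) (A := {x : Fin n → Fin d → Fin r |
      ∃ T : SimpleGraph (Fin d), IsMWST (pairMI (massFn P)) T ∧ ∃ e ∈ T.edgeSet,
        pairMI (massFn P) e = 0 ∧ ε n ≤ pairMI (empirical x) e})
      (fun x ⟨T, _, e, _, h0, h⟩ => ⟨e, h0, h⟩)
    have h2 : Real.exp (-(n * c)) ≤ Real.exp (-(n * ε n)) := by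
      rw [Real.exp_le_exp]
      nlinarith
    have h3 : (0 : ℝ) ≤ ((n : ℝ) + 1) ^ Fintype.card (Fin d → Fin r) := by positivity
    nlinarith [mul_le_mul_of_nonneg_left h2 h3]
  · have : (0 : ℝ) < n * ε n := by positivity
    rw [one_div, inv_mul_eq_div, div_le_iff₀ this]
    linarith

theorem eq_of_isMWST_of_isTree {w : Sym2 (Fin d) → ℝ} (hGt : G.IsTree)
    (hG : ∀ T : SimpleGraph (Fin d), IsMWST w T → T.deleteEdges {e | w e = 0} = G)
    {T : SimpleGraph (Fin d)} (hT : IsMWST w T) : T = G := by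
  refine (eq_of_le_of_isTree hGt hT.1 ?_).symm
  rw [SimpleGraph.edgeSet_subset_edgeSet, ← hG T hT]
  exact SimpleGraph.deleteEdges_le _

theorem ne_zero_of_mem_edgeSet {w : Sym2 (Fin d) → ℝ} {T : SimpleGraph (Fin d)}
    (hT : T.deleteEdges {e | w e = 0} = G) {e : Sym2 (Fin d)} (he : e ∈ G.edgeSet) :
    w e ≠ 0 := by
  rw [← hT, SimpleGraph.edgeSet_deleteEdges] at he
  exact he.2

/-- An exponential bound for the error probability turns into a bound for its rate. -/
theorem eventually_logErr_le_of_le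
    {Ehat : (n : ℕ) → (Fin n → Fin d → Fin r) → Set (Sym2 (Fin d))} {c c' : ℝ} (hc : 0 < c)
    (hcc : c' < c) {N : ℕ}
    (h : ∀ᶠ n : ℕ in atTop, iidSetProb (massFn P) {x | Ehat n x ≠ G.edgeSet} ≤
      ((n : ℝ) + 1) ^ N * Real.exp (-(n * c))) :
    ∀ᶠ n : ℕ in atTop, ((1 / n : ℝ) : EReal) * logErr P G Ehat n ≤ ((-c' : ℝ) : EReal) := by
  filter_upwards [h, eventually_ne_atTop 0, eventually_pow_mul_exp_le
    (tendsto_natCast_mul_div_log hc) 1 N (κ := 1 - c' / c)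
      (by rw [sub_pos, div_lt_one hc]; exact hcc)] with n hn h0 hexp
  have hnpos : (0 : ℝ) < n := by positivity
  rw [one_mul] at hexp
  rw [logErr_eq]
  refine mul_log_le (by positivity) (log_ofReal_le_of_le_exp (hn.trans hexp)) (le_of_eq ?_)
  field_simp
  ring

theorem limsup_logErr_neg (hp : massFn P ∈ stdSimplex ℝ _) (hGt : G.IsTree)
    (hG : ∀ T : SimpleGraph (Fin d), IsMWST (pairMI (massFn P)) T →
      T.deleteEdges {e | pairMI (massFn P) e = 0} = G) {ε : ℕ → ℝ} (hε : IsRegularization ε)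
    {Ehat : (n : ℕ) → (Fin n → Fin d → Fin r) → Set (Sym2 (Fin d))} (hE : IsCLThres ε Ehat) :
    limsup (fun n : ℕ => ((1 / n : ℝ) : EReal) * logErr P G Ehat n) atTop < 0 := by
  obtain ⟨δ, hδ, c, hc, hbound⟩ := exists_iidSetProb_error_le hp rfl hG
  have h1 : limsup (fun n : ℕ => ((1 / n : ℝ) : EReal) * logErr P G Ehat n) atTop ≤
      ((-(c / 2) : ℝ) : EReal) := by
    refine limsup_le_of_le (h := eventually_logErr_le_of_le
      (N := Fintype.card (Fin d → Fin r)) hc (half_lt_self hc) ?_)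
    filter_upwards [eventually_ne_atTop 0, hε.1.eventually_lt_const hδ] with n hn hεδ
    refine (hbound ε Ehat hE n hn hεδ).trans (le_of_eq ?_)
    have hempty : {x : Fin n → Fin d → Fin r | ∃ T : SimpleGraph (Fin d),
        IsMWST (pairMI (massFn P)) T ∧ ∃ e ∈ T.edgeSet, pairMI (massFn P) e = 0 ∧
          ε n ≤ pairMI (empirical x) e} = ∅ := by
      rw [Set.eq_empty_iff_forall_notMem]
      rintro x ⟨T, hT, e, he, h0, -⟩
      rw [eq_of_isMWST_of_isTree hGt hG hT] at he
      exact ne_zero_of_mem_edgeSet (hG T hT) he h0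
    rw [hempty]
    simp [iidSetProb]
  refine h1.trans_lt ?_
  exact_mod_cast (by linarith : -(c / 2) < 0)

/-- Distributions for which `G` is not the unique tree of maximal weight or some edge of `G` has
weight zero. -/
def failureSet (r : ℕ) (G : SimpleGraph (Fin d)) : Set ((Fin d → Fin r) → ℝ) :=
  {q | q ∈ stdSimplex ℝ (Fin d → Fin r) ∧
    ((∃ T : SimpleGraph (Fin d), T.IsTree ∧ T ≠ G ∧
      graphWeight (pairMI q) G ≤ graphWeight (pairMI q) T) ∨ ∃ e ∈ G.edgeSet, pairMI q e = 0)}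

theorem continuousOn_graphWeight_pairMI (T : SimpleGraph (Fin d)) :
    ContinuousOn (fun q : (Fin d → Fin r) → ℝ => graphWeight (pairMI q) T)
      (stdSimplex ℝ (Fin d → Fin r)) :=
  continuousOn_finsetSum _ fun e _ => continuousOn_pairMI e

theorem isCompact_failureSet (G : SimpleGraph (Fin d)) : IsCompact (failureSet r G) := by
  have hΔ := isCompact_stdSimplex ℝ (Fin d → Fin r)
  have heq : failureSet r G = (⋃ T ∈ {T : SimpleGraph (Fin d) | T.IsTree ∧ T ≠ G},
      (stdSimplex ℝ (Fin d → Fin r) ∩ (fun q => graphWeight (pairMI q) T -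
        graphWeight (pairMI q) G) ⁻¹' Set.Ici 0)) ∪
      ⋃ e ∈ G.edgeSet, (stdSimplex ℝ (Fin d → Fin r) ∩ (fun q => pairMI q e) ⁻¹' {0}) := by
    ext q
    simp only [failureSet, Set.mem_ofPred_eq, Set.mem_union, Set.mem_iUnion, Set.mem_inter_iff,
      Set.mem_preimage, Set.mem_Ici, sub_nonneg, Set.mem_singleton_iff, exists_prop]
    constructor
    · rintro ⟨h, ⟨T, h1, h2, h3⟩ | ⟨e, h1, h2⟩⟩
      · exact Or.inl ⟨T, ⟨h1, h2⟩, h, h3⟩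
      · exact Or.inr ⟨e, h1, h, h2⟩
    · rintro (⟨T, ⟨h1, h2⟩, h, h3⟩ | ⟨e, h1, h, h2⟩)
      · exact ⟨h, Or.inl ⟨T, h1, h2, h3⟩⟩
      · exact ⟨h, Or.inr ⟨e, h1, h2⟩⟩
  have hclosed : IsClosed (failureSet r G) := by
    rw [heq]
    refine IsClosed.union ?_ ?_
    · exact (Set.toFinite _).isClosed_biUnion fun T _ =>
        ((continuousOn_graphWeight_pairMI T).sub
          (continuousOn_graphWeight_pairMI G)).preimage_isClosed_of_isClosed hΔ.isClosed isClosed_Ici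
    · exact (Set.toFinite _).isClosed_biUnion fun e _ =>
        (continuousOn_pairMI e).preimage_isClosed_of_isClosed hΔ.isClosed isClosed_singleton
  exact hΔ.of_isClosed_subset hclosed fun q hq => hq.1

/-- Resampling an endpoint of an edge of `G` makes the weight of that edge zero. -/
theorem failureSet_nonempty (hd : 2 ≤ d) {p : (Fin d → Fin r) → ℝ}
    (hp : p ∈ stdSimplex ℝ (Fin d → Fin r)) (hGt : G.IsTree) : (failureSet r G).Nonempty := by
  have h1 := ncard_edgeSet_add_one hGt
  obtain ⟨e, he⟩ := Set.nonempty_of_ncard_ne_zero (show G.edgeSet.ncard ≠ 0 by omega)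
  induction e with | _ k l
  have hkl : k ≠ l := SimpleGraph.Adj.ne he
  have hR := resample_mem_stdSimplex hp l
  refine ⟨resample p l, hR, Or.inr ⟨s(k, l), he, (pairMI_eq_zero_iff hR k l).2 fun a b => ?_⟩⟩
  rw [← sum_pairMarg_right (resample p l) k l, ← sum_pairMarg_left (resample p l) k l]
  simp only [pairMarg_resample_self hkl, ← Finset.mul_sum, ← Finset.sum_mul, sum_nodeMarg, hp.2]
  ring

theorem notMem_failureSet {p : (Fin d → Fin r) → ℝ} (hGt : G.IsTree)
    (hd : d ≠ 0) (hG : ∀ T : SimpleGraph (Fin d), IsMWST (pairMI p) T →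
      T.deleteEdges {e | pairMI p e = 0} = G) : p ∉ failureSet r G := by
  obtain ⟨T₀, hT₀⟩ := exists_isMWST hd (pairMI p)
  obtain rfl := eq_of_isMWST_of_isTree hGt hG hT₀
  rintro ⟨-, ⟨T, hT, hTG, hw⟩ | ⟨e, he, h0⟩⟩
  · refine hTG (eq_of_isMWST_of_isTree hGt hG ((isMWST_iff _ T).2 ⟨hT, fun S hS => ?_⟩))
    exact (((isMWST_iff _ _).1 hT₀).2 S hS).trans hw
  · exact ne_zero_of_mem_edgeSet (hG _ hT₀) he h0

/-- Distributions under which the error probability of the algorithm tends to one. -/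
def IsFailing (G : SimpleGraph (Fin d)) (q : (Fin d → Fin r) → ℝ) : Prop :=
  q ∈ stdSimplex ℝ (Fin d → Fin r) ∧
    ((∃ T : SimpleGraph (Fin d), T.IsTree ∧
      graphWeight (pairMI q) G < graphWeight (pairMI q) T) ∨ ∃ e ∈ G.edgeSet, pairMI q e = 0)

/-- At a tie the algorithm may still return `G`, so ties must be made strict. Exchange `e` for `e'`,
then mix slightly with a resampled law: w(e) drops, w(e') stays, and all other edges cancel in the
comparison. Continuity keeps the relative entropy below `c`. -/
theorem exists_isFailing_relEnt_lt {p : (Fin d → Fin r) → ℝ} (hp : ∀ x, p x ≠ 0)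
    (hGt : G.IsTree) {q : (Fin d → Fin r) → ℝ} (hq : q ∈ failureSet r G) {c : ℝ}
    (hc : relEnt q p < c) : ∃ q', IsFailing G q' ∧ relEnt q' p < c := by
  obtain ⟨hqs, ⟨T, hT, hTG, hw⟩ | h0⟩ := hq
  swap
  · exact ⟨q, ⟨hqs, Or.inr h0⟩, hc⟩
  obtain ⟨T', hT', e, he, e', he', hE, hle⟩ :=
    exists_single_exchange (pairMI q) hGt ⟨T, hT, hTG, hw⟩
  by_cases h0 : pairMI q e = 0
  · exact ⟨q, ⟨hqs, Or.inr ⟨e, he, h0⟩⟩, hc⟩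
  obtain ⟨R, hR, hmix⟩ := exists_mem_stdSimplex_pairMI_lt hqs
    (SimpleGraph.not_isDiag_of_mem_edgeSet G he) (e' := e') (by rintro rfl; exact he' he)
    ((pairMI_nonneg hqs e).lt_of_ne' h0)
  have hcont : Continuous fun t : ℝ => relEnt (fun x => (1 - t) * q x + t * R x) p :=
    (continuous_relEnt_left hp).comp (continuous_pi fun x => by fun_prop)
  have hev : ∀ᶠ t : ℝ in 𝓝 0, relEnt (fun x => (1 - t) * q x + t * R x) p < c := by
    refine (hcont.tendsto 0).eventually_lt_const ?_
    simpa using hc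
  obtain ⟨t, ht, ht0, ht1⟩ : ∃ t : ℝ, relEnt (fun x => (1 - t) * q x + t * R x) p < c ∧
      0 < t ∧ t ≤ 1 := by
    have h1 : ∀ᶠ t : ℝ in 𝓝[>] 0, t ≤ 1 :=
      eventually_nhdsWithin_of_eventually_nhds (eventually_le_nhds one_pos)
    obtain ⟨t, ⟨h2, h3⟩, h4⟩ := (((eventually_nhdsWithin_of_eventually_nhds hev).and h1).and
      eventually_mem_nhdsWithin).exists
    exact ⟨t, h2, h4, h3⟩
  obtain ⟨hlt, heq⟩ := hmix t ht0 ht1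
  refine ⟨_, ⟨?_, Or.inl ⟨T', hT', ?_⟩⟩, ht⟩
  · exact convex_stdSimplex ℝ _ hqs hR (by linarith) ht0.le (by ring)
  · rw [graphWeight_eq_of_edgeSet_eq_insert_diff _ he he' hE]
    linarith

/-- A strictly heavier tree stays heavier for typical samples. If instead an edge of `G` has weight
zero, returning `G` requires its empirical weight to reach ε_n, whose probability vanishes because
nε_n dominates log n. -/
theorem IsFailing.eventually_le_iidSetProb {q : (Fin d → Fin r) → ℝ} (hq : IsFailing G q)
    (hGt : G.IsTree) {ε : ℕ → ℝ} (hε : IsRegularization ε)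
    {Ehat : (n : ℕ) → (Fin n → Fin d → Fin r) → Set (Sym2 (Fin d))} (hE : IsCLThres ε Ehat)
    {θ : ℝ} (hθ : θ < 1) :
    ∀ᶠ n : ℕ in atTop, θ ≤ iidSetProb q {x : Fin n → Fin d → Fin r | Ehat n x ≠ G.edgeSet} := by
  obtain ⟨hqs, ⟨T, hT, hlt⟩ | ⟨e, he, h0⟩⟩ := hq
  · have hδ : 0 < (graphWeight (pairMI q) T - graphWeight (pairMI q) G) /
        (2 * Fintype.card (Sym2 (Fin d)) + 1 : ℝ) := by
      have := sub_pos.2 hlt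
      positivity
    obtain ⟨c, hc, hconc⟩ := exists_iidSetProb_le_of_pairMI hqs hδ
    filter_upwards [eventually_ne_atTop 0, eventually_pow_mul_exp_le_const
      (tendsto_natCast_mul_div_log hc) (Fintype.card (Fin d → Fin r)) (sub_pos.2 hθ)] with n hn hexp
    have h1 := iidSetProb_compl hqs.2 {x : Fin n → Fin d → Fin r | Ehat n x ≠ G.edgeSet}
    have h2 := hconc n hn {x : Fin n → Fin d → Fin r | Ehat n x ≠ G.edgeSet}ᶜ fun x hx => by
      by_contra! hcon
      have hx' : Ehat n x = G.edgeSet := by simpa using hx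
      have h3 := hE n x
      rw [hx'] at h3
      exact absurd ((h3.of_eq_tree hGt).1 T hT)
        (not_le.2 (graphWeight_lt_of_abs_sub_lt hcon le_rfl hlt))
    linarith
  · filter_upwards [eventually_ne_atTop 0, eventually_pow_mul_exp_le_const
      hε.2 (Fintype.card (Fin d → Fin r)) (sub_pos.2 hθ)] with n hn hexp
    have h1 := iidSetProb_compl hqs.2 {x : Fin n → Fin d → Fin r | Ehat n x ≠ G.edgeSet}
    have h2 := iidSetProb_le_of_le_pairMI hqs hn (ε := ε n)
      (A := {x : Fin n → Fin d → Fin r | Ehat n x ≠ G.edgeSet}ᶜ) fun x hx => by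
      have hx' : Ehat n x = G.edgeSet := by simpa using hx
      have h3 := hE n x
      rw [hx'] at h3
      exact ⟨e, h0, (h3.of_eq_tree hGt).2 e he⟩
    linarith

theorem exists_tendsto_logErr (hd : 2 ≤ d) (hpos : ∀ x, 0 < massFn P x) (hGt : G.IsTree)
    (hG : ∀ T : SimpleGraph (Fin d), IsMWST (pairMI (massFn P)) T →
      T.deleteEdges {e | pairMI (massFn P) e = 0} = G) {ε : ℕ → ℝ} (hε : IsRegularization ε)
    {Ehat : (n : ℕ) → (Fin n → Fin d → Fin r) → Set (Sym2 (Fin d))} (hE : IsCLThres ε Ehat) :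
    ∃ L : ℝ, L < 0 ∧ Tendsto (fun n : ℕ => ((1 / n : ℝ) : EReal) * logErr P G Ehat n) atTop
      (𝓝 (L : EReal)) := by
  have hp : massFn P ∈ stdSimplex ℝ _ := massFn_mem_stdSimplex P
  set p := massFn P with hpdef
  have hp0 : ∀ x, p x ≠ 0 := fun x => (hpos x).ne'
  have hac : ∀ (q : (Fin d → Fin r) → ℝ) x, p x = 0 → q x = 0 := fun q x h => absurd h (hp0 x)
  have hcont := continuous_relEnt_left hp0
  obtain ⟨q₀, hq₀, hmin⟩ := (isCompact_failureSet G).exists_isMinOn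
    (failureSet_nonempty hd hp hGt) hcont.continuousOn
  set K := relEnt q₀ p with hK
  have hKmin : ∀ q ∈ failureSet r G, K ≤ relEnt q p := fun q hq => hmin hq
  -- Zero relative entropy would put P itself in the failure set.
  have hKpos : 0 < K := by
    by_contra! hcon
    refine notMem_failureSet hGt (by omega) hG (?_ : p ∈ failureSet r G)
    have : q₀ = p := by
      funext x
      have h1 := sq_sub_le_relEnt hq₀.1 hp (hac q₀) x
      have h2 : (q₀ x - p x) ^ 2 = 0 := le_antisymm (by linarith) (sq_nonneg _)
      exact sub_eq_zero.1 (pow_eq_zero_iff two_ne_zero |>.1 h2)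
    exact this ▸ hq₀
  have hupper : ∀ c', c' < K → ∀ᶠ n : ℕ in atTop,
      ((1 / n : ℝ) : EReal) * logErr P G Ehat n ≤ ((-c' : ℝ) : EReal) := by
    intro c' hc'
    obtain ⟨c, hc1, hc2⟩ := exists_between (max_lt hc' hKpos)
    have hc0 : 0 < c := (le_max_right _ _).trans_lt hc1
    refine eventually_logErr_le_of_le (N := Fintype.card (Fin d → Fin r)) hc0
      ((le_max_left _ _).trans_lt hc1) ?_
    -- on the sublevel set of the relative entropy all edges of `G` have weight bounded below
    have hcomp : IsCompact (stdSimplex ℝ (Fin d → Fin r) ∩ {q | relEnt q p ≤ c}) :=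
      (isCompact_stdSimplex ℝ _).inter_right (isClosed_le hcont continuous_const)
    have hδe : ∀ e ∈ G.edgeSet, ∃ δ > 0, ∀ q ∈ stdSimplex ℝ (Fin d → Fin r), relEnt q p ≤ c →
        δ ≤ pairMI q e := by
      intro e he
      rcases (stdSimplex ℝ (Fin d → Fin r) ∩ {q | relEnt q p ≤ c}).eq_empty_or_nonempty
        with h0 | hne
      · refine ⟨1, one_pos, fun q hq hqc => ?_⟩
        exact absurd (show q ∈ _ ∩ {q | relEnt q p ≤ c} from ⟨hq, hqc⟩)
          (Set.eq_empty_iff_forall_notMem.1 h0 q)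
      · obtain ⟨q₁, hq₁, hq₁min⟩ := hcomp.exists_isMinOn hne
          ((continuousOn_pairMI e).mono Set.inter_subset_left)
        refine ⟨pairMI q₁ e, (pairMI_nonneg hq₁.1 e).lt_of_ne' fun h0 => ?_, fun q hq hqc =>
          hq₁min ⟨hq, hqc⟩⟩
        have h1 := hKmin q₁ ⟨hq₁.1, Or.inr ⟨e, he, h0⟩⟩
        have h2 : relEnt q₁ p ≤ c := hq₁.2
        linarith
    choose! δ hδ0 hδ using hδe
    have hεδ : ∀ᶠ n : ℕ in atTop, ∀ e ∈ G.edgeSet, ε n < δ e := by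
      rw [eventually_all_finite (Set.toFinite _)]
      exact fun e he => hε.1.eventually_lt_const (hδ0 e he)
    filter_upwards [hεδ, eventually_ne_atTop 0] with n hn hn0
    refine iidSetProb_le_of_le_relEnt hn0 hp.1 fun x hx _ => ?_
    have hxs := empirical_mem_stdSimplex hn0 x
    by_contra! hcon
    rcases (hE n x).of_ne_tree hGt hx with h | ⟨e, he, hle⟩
    · have := hKmin _ ⟨hxs, Or.inl h⟩
      linarith
    · have h1 := hδ e he _ hxs hcon.le
      have h2 := hn e he
      linarith
  have hlower : ∀ c, K < c → ∀ᶠ n : ℕ in atTop,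
      ((-c : ℝ) : EReal) ≤ ((1 / n : ℝ) : EReal) * logErr P G Ehat n := by
    intro c hc
    -- The approximating law costs less than K + η and log 2 is at most nη; with success probability
    -- θ = (K + 2η)/c < 1 the total exponent is (K + 2η)/θ = c.
    set η := (c - K) / 3 with hη
    have hη0 : 0 < η := by rw [hη]; linarith
    obtain ⟨q, hq, hqc⟩ := exists_isFailing_relEnt_lt hp0 hGt hq₀ (show relEnt q₀ p < K + η by
      linarith)
    have hc0 : 0 < c := hKpos.trans hc
    have hlog : ∀ᶠ n : ℕ in atTop, Real.log 2 ≤ n * η := by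
      filter_upwards [tendsto_natCast_atTop_atTop.eventually_ge_atTop (Real.log 2 / η)] with n hn
      rwa [div_le_iff₀ hη0] at hn
    have hθ1 : (K + 2 * η) / c < 1 := by
      rw [div_lt_one hc0]
      linarith
    filter_upwards [hq.eventually_le_iidSetProb hGt hε hE hθ1, hlog, eventually_ne_atTop 0]
      with n hn hl hn0
    have hnpos : (0 : ℝ) < n := by positivity
    have hθ0 : 0 < (K + 2 * η) / c := by positivity
    rw [logErr_eq]
    refine le_mul_log (by positivity) (le_log_iidSetProb hp hq.1 (hac q) hθ0 hn) ?_
    rw [mul_neg, neg_le_neg_iff, one_div, inv_mul_eq_div, div_le_iff₀ hnpos, div_le_iff₀ hθ0]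
    have h1 : c * n * ((K + 2 * η) / c) = n * (K + 2 * η) := by field_simp
    rw [h1]
    nlinarith
  refine ⟨-K, by linarith, tendsto_order.2 ⟨fun a ha => ?_, fun a ha => ?_⟩⟩
  · obtain ⟨z, hz1, hz2⟩ := EReal.lt_iff_exists_real_btwn.1 ha
    have hz : z < -K := by exact_mod_cast hz2
    filter_upwards [hlower (-z) (by linarith)] with n hn
    rw [neg_neg] at hn
    exact hz1.trans_le hn
  · obtain ⟨z, hz1, hz2⟩ := EReal.lt_iff_exists_real_btwn.1 ha
    have hz : -K < z := by exact_mod_cast hz1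
    filter_upwards [hupper (-z) (by linarith)] with n hn
    rw [neg_neg] at hn
    exact hn.trans_lt hz2

end Asymptotics

end ForestLearning

theorem mainTheorem7 (d r : ℕ) (hd : 2 ≤ d) (hr : 2 ≤ r)
    (P : Measure (Fin d → Fin r)) [IsProbabilityMeasure P]
    (hP : ForestLearning.PairwisePositive P)
    (Pt : Measure (Fin d → Fin r)) (G : SimpleGraph (Fin d))
    (hPt : ForestLearning.IsMinimalForestProjection P Pt G)
    (huniq : ∀ (Q : Measure (Fin d → Fin r)) (G' : SimpleGraph (Fin d)),
      ForestLearning.IsMinimalForestProjection P Q G' → G' = G) :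
    (¬ G.IsTree → ∃ C : ℝ, 1 < C ∧
      ∀ ε : ℕ → ℝ, ForestLearning.IsRegularization ε →
      ∀ Ehat : (n : ℕ) → (Fin n → Fin d → Fin r) → Set (Sym2 (Fin d)),
      ForestLearning.IsCLThres ε Ehat →
        ((-C : ℝ) : EReal) ≤
            liminf (fun n : ℕ =>
              ((1 / (n * ε n) : ℝ) : EReal) * ForestLearning.logErr P G Ehat n) atTop ∧
          limsup (fun n : ℕ =>
            ((1 / (n * ε n) : ℝ) : EReal) * ForestLearning.logErr P G Ehat n) atTop ≤ -1) ∧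
    (G.IsTree →
      ∀ ε : ℕ → ℝ, ForestLearning.IsRegularization ε →
      ∀ Ehat : (n : ℕ) → (Fin n → Fin d → Fin r) → Set (Sym2 (Fin d)),
      ForestLearning.IsCLThres ε Ehat →
        limsup (fun n : ℕ =>
          ((1 / n : ℝ) : EReal) * ForestLearning.logErr P G Ehat n) atTop < 0 ∧
        ((∀ x, 0 < P.real {x}) → ∃ L : ℝ, L < 0 ∧
          Tendsto (fun n : ℕ =>
            ((1 / n : ℝ) : EReal) * ForestLearning.logErr P G Ehat n) atTop (𝓝 (L : EReal)))) := by
  have hp := ForestLearning.positiveMarginals_massFn hd hP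
  have hG := fun (T : SimpleGraph (Fin d)) hT =>
    ForestLearning.deleteEdges_zero_eq_of_isMWST hd hP hPt huniq (T := T) hT
  refine ⟨fun hGt => ?_, fun hGt ε hε Ehat hE =>
    ⟨ForestLearning.limsup_logErr_neg hp.mem hGt hG hε hE, fun hpos =>
      ForestLearning.exists_tendsto_logErr hd hpos hGt hG hε hE⟩⟩
  have hacyc : G.IsAcyclic := hPt.1.1.acyclic
  -- An acyclic graph that is not a tree is disconnected.
  obtain ⟨a, b, hab⟩ : ∃ a b, ¬ G.Reachable a b := by
    by_contra! hcon
    have : Nonempty (Fin d) := ⟨⟨0, by omega⟩⟩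
    exact hGt ⟨⟨hcon⟩, hacyc⟩
  -- A pair of positive weight is connected by the positive edges of a maximum-weight spanning tree,
  -- and these form `G`.
  have h0 : ForestLearning.pairMI (ForestLearning.massFn P) s(a, b) = 0 := by
    by_contra hne
    obtain ⟨T, hT⟩ := ForestLearning.exists_isMWST (by omega)
      (ForestLearning.pairMI (ForestLearning.massFn P))
    have hw := ForestLearning.pairMI_nonneg hp.mem
    have := ForestLearning.reachable_deleteEdges_zero hw hT ((hw _).lt_of_ne' hne)
      (fun h => hab (h ▸ SimpleGraph.Reachable.refl a))
    rw [hG T hT] at this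
    exact hab this
  obtain ⟨C, hC, hlow⟩ := ForestLearning.exists_forall_le_logErr hr hp hab h0
  exact ⟨C, hC, fun ε hε Ehat hE => ⟨le_liminf_of_le (h := hlow ε hε Ehat hE),
    ForestLearning.limsup_logErr_le_neg_one hp.mem hG hε hE⟩⟩
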